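/- Let $n \ge 2$, let $F_n$ be the free group on $x_1,\dots,x_n$, let $H_{\mathbb Z} = F_n^{\mathrm{ab}}$, and let $IA_n$ be the kernel of the homomorphism $|\cdot| : \mathrm{Aut}(F_n) \to GL(H_{\mathbb Z})$ induced by abelianization. Let $\bar\Gamma \subset GL(H_{\mathbb Z})$ be a subgroup and $\Gamma \subset \mathrm{Aut}(F_n)$ its preimage. Then $|\cdot|$ restricts to a surjection $\pi : \Gamma \to \bar\Gamma$ with kernel $IA_n$, and for modules $M$ over $\mathbb Z[\tfrac12][\bar\Gamma]$ the following hold, where $M$ is regarded as a $\Gamma$-module via $\pi$. (1) For the Lyndon–Hochschild–Serre spectral sequence $E_2^{p,q} = H^p(\bar\Gamma; H^q(IA_n; M)) \Rightarrow H^{p+q}(\Gamma; M)$ of the extension $IA_n \to \Gamma \to \bar\Gamma$ (that of the Hochschild–Serre filtration of the cochain complex of $\Gamma$), under the canonical identifications of $E_2^{p,1}$ and $E_2^{p+2,0}$, one has for every $p \ge 0$ $$d_2^{p,1} = 0 : H^p(\bar\Gamma; H^1(IA_n; M)) \to H^{p+2}(\bar\Gamma; M).$$ (2) There is an isomorphism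 of $\mathbb Z[\tfrac12]$-modules, natural in $M$, $$\mathrm{Hom}_{\mathbb Z}(H_{\mathbb Z}^* \otimes \Lambda^2 H_{\mathbb Z}, M)^{\bar\Gamma} \oplus H^1(\bar\Gamma; M) \;\cong\; H^1(\Gamma; M).$$ On $H^1(\bar\Gamma; M)$ it is the inflation $\pi^*$. The image of $u \in \mathrm{Hom}_{\mathbb Z}(H_{\mathbb Z}^* \otimes \Lambda^2 H_{\mathbb Z}, M)^{\bar\Gamma}$ restricts on $IA_n$ to the class of the homomorphism $u \circ \tau_1 : IA_n \to M$. Here $\tau_1 : IA_n \to H_{\mathbb Z}^* \otimes \Lambda^2 H_{\mathbb Z}$ is the first Johnson homomorphism: regarding $\Lambda^2 H_{\mathbb Z} \subset H_{\mathbb Z}^{\otimes 2}$ via $a \wedge b \mapsto a \otimes b - b \otimes a$, one has $\tau_1(\varphi) = \sum_i \ell_i \otimes (\theta_2(\varphi(x_i)) - \theta_2(x_i))$, where $(\ell_i)$ is the basis of $H_{\mathbb Z}^*$ dual to $X_i = [x_i]$ and $\theta_2 : F_n \to H_{\mathbb Z}^{\otimes 2}$ is the degree-two part of the standard Magnus expansion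 $x_i \mapsto 1 + X_i$. -/

import Mathlib

open CategoryTheory TensorProduct

noncomputable section

/-! ## The spectral sequence of a filtered cochain complex -/

/-- A decreasing filtration `C = F⁰ ⊇ F¹ ⊇ F² ⊇ …` of a cochain complex by subcomplexes. -/
structure CochainFiltration {k : Type} [CommRing k] (C : CochainComplex (ModuleCat.{0} k) ℕ) where
  F : ℕ → (n : ℕ) → Submodule k (C.X n)
  F_zero : ∀ n, F 0 n = ⊤
  F_anti : ∀ p n, F (p + 1) n ≤ F p n
  d_mem : ∀ p n x, x ∈ F p n → (C.d n (n + 1)).hom x ∈ F p (n + 1)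

namespace CochainFiltration

variable {k : Type} [CommRing k] {C : CochainComplex (ModuleCat.{0} k) ℕ}
  (𝓕 : CochainFiltration C)

/-- `Z_r^{p,n-p} = {x ∈ F^p C^n | dx ∈ F^{p+r} C^{n+1}}`; the second index is the total degree. -/
def Z (r p n : ℕ) : Submodule k (C.X n) :=
  𝓕.F p n ⊓ (𝓕.F (p + r) (n + 1)).comap (C.d n (n + 1)).hom

/-- `B_r^{p,n-p} = Z_{r-1}^{p+1,n-p-1} + (F^p C^n ∩ d F^{p-r+1} C^{n-1})` for `r ≥ 1`. The
truncated subtractions are harmless: a negative filtration degree means `F^0 = C`, and for `n = 0`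
the map `C.d (n - 1) n` is zero. -/
def B (r p n : ℕ) : Submodule k (C.X n) :=
  𝓕.Z (r - 1) (p + 1) n ⊔
    (𝓕.F p n ⊓ (𝓕.F (p + 1 - r) (n - 1)).map (C.d (n - 1) n).hom)

/-- The term `E_r^{p,n-p} = Z_r^{p,n-p} / B_r^{p,n-p}` of the spectral sequence of a filtered
complex (`r ≥ 1`); the index `n` is the total degree. -/
abbrev E (r p n : ℕ) : Type := 𝓕.Z r p n ⧸ (𝓕.B r p n).submoduleOf (𝓕.Z r p n)

lemma F_le_of_le {p q : ℕ} (h : p ≤ q) (n : ℕ) : 𝓕.F q n ≤ 𝓕.F p n := by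
  induction h with
  | refl => exact le_rfl
  | step _ ih => exact (𝓕.F_anti _ n).trans ih

lemma d_d (i j l : ℕ) (x : C.X i) : (C.d j l).hom ((C.d i j).hom x) = 0 := by
  have := C.d_comp_d i j l
  rw [← ModuleCat.comp_apply, this]
  rfl

/-- The differential of `C` as a map `Z_r^{p,q} → Z_r^{p+r,q-r+1}`. -/
def dZ (r p n : ℕ) : 𝓕.Z r p n →ₗ[k] 𝓕.Z r (p + r) (n + 1) :=
  (C.d n (n + 1)).hom.restrict fun x hx => by
    refine ⟨hx.2, ?_⟩
    have h0 : (C.d (n + 1) (n + 1 + 1)).hom ((C.d n (n + 1)).hom x) = 0 := d_d _ _ _ x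
    change (C.d (n + 1) (n + 1 + 1)).hom ((C.d n (n + 1)).hom x) ∈ 𝓕.F (p + r + r) (n + 1 + 1)
    rw [h0]
    exact zero_mem _

/-- The differential `d_r : E_r^{p,q} → E_r^{p+r,q-r+1}`, induced by the differential of `C`
(`r ≥ 1`). -/
def dE (r p n : ℕ) : 𝓕.E r p n →ₗ[k] 𝓕.E r (p + r) (n + 1) :=
  Submodule.mapQ _ _ (𝓕.dZ r p n) <| by
    rintro ⟨x, hx⟩ hxB
    simp only [Submodule.mem_comap, Submodule.submoduleOf, Submodule.subtype_apply] at hxB ⊢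
    obtain ⟨y, hy, z, hz, rfl⟩ := Submodule.mem_sup.1 hxB
    refine Submodule.mem_sup_right ⟨?_, y, ?_, ?_⟩
    · exact (𝓕.dZ r p n ⟨y + z, hx⟩).2.1
    · have : p + r + 1 - r = p + 1 := by omega
      simpa [this] using hy.1
    · obtain ⟨-, w, -, rfl⟩ := hz
      change (C.d n (n + 1)).hom y = (C.d n (n + 1)).hom (y + _)
      rw [map_add, d_d, add_zero]

end CochainFiltration

/-! ## The Lyndon–Hochschild–Serre spectral sequence of a group extension -/

namespace LHS

variable {k G Q : Type} [CommRing k] [Group G] [Group Q]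

/-- The Hochschild–Serre filtration of the complex of inhomogeneous cochains of `G`, for
`π : G → Q`: a cochain `f(g₁, …, gₙ)` lies in `F^p C^n` if it depends only on `g₁, …, g_{n-p}` and
on the classes `π g_{n-p+1}, …, π gₙ`; moreover `F^p C^n = 0` for `p > n`. -/
def filtration (π : G →* Q) (A : Rep.{0} k G) :
    CochainFiltration (groupCohomology.inhomogeneousCochains A) where
  F p n :=
    { carrier := {f : (Fin n → G) → A | (n < p → f = 0) ∧
        ∀ g g' : Fin n → G, (∀ i : Fin n, (i : ℕ) < n - p → g i = g' i) →
          (∀ i, π (g i) = π (g' i)) → f g = f g'}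
      add_mem' := by
        rintro a b ⟨ha, ha'⟩ ⟨hb, hb'⟩
        refine ⟨fun h => by rw [ha h, hb h, add_zero], fun g g' h h' => ?_⟩
        exact congrArg₂ (· + ·) (ha' g g' h h') (hb' g g' h h')
      zero_mem' := ⟨fun _ => rfl, fun _ _ _ _ => rfl⟩
      smul_mem' := by
        rintro c a ⟨ha, ha'⟩
        refine ⟨fun h => by rw [ha h, smul_zero], fun g g' h h' => ?_⟩
        exact congrArg (c • ·) (ha' g g' h h') }
  F_zero n := by
    refine eq_top_iff.2 fun f _ => ⟨fun h => absurd h (by omega), fun g g' h _ => ?_⟩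
    exact congrArg f (funext fun i => h i (by simp))
  F_anti p n := by
    rintro f ⟨hf, hf'⟩
    refine ⟨fun h => hf (by omega), fun g g' h h' => hf' g g' (fun i hi => h i (by omega)) h'⟩
  d_mem p n := by
    rintro f ⟨hf, hf'⟩
    rw [groupCohomology.inhomogeneousCochains.d_def]
    change (n + 1 < p → (inhomogeneousCochains.d A n).hom f = 0) ∧ _
    refine ⟨fun h => by rw [hf (by omega), map_zero], fun g g' h h' => ?_⟩
    by_cases hn : n < p
    · rw [hf hn, map_zero]
      rfl
    · change (inhomogeneousCochains.d A n).hom f g = (inhomogeneousCochains.d A n).hom f g'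
      rw [inhomogeneousCochains.d_hom_apply, inhomogeneousCochains.d_hom_apply]
      congr 1
      · rw [h 0 (by simp; omega),
          hf' (fun i => g i.succ) (fun i => g' i.succ)
            (fun i hi => h _ (by simp; omega)) (fun i => h' _)]
      · refine Finset.sum_congr rfl fun j _ => ?_
        congr 1
        refine hf' _ _ (fun i hi => ?_) (fun i => ?_)
        · simp only [Fin.contractNth]
          rw [h i.castSucc (by simp; omega), h i.succ (by simp; omega)]
        · simp only [Fin.contractNth]
          split_ifs <;> simp [h']

/-- The restriction to `ker π` of the inflation along `π` of a `Q`-module. -/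
abbrev kerRes (π : G →* Q) (M : Rep.{0} k Q) : Rep.{0} k π.ker :=
  Rep.res π.ker.subtype (Rep.res π M)

/-- Conjugation `x ↦ g⁻¹ x g` on `ker π`. -/
def kerConj (π : G →* Q) (g : G) : π.ker →* π.ker :=
  (MulAut.conjNormal g⁻¹ : MulAut π.ker).toMonoidHom

lemma kerConj_coe (π : G →* Q) (g : G) (x : π.ker) : (kerConj π g x : G) = g⁻¹ * x * g := by
  simp [kerConj]

/-- The action of `g ∈ G` on the coefficients, compatible with conjugation on `ker π`. -/
def kerCoeff (π : G →* Q) (M : Rep.{0} k Q) (g : G) :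
    Rep.res (kerConj π g) (kerRes π M) ⟶ kerRes π M :=
  Rep.ofHom ⟨M.ρ (π g), fun x => by
    ext m
    have h1 : π (kerConj π g x : G) = 1 := (kerConj π g x).2
    have h2 : π (x : G) = 1 := x.2
    simp [h1, h2]⟩

/-- The action of `g ∈ G` on `H¹(ker π; M)`: on cocycles, `(g · c)(x) = g · c(g⁻¹ x g)`. -/
def conjAct (π : G →* Q) (M : Rep.{0} k Q) (g : G) :
    groupCohomology (kerRes π M) 1 →ₗ[k] groupCohomology (kerRes π M) 1 :=
  (groupCohomology.map (kerConj π g) (kerCoeff π M g) 1).hom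

lemma conjAct_mul (π : G →* Q) (M : Rep.{0} k Q) (g h : G) :
    conjAct π M (g * h) = conjAct π M g ∘ₗ conjAct π M h := by
  have := groupCohomology.map_comp (kerConj π h) (kerConj π g) (kerCoeff π M h) (kerCoeff π M g) 1
  rw [conjAct, conjAct, conjAct, ← ModuleCat.hom_comp, ← this]
  congr 1
  refine groupCohomology.map_congr ?_ ?_ 1
  · ext x
    simp [kerConj_coe, mul_assoc]
  · ext m
    simp [kerCoeff]

lemma conjAct_of_mem (π : G →* Q) (M : Rep.{0} k Q) (g : G) (hg : π g = 1) :
    conjAct π M g = LinearMap.id := by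
  ext x
  induction x using groupCohomology.H1_induction_on with
  | h c =>
    have h1 : conjAct π M g (groupCohomology.H1π _ c) = groupCohomology.H1π _
        (groupCohomology.mapCocycles₁ (kerConj π g) (kerCoeff π M g) c) :=
      groupCohomology.H1π_comp_map_apply (kerConj π g) (kerCoeff π M g) c
    rw [h1, LinearMap.id_apply]
    congr 1
    refine groupCohomology.cocycles₁_ext fun x => ?_
    have hc := (groupCohomology.mem_cocycles₁_iff (c : π.ker → _)).1 c.2
    have htriv : ∀ (y : π.ker) (m : M), (kerRes π M).ρ y m = m := fun y m => by
      have h2 : π (y : G) = 1 := y.2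
      simp [h2]
    have hmul : ∀ a b : π.ker, c (a * b) = c b + c a := fun a b => by
      have := hc a b
      rwa [htriv] at this
    obtain ⟨y, hy⟩ : ∃ y : π.ker, (y : G) = g := ⟨⟨g, hg⟩, rfl⟩
    have hx : kerConj π g x = y⁻¹ * x * y :=
      Subtype.ext (by simp [kerConj_coe, hy])
    have h3 : c (kerConj π g x) = c x := by
      have h4 : c (y⁻¹ * y) = c y + c y⁻¹ := hmul _ _
      rw [inv_mul_cancel, groupCohomology.cocycles₁_map_one] at h4
      rw [hx, hmul, hmul, add_left_comm, ← h4, add_zero]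
    change M.ρ (π g) (c (kerConj π g x)) = c x
    rw [hg, h3, map_one]
    rfl

lemma conjAct_congr (π : G →* Q) (M : Rep.{0} k Q) (g g' : G) (h : π g = π g') :
    conjAct π M g = conjAct π M g' := by
  have : g = g' * (g'⁻¹ * g) := by group
  rw [this, conjAct_mul, conjAct_of_mem π M (g'⁻¹ * g) (by simp [h]), LinearMap.comp_id]

/-- The `Q`-module `H¹(ker π; M)`, for a surjection `π : G → Q` and a `Q`-module `M`. -/
def kerH1 (π : G →* Q) (hπ : Function.Surjective π) (M : Rep.{0} k Q) : Rep.{0} k Q :=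
  Rep.of (X := groupCohomology (kerRes π M) 1)
    { toFun := fun q => conjAct π M (Function.surjInv hπ q)
      map_one' := conjAct_of_mem π M _ (Function.surjInv_eq hπ 1)
      map_mul' := fun q r => by
        rw [Module.End.mul_eq_comp, ← conjAct_mul]
        exact conjAct_congr π M _ _ (by simp [Function.surjInv_eq hπ]) }

/-- The Lyndon–Hochschild–Serre spectral sequence of `ker π → G → Q` with coefficients in (the
inflation of) a `Q`-module `M`. `LHS.E π M r p n` is the term `E_r^{p,n-p}`. -/
abbrev E (π : G →* Q) (M : Rep.{0} k Q) (r p n : ℕ) : Type :=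
  (filtration π (Rep.res π M)).E r p n

/-- The differential `d_r^{p,n-p} : E_r^{p,n-p} → E_r^{p+r,n-p-r+1}`. -/
abbrev d (π : G →* Q) (M : Rep.{0} k Q) (r p n : ℕ) : E π M r p n →ₗ[k] E π M r (p + r) (n + 1) :=
  (filtration π (Rep.res π M)).dE r p n

/-- The class in `E_r^{p,n-p}` of an element of `Z_r^{p,n-p}`. -/
abbrev E.mk (π : G →* Q) (M : Rep.{0} k Q) (r p n : ℕ) :
    (filtration π (Rep.res π M)).Z r p n →ₗ[k] E π M r p n :=
  Submodule.mkQ _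

/-- The canonical identification `E_2^{p,1} ≅ H^p(Q; H¹(ker π; M))`: the class of a cochain
`F(g₁, …, g_{p+1})` corresponds to the class of the cocycle `f` whose value at `(π g₁, …, π g_p)` is
the class of `x ↦ F(x, g₁, …, g_p) - F(1, g₁, …, g_p)` in `H¹(ker π; M)`. (The subtracted term is
zero for normalized cochains.) -/
def IsEdgeOne (π : G →* Q) (hπ : Function.Surjective π) (M : Rep.{0} k Q) (p : ℕ)
    (e : E π M 2 p (p + 1) ≃ₗ[k] groupCohomology (kerH1 π hπ M) p) : Prop :=
  ∀ (F : (Fin (p + 1) → G) → M) (hF : F ∈ (filtration π (Rep.res π M)).Z 2 p (p + 1))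
    (f : (Fin p → Q) → kerH1 π hπ M)
    (hf : inhomogeneousCochains.d (kerH1 π hπ M) p f = 0),
    (∀ g : Fin p → G, ∃ c : groupCohomology.cocycles₁ (kerRes π M),
      (∀ x : π.ker, c x = F (Fin.cons (x : G) g) - F (Fin.cons 1 g)) ∧
        f (fun i => π (g i)) = groupCohomology.H1π (kerRes π M) c) →
    e (E.mk π M 2 p (p + 1) ⟨F, hF⟩) =
      groupCohomology.π (kerH1 π hπ M) p (groupCohomology.cocyclesMk f hf)

/-- The canonical identification `E_2^{p,0} ≅ H^p(Q; M)`: the class of the inflation of a cocycle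
`f` of `Q` corresponds to the class of `f`. -/
def IsEdgeZero (π : G →* Q) (M : Rep.{0} k Q) (p : ℕ)
    (e : E π M 2 p p ≃ₗ[k] groupCohomology M p) : Prop :=
  ∀ (f : (Fin p → Q) → M) (hf : inhomogeneousCochains.d M p f = 0)
    (hF : (fun g : Fin p → G => f (fun i => π (g i))) ∈ (filtration π (Rep.res π M)).Z 2 p p),
    e (E.mk π M 2 p p ⟨_, hF⟩) = groupCohomology.π M p (groupCohomology.cocyclesMk f hf)

end LHS

/-! ## Automorphisms of free groups -/

namespace AutFree

variable {n : ℕ}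

/-- The free group `F_n`. -/
abbrev F (n : ℕ) : Type := FreeGroup (Fin n)

/-- `H_ℤ = F_n^{ab}`, written additively. -/
abbrev H (n : ℕ) : Type := Additive (Abelianization (F n))

/-- The class `[γ] ∈ H_ℤ` of `γ ∈ F_n`. -/
def cls (γ : F n) : H n := Additive.ofMul (Abelianization.of γ)

lemma cls_mul (γ δ : F n) : cls (γ * δ) = cls γ + cls δ := by simp [cls]

/-- The action of `Aut(F_n)` on `H_ℤ`. -/
def absEnd (n : ℕ) : MulAut (F n) →* Module.End ℤ (H n) where
  toFun φ := (Abelianization.map φ.toMonoidHom).toAdditive.toIntLinearMap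
  map_one' := by
    ext x
    induction x using Additive.rec with | _ x =>
    obtain ⟨x, rfl⟩ := QuotientGroup.mk_surjective x
    rfl
  map_mul' φ ψ := by
    ext x
    induction x using Additive.rec with | _ x =>
    obtain ⟨x, rfl⟩ := QuotientGroup.mk_surjective x
    rfl

/-- The homomorphism `|·| : Aut(F_n) → GL(H_ℤ)` induced by the abelianization. -/
def abs (n : ℕ) : MulAut (F n) →* LinearMap.GeneralLinearGroup ℤ (H n) := (absEnd n).toHomUnits

lemma abs_cls (φ : MulAut (F n)) (γ : F n) : (abs n φ : Module.End ℤ (H n)) (cls γ) = cls (φ γ) :=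
  rfl

/-- `IA_n`, the kernel of `Aut(F_n) → GL(H_ℤ)`. -/
abbrev IA (n : ℕ) : Subgroup (MulAut (F n)) := (abs n).ker

/-- `H_ℤ^* ⊗ Λ² H_ℤ`. -/
abbrev T (n : ℕ) : Type := Module.Dual ℤ (H n) ⊗[ℤ] ⋀[ℤ]^2 (H n)

/-- The standard representation of `GL(H_ℤ)`. -/
def std (n : ℕ) : Representation ℤ (LinearMap.GeneralLinearGroup ℤ (H n)) (H n) :=
  Units.coeHom (Module.End ℤ (H n))

/-- The second exterior power of the standard representation. -/
def extSq (n : ℕ) : Representation ℤ (LinearMap.GeneralLinearGroup ℤ (H n)) (⋀[ℤ]^2 (H n)) where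
  toFun A := exteriorPower.map 2 (A : Module.End ℤ (H n))
  map_one' := exteriorPower.map_id
  map_mul' A B := by
    rw [Units.val_mul, Module.End.mul_eq_comp, Module.End.mul_eq_comp, exteriorPower.map_comp]

/-- The representation of `GL(H_ℤ)` on `H_ℤ^* ⊗ Λ² H_ℤ`. -/
def repT (n : ℕ) : Representation ℤ (LinearMap.GeneralLinearGroup ℤ (H n)) (T n) :=
  (std n).dual.tprod (extSq n)

/-! ### The first Johnson homomorphism -/

/-- The group `1 + H_ℤ + H_ℤ^{⊗2}` of units of the tensor algebra of `H_ℤ` modulo tensors of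
degree `≥ 3`. -/
@[ext]
structure Magnus (n : ℕ) where
  one : H n
  two : H n ⊗[ℤ] H n

namespace Magnus

instance : Mul (Magnus n) := ⟨fun a b => ⟨a.one + b.one, a.two + b.two + a.one ⊗ₜ b.one⟩⟩

instance : One (Magnus n) := ⟨⟨0, 0⟩⟩

instance : Inv (Magnus n) := ⟨fun a => ⟨-a.one, -a.two + a.one ⊗ₜ a.one⟩⟩

@[simp] lemma mul_one' (a b : Magnus n) : (a * b).one = a.one + b.one := rfl

@[simp] lemma mul_two (a b : Magnus n) :
    (a * b).two = a.two + b.two + a.one ⊗ₜ b.one := rfl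

@[simp] lemma one_one : (1 : Magnus n).one = 0 := rfl

@[simp] lemma one_two : (1 : Magnus n).two = 0 := rfl

@[simp] lemma inv_one' (a : Magnus n) : (a⁻¹).one = -a.one := rfl

@[simp] lemma inv_two (a : Magnus n) : (a⁻¹).two = -a.two + a.one ⊗ₜ a.one := rfl

instance : Group (Magnus n) :=
  Group.ofLeftAxioms
    (fun a b c => by
      ext
      · simp [add_assoc]
      · simp only [mul_two, mul_one', add_tmul, tmul_add]
        abel)
    (fun a => by ext <;> simp)
    (fun a => by
      ext
      · simp
      · simp [neg_tmul])

end Magnus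

/-- The standard Magnus expansion `x_i ↦ 1 + X_i` modulo tensors of degree `≥ 3`. -/
def magnus (n : ℕ) : F n →* Magnus n :=
  FreeGroup.lift fun i => ⟨cls (FreeGroup.of i), 0⟩

lemma magnus_one (γ : F n) : (magnus n γ).one = cls γ := by
  induction γ using FreeGroup.induction_on with
  | C1 => rfl
  | of i => simp [magnus]
  | inv_of i h => rw [map_inv, Magnus.inv_one', h]; rfl
  | mul a b ha hb => rw [map_mul, Magnus.mul_one', ha, hb, cls_mul]

/-- The degree-two part `θ₂ : F_n → H_ℤ^{⊗2}` of the standard Magnus expansion. -/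
def theta2 (γ : F n) : H n ⊗[ℤ] H n := (magnus n γ).two

lemma theta2_mul (γ δ : F n) : theta2 (γ * δ) = theta2 γ + theta2 δ + cls γ ⊗ₜ cls δ := by
  simp [theta2, magnus_one]

/-- The embedding `Λ² H_ℤ → H_ℤ^{⊗2}`, `a ∧ b ↦ a ⊗ b - b ⊗ a`. -/
def antisym (n : ℕ) : ⋀[ℤ]^2 (H n) →ₗ[ℤ] H n ⊗[ℤ] H n :=
  exteriorPower.alternatingMapLinearEquiv
    { toFun := fun v => v 0 ⊗ₜ v 1 - v 1 ⊗ₜ v 0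
      map_update_add' := by
        intro inst v i x y
        rw [Subsingleton.elim inst (instDecidableEqFin 2)]
        fin_cases i <;> simp [add_tmul, tmul_add] <;> abel
      map_update_smul' := by
        intro inst v i c x
        rw [Subsingleton.elim inst (instDecidableEqFin 2)]
        fin_cases i <;> simp [smul_sub, tmul_smul, smul_tmul']
      map_eq_zero_of_eq' := by
        intro v i j h hij
        fin_cases i <;> fin_cases j <;> simp_all }

lemma antisym_wedge (a b : H n) :
    antisym n (exteriorPower.ιMulti ℤ 2 ![a, b]) = a ⊗ₜ b - b ⊗ₜ a := by
  simp [antisym]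

lemma exists_antisym_of_mem_commutator (γ : F n) (hγ : γ ∈ commutator (F n)) :
    cls γ = 0 ∧ ∃ w, antisym n w = theta2 γ := by
  rw [commutator_eq_closure] at hγ
  induction hγ using Subgroup.closure_induction with
  | mem x hx =>
    obtain ⟨a, b, rfl⟩ := hx
    refine ⟨by simp [cls, commutatorElement_def], exteriorPower.ιMulti ℤ 2 ![cls a, cls b], ?_⟩
    rw [antisym_wedge]
    simp only [theta2, commutatorElement_def, map_mul, map_inv, Magnus.mul_two, Magnus.inv_two,
      Magnus.mul_one', Magnus.inv_one', magnus_one, add_tmul, tmul_neg, neg_tmul]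
    abel
  | one => exact ⟨rfl, 0, by simp [theta2]⟩
  | mul x y _ _ hx hy =>
    obtain ⟨hx, v, hv⟩ := hx
    obtain ⟨hy, w, hw⟩ := hy
    exact ⟨by rw [cls_mul, hx, hy, add_zero], v + w, by rw [map_add, hv, hw, theta2_mul, hx]; simp⟩
  | inv x _ hx =>
    obtain ⟨hx, v, hv⟩ := hx
    refine ⟨by simpa [cls] using hx, -v, ?_⟩
    rw [map_neg, hv, theta2, theta2, map_inv, Magnus.inv_two, magnus_one, hx]
    simp

lemma exists_antisym (φ : IA n) (γ : F n) :
    ∃ w, antisym n w = theta2 ((φ : MulAut (F n)) γ) - theta2 γ := by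
  have h1 : cls ((φ : MulAut (F n)) γ) = cls γ := by
    rw [← abs_cls, show abs n φ = 1 from φ.2]
    rfl
  have h2 : γ⁻¹ * (φ : MulAut (F n)) γ ∈ commutator (F n) := by
    rw [← Abelianization.ker_of, MonoidHom.mem_ker, map_mul, map_inv,
      show Abelianization.of ((φ : MulAut (F n)) γ) = Abelianization.of γ from h1, inv_mul_cancel]
  obtain ⟨h3, w, hw⟩ := exists_antisym_of_mem_commutator _ h2
  refine ⟨w, ?_⟩
  have h4 := theta2_mul γ (γ⁻¹ * (φ : MulAut (F n)) γ)
  rw [mul_inv_cancel_left, h3, tmul_zero, add_zero] at h4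
  rw [h4, hw, add_sub_cancel_left]

/-- The dual basis `ℓ_i ∈ H_ℤ^*` of the basis `X_i = [x_i]` of `H_ℤ`. -/
def dualBasis (i : Fin n) : Module.Dual ℤ (H n) :=
  (MonoidHom.toAdditiveLeft (Abelianization.lift (FreeGroup.lift fun j =>
    Multiplicative.ofAdd (if j = i then (1 : ℤ) else 0)))).toIntLinearMap

/-- The first Johnson homomorphism `τ₁ : IA_n → H_ℤ^* ⊗ Λ² H_ℤ`,
`τ₁(φ) = ∑ᵢ ℓᵢ ⊗ (θ₂(φ(xᵢ)) - θ₂(xᵢ))`, where `Λ² H_ℤ` is regarded as a submodule of `H_ℤ^{⊗2}`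
through `antisym`. -/
def johnson (φ : IA n) : T n :=
  ∑ i, dualBasis i ⊗ₜ Classical.choose (exists_antisym φ (FreeGroup.of i))

/-! ### The extension `IA_n → Γ → Γ̄` -/

/-- The preimage `Γ ⊂ Aut(F_n)` of a subgroup `Γ̄` of `GL(H_ℤ)`. -/
abbrev preimage (S : Subgroup (LinearMap.GeneralLinearGroup ℤ (H n))) : Subgroup (MulAut (F n)) :=
  S.comap (abs n)

/-- The projection `π : Γ → Γ̄`. -/
abbrev proj (S : Subgroup (LinearMap.GeneralLinearGroup ℤ (H n))) : preimage S →* S :=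
  (abs n).subgroupComap S

/-- The kernel of `Γ → Γ̄` is `IA_n`. -/
def kerEquivIA (S : Subgroup (LinearMap.GeneralLinearGroup ℤ (H n))) : (proj S).ker ≃* IA n where
  toFun x := ⟨x.1.1, congrArg Subtype.val x.2⟩
  invFun φ := ⟨⟨φ.1, by
    rw [Subgroup.mem_comap, show abs n φ = 1 from φ.2]
    exact one_mem S⟩, Subtype.ext φ.2⟩
  left_inv _ := rfl
  right_inv _ := rfl
  map_mul' _ _ := rfl

/-- `ℤ[1/2]`. -/
abbrev ZHalf : Type := Localization.Away (2 : ℤ)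

/-- `Hom(H_ℤ^* ⊗ Λ² H_ℤ, M)^{Γ̄}`, the module of `Γ̄`-equivariant homomorphisms of abelian
groups. -/
def invHom (S : Subgroup (LinearMap.GeneralLinearGroup ℤ (H n))) (M : Rep.{0} ZHalf S) :
    Submodule ZHalf (T n →ₗ[ℤ] M) where
  carrier := {u | ∀ (A : S) (t : T n), u (repT n A t) = M.ρ A (u t)}
  add_mem' {u v} hu hv A t := by simp [hu A t, hv A t]
  zero_mem' A t := by simp
  smul_mem' c u hu A t := by simp [hu A t]

/-- Composition with a morphism of `Γ̄`-modules, on `Hom(H_ℤ^* ⊗ Λ² H_ℤ, -)^{Γ̄}`. -/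
def invHomMap {S : Subgroup (LinearMap.GeneralLinearGroup ℤ (H n))} {M N : Rep.{0} ZHalf S}
    (φ : M ⟶ N) (u : invHom S M) : invHom S N :=
  ⟨(φ.hom.toLinearMap.toAddMonoidHom.comp u.1.toAddMonoidHom).toIntLinearMap, fun A t => by
    have h := u.2 A t
    have h' := Rep.hom_comm_apply φ A (u.1 t)
    simp_all⟩

end AutFree

end

/-! Write `T` for `H_ℤ^* ⊗ Λ² H_ℤ`. Two facts about the Johnson homomorphism carry the theorem, both
for a module `M` in which 2 is invertible. The first is that every homomorphism `IA_n → M` is `u ∘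
τ₁` for exactly one linear `u : T → M` (`exists_linearMap_johnson`, `linearMap_ext_johnson`), so
that `H¹(IA_n; M)` is `Hom(T, M)`. The second is that `2 τ₁` extends to a crossed homomorphism
`crossed` on all of `Aut(F_n)` (`crossed_mul`, `crossed_coe`): the degree-two part of the Magnus
expansion fails to be equivariant by a defect that is linear on `H_ℤ`, and this defect is projected
to `Λ² H_ℤ`. The factor 2 is the composite `Λ² → H^{⊗2} → Λ²`. Hence `u ∘ crossed`, divided by 2,
extends `u ∘ τ₁` to `Aut(F_n)`.

If `u` is equivariant, this extension is a 1-cocycle of `Γ`. A cocycle of `Γ` minus the extension of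
its restriction to `IA_n` vanishes on `IA_n` and descends to `Γ̄`, which splits `H¹(Γ; M)`
(`splitting_injective`, `splitting_surjective`). For the differentials, classes of `E_2^{p,1}` are
represented through symbols, which record how a cochain varies in its first argument along `ker π`
(`HasSymbol.d`, `HasSymbol.mem_Z_two_iff`, `HasSymbol.mem_B_two_iff`). Given a cocycle `c` of `Γ̄`
with values in `H¹(IA_n; M)`, the extensions of its values assemble to a cochain of `Γ` with symbol
`c` whose coboundary is exactly zero (`LHS.d_two_eq_zero`).

The first fact needs Magnus' theorem that `IA_n` is generated by the `x_i ↦ x_j x_i x_j⁻¹` and `x_i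
↦ x_i [x_j, x_k]` (`IA_eq_magnusSubgroup`), because `τ₁` sends the nontrivial ones among these to
the elements `ℓ_i ⊗ X_j ∧ X_k`, a basis of `T` up to signs. The subgroup they generate is normal:
this is checked against Nielsen's generators of `Aut(F_n)` (`FreeGroup.nielsen_generation`). The
quotient satisfies the relations collected in `ElementaryData`, and these already force the action
on `ℤⁿ` to be faithful (`ElementaryData.eq_one_of_ρ_eq_one`). That last point is proved with the
Euclidean algorithm: reducing a primitive vector to a unit vector defines a coset that does not
depend on the choices made, which identifies the stabilizer of a unit vector and allows an induction
on the rank. The same algorithm shows that `Aut(F_n) → GL(H_ℤ)` is surjective (`abs_surjective`). -/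

/-! ## Cancellation in free groups -/

namespace FreeGroup

section Cancellation

variable {α : Type*} [DecidableEq α]

/-- The length of the longest common prefix of two lists. -/
def lcp {β : Type*} [DecidableEq β] : List β → List β → ℕ
  | a :: l, b :: m => if a = b then lcp l m + 1 else 0
  | _, _ => 0

lemma le_lcp_iff {β : Type*} [DecidableEq β] (k : ℕ) (l m : List β) :
    k ≤ lcp l m ↔ k ≤ l.length ∧ k ≤ m.length ∧ l.take k = m.take k := by
  induction l generalizing m k with
  | nil => simp +contextual [lcp]
  | cons a l ih =>
    cases m with
    | nil => simp +contextual [lcp]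
    | cons b m =>
      cases k with
      | zero => simp
      | succ k =>
        simp only [lcp, List.length_cons, List.take_succ_cons, List.cons.injEq,
          Nat.add_le_add_iff_right]
        split_ifs with h
        · simp [ih, h]
        · simp [h]

/-- Equal first letters of `l` and `m` meet in the middle of `invRev l ++ m` and cancel, which
removes one letter from each; once the first letters differ, nothing more cancels. -/
lemma length_reduce_invRev_append {l m : List (α × Bool)} (hl : IsReduced l) (hm : IsReduced m) :
    (reduce (invRev l ++ m)).length + 2 * lcp l m = l.length + m.length := by
  induction l generalizing m with
  | nil => simp [lcp, hm.reduce_eq]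
  | cons a l ih =>
    cases m with
    | nil => simp [lcp, reduce_invRev, hl.reduce_eq]
    | cons b m =>
      have hl' : IsReduced l := hl.infix (List.suffix_cons a l).isInfix
      have hm' : IsReduced m := hm.infix (List.suffix_cons b m).isInfix
      by_cases h : a = b
      · subst h
        have h1 : reduce (invRev (a :: l) ++ a :: m) = reduce (invRev l ++ m) := by
          apply reduce.sound
          rw [← mul_mk, ← mul_mk, ← inv_mk, ← inv_mk, ← List.singleton_append,
            ← List.singleton_append (l := m), ← mul_mk, ← mul_mk]
          group
        rw [h1]
        have := ih hl' hm'
        simp only [lcp, if_true, List.length_cons]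
        omega
      · have h1 : IsReduced (invRev (a :: l) ++ b :: m) := by
          have h2 : IsReduced (invRev (a :: l)) := by
            rw [isReduced_iff_reduce_eq, reduce_invRev, hl.reduce_eq]
          refine List.isChain_append.2 ⟨h2, hm, ?_⟩
          intro x hx y hy hxy
          simp only [invRev, List.map_cons, List.reverse_cons, List.getLast?_append,
            List.getLast?_singleton, Option.some_or, Option.mem_def, Option.some.injEq,
            List.head?_cons] at hx hy
          subst hx hy
          obtain ⟨a1, a2⟩ := a
          obtain ⟨b1, b2⟩ := b
          simp only at hxy
          subst hxy
          cases a2 <;> cases b2 <;> simp_all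
        rw [h1.reduce_eq]
        simp [lcp, h]

/-- The Gromov product of two elements of a free group: the length of the longest common prefix
of the reduced words. -/
def gromov (g h : FreeGroup α) : ℕ := lcp g.toWord h.toWord

lemma norm_inv_mul_add (g h : FreeGroup α) :
    norm (g⁻¹ * h) + 2 * gromov g h = norm g + norm h := by
  have := length_reduce_invRev_append (isReduced_toWord (x := g)) (isReduced_toWord (x := h))
  simpa [norm, toWord_mul, toWord_inv, gromov] using this

lemma norm_mul_add (g h : FreeGroup α) :
    norm (g * h) + 2 * gromov g⁻¹ h = norm g + norm h := by
  simpa using norm_inv_mul_add g⁻¹ h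

lemma le_gromov_iff (k : ℕ) (g h : FreeGroup α) :
    k ≤ gromov g h ↔ k ≤ norm g ∧ k ≤ norm h ∧ g.toWord.take k = h.toWord.take k :=
  le_lcp_iff _ _ _

lemma gromov_comm (g h : FreeGroup α) : gromov g h = gromov h g :=
  eq_of_forall_le_iff fun k => by
    rw [le_gromov_iff, le_gromov_iff, eq_comm]
    tauto

lemma le_gromov_trans {k : ℕ} {f g h : FreeGroup α} (h1 : k ≤ gromov f g) (h2 : k ≤ gromov g h) :
    k ≤ gromov f h := by
  rw [le_gromov_iff] at *
  exact ⟨h1.1, h2.2.1, h1.2.2.trans h2.2.2⟩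

/-- Prefixes form a tree, so the Gromov product is ultrametric: among the three products of `f`,
`g`, `h` the two smallest agree. -/
lemma gromov_eq_of_lt {f g h : FreeGroup α} (h1 : gromov f g < gromov g h) :
    gromov f h = gromov f g := by
  refine le_antisymm ?_ (le_gromov_trans le_rfl h1.le)
  by_contra! h2
  have h3 := le_gromov_trans (k := gromov f g + 1) (f := f) (g := h) (h := g) h2
    (by rw [gromov_comm h g]; exact h1)
  omega

/-- Write `g = c r c⁻¹` with `r` the cyclically reduced core, which is not empty. Then `c r r c⁻¹`
is reduced and longer by the length of `r`. -/
lemma norm_lt_norm_mul_self {g : FreeGroup α} (hg : g ≠ 1) : norm g < norm (g * g) := by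
  have h1 : (g * g).toWord = _ :=
    (by rw [toWord_mul]; simp :
      (g * g).toWord = reduce (List.replicate 2 g.toWord).flatten).trans
      (reduceCyclically.reduce_flatten_replicate_succ isReduced_toWord 1)
  have h2 := reduceCyclically.conj_conjugator_reduceCyclically g.toWord
  have h3 : reduceCyclically g.toWord ≠ [] := by
    intro h
    apply hg
    rw [← toWord_eq_nil_iff, ← reduce_toWord, ← h2, h, List.append_nil, ← reduce_nil]
    apply reduce.sound
    rw [← mul_mk, ← inv_mk, mul_inv_cancel]
    rfl
  have h4 : 0 < (reduceCyclically g.toWord).length := List.length_pos_iff.2 h3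
  have h5 := congrArg List.length h2
  simp only [norm, h1]
  rw [← h5]
  simp
  omega

/-- Used where a letter is followed by itself: no Nielsen move relates the two factors there, so the
bound on the cancellation has to come from `g` alone. -/
lemma two_mul_gromov_inv_self_lt {g : FreeGroup α} (hg : g ≠ 1) : 2 * gromov g⁻¹ g < norm g := by
  have h1 := norm_mul_add g g
  have h2 := norm_lt_norm_mul_self hg
  omega

end Cancellation

end FreeGroup

/-! ## Nielsen reduction -/

namespace FreeGroup

section Nielsen

variable {α : Type*}

/-- The inverse of a letter. -/
def bar (x : α × Bool) : α × Bool := (x.1, !x.2)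

@[simp] lemma bar_bar (x : α × Bool) : bar (bar x) = x := by simp [bar]

@[simp] lemma bar_fst (x : α × Bool) : (bar x).1 = x.1 := rfl

lemma mk_bar (x : α × Bool) : mk [bar x] = (mk [x])⁻¹ := by simp [bar, inv_mk, invRev]

lemma isReduced_cons_cons_iff {x y : α × Bool} {L : List (α × Bool)} :
    IsReduced (x :: y :: L) ↔ y ≠ bar x ∧ IsReduced (y :: L) := by
  rw [IsReduced, List.isChain_cons_cons]
  refine and_congr_left fun _ => ?_
  obtain ⟨a, b⟩ := x
  obtain ⟨c, d⟩ := y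
  simp only [bar, ne_eq, Prod.mk.injEq, not_and]
  cases b <;> cases d <;> simp [eq_comm]

variable {β : Type*} [DecidableEq β]

/-- Nielsen's conditions on a family of elements of a free group indexed by letters. -/
structure NielsenReduced (v : α × Bool → FreeGroup β) : Prop where
  ne_one : ∀ x, v x ≠ 1
  two_mul_le_left : ∀ x y, y ≠ bar x → 2 * gromov (v x)⁻¹ (v y) ≤ norm (v x)
  two_mul_le_right : ∀ x y, y ≠ bar x → 2 * gromov (v x)⁻¹ (v y) ≤ norm (v y)
  add_lt : ∀ x y z, y ≠ bar x → z ≠ bar y →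
    gromov (v x)⁻¹ (v y) + gromov (v y)⁻¹ (v z) < norm (v y)

namespace NielsenReduced

variable {v : α × Bool → FreeGroup β}

/-- By `add_lt` a letter of `v y` survives the cancellation on both of its sides, so `v x` sees only
`v y` in the tail (`gromov_eq_of_lt`). The second clause is the resulting growth of length, in the
form that the induction carries along. -/
lemma norm_prod (hv : NielsenReduced v) (L : List (α × Bool)) (x y : α × Bool)
    (hL : IsReduced (x :: y :: L)) :
    gromov (v x)⁻¹ ((y :: L).map v).prod = gromov (v x)⁻¹ (v y) ∧
      norm (v x) + L.length + 1 ≤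
        norm (v x * ((y :: L).map v).prod) + gromov (v x)⁻¹ (v y) := by
  induction L generalizing x y with
  | nil =>
    obtain ⟨h1, -⟩ := isReduced_cons_cons_iff.1 hL
    have h2 := norm_mul_add (v x) (v y)
    have h3 := hv.two_mul_le_right x y h1
    have h4 : norm (v y) ≠ 0 := fun h => hv.ne_one y (norm_eq_zero.1 h)
    simp only [List.map_cons, List.map_nil, List.prod_cons, List.prod_nil, mul_one,
      List.length_nil, true_and]
    omega
  | cons z L ih =>
    obtain ⟨h1, hL'⟩ := isReduced_cons_cons_iff.1 hL
    obtain ⟨h2, -⟩ := isReduced_cons_cons_iff.1 hL'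
    obtain ⟨h3, h4⟩ := ih y z hL'
    set R := ((z :: L).map v).prod with hR
    have h5 : ((y :: z :: L).map v).prod = v y * R := by simp [hR]
    rw [h5]
    have h6 := norm_mul_add (v y) R
    have h7 := norm_inv_mul_add (v y) (v y * R)
    rw [inv_mul_cancel_left] at h7
    have h8 := hv.add_lt x y z h1 h2
    have h9 : gromov (v x)⁻¹ (v y * R) = gromov (v x)⁻¹ (v y) :=
      gromov_eq_of_lt (by omega)
    have h10 := norm_mul_add (v x) (v y * R)
    refine ⟨h9, ?_⟩
    simp only [List.length_cons]
    omega

/-- With two or more factors, `norm_prod` and the fact that at most half of `v x` cancels force a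
length greater than one. -/
lemma eq_singleton (hv : NielsenReduced v) {L : List (α × Bool)} (hL : IsReduced L)
    (h : norm (L.map v).prod = 1) : ∃ x, L = [x] := by
  match L, hL, h with
  | [], _, h => simp at h
  | [x], _, _ => exact ⟨x, rfl⟩
  | x :: y :: L, hL, h =>
    have h1 := (hv.norm_prod L x y hL).2
    have h2 := hv.two_mul_le_left x y (isReduced_cons_cons_iff.1 hL).1
    have h3 : norm (v x) ≠ 0 := fun h => hv.ne_one x (norm_eq_zero.1 h)
    rw [List.map_cons, List.prod_cons] at h
    omega

end NielsenReduced

/-! ### Breaking ties between words of equal length -/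

section Weight

/-- The number whose digits are the letters of a word. -/
noncomputable def code {β : Type*} [Fintype β] (l : List (β × Bool)) : ℕ :=
  Nat.ofDigits (Fintype.card (β × Bool) + 2)
    -- `Nat.ofDigits` expects the least significant digit first. After reversal the first letter is
    -- the leading digit, so codes compare words of equal length lexicographically.
    (l.reverse.map fun x => (Fintype.equivFin (β × Bool) x : ℕ))

lemma code_append {β : Type*} [Fintype β] (l m : List (β × Bool)) :
    code (l ++ m) = code m + (Fintype.card (β × Bool) + 2) ^ m.length * code l := by
  simp [code, Nat.ofDigits_append]

lemma code_lt {β : Type*} [Fintype β] (l : List (β × Bool)) :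
    code l < (Fintype.card (β × Bool) + 2) ^ l.length := by
  have := Nat.ofDigits_lt_base_pow_length' (b := Fintype.card (β × Bool))
    (l := l.reverse.map fun x => (Fintype.equivFin (β × Bool) x : ℕ)) (fun x hx => by
      obtain ⟨y, -, rfl⟩ := List.mem_map.1 hx
      have := (Fintype.equivFin (β × Bool) y).2
      omega)
  simpa [code] using this

lemma code_injective {β : Type*} [Fintype β] {l m : List (β × Bool)} (h : l.length = m.length)
    (h' : code l = code m) : l = m := by
  have := Nat.ofDigits_inj_of_len_eq (b := Fintype.card (β × Bool) + 2) (by omega)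
    (L1 := l.reverse.map fun x => (Fintype.equivFin (β × Bool) x : ℕ))
    (L2 := m.reverse.map fun x => (Fintype.equivFin (β × Bool) x : ℕ)) (by simpa using h)
    (fun x hx => by
      obtain ⟨y, -, rfl⟩ := List.mem_map.1 hx
      have := (Fintype.equivFin (β × Bool) y).2
      omega)
    (fun x hx => by
      obtain ⟨y, -, rfl⟩ := List.mem_map.1 hx
      have := (Fintype.equivFin (β × Bool) y).2
      omega) h'
  have h2 : Function.Injective fun x => (Fintype.equivFin (β × Bool) x : ℕ) := fun x y hxy =>
    (Fintype.equivFin _).injective (Fin.ext hxy)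
  exact List.reverse_injective (List.map_injective_iff.2 h2 this)

lemma code_lt_of_take {β : Type*} [Fintype β] {l m : List (β × Bool)} (k : ℕ)
    (h : l.length = m.length) (h' : code (l.take k) < code (m.take k)) : code l < code m := by
  have h1 := code_append (l.take k) (l.drop k)
  have h2 := code_append (m.take k) (m.drop k)
  rw [List.take_append_drop] at h1 h2
  have h3 := code_lt (l.drop k)
  have h4 : (m.drop k).length = (l.drop k).length := by simp [h]
  rw [h1, h2, h4]
  have h5 := Nat.mul_le_mul_left ((Fintype.card (β × Bool) + 2) ^ (l.drop k).length) h'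
  rw [Nat.mul_succ] at h5
  omega

variable [Fintype β]

/-- The code of the initial half of a reduced word. -/
noncomputable def halfCode (g : FreeGroup β) : ℕ := code (g.toWord.take ((norm g + 1) / 2))

/-- The secondary complexity of an element of a free group. -/
noncomputable def weight (g : FreeGroup β) : ℕ := halfCode g + halfCode g⁻¹

lemma weight_inv (g : FreeGroup β) : weight g⁻¹ = weight g := by
  rw [weight, weight, inv_inv, add_comm]

/-- Write `b = p q⁻¹` with both halves of length `k`. Exactly `q⁻¹` cancels against `a = q a'`, so
multiplication by `b` trades the prefix `q` for `p`. As `2 * k ≤ norm a`, this prefix lies in the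
initial half of `a`, and the final half is untouched. -/
lemma weight_mul_lt {a b : FreeGroup β} {k : ℕ} (hb : norm b = 2 * k) (hab : gromov b⁻¹ a = k)
    (ha : 2 * k ≤ norm a) (hc : code (b.toWord.take k) < code (b⁻¹.toWord.take k)) :
    norm (b * a) = norm a ∧ weight (b * a) < weight a := by
  have h1 := norm_mul_add b a
  have h2 : norm (b * a) = norm a := by omega
  refine ⟨h2, ?_⟩
  have h3 := norm_inv_mul_add b (b * a)
  rw [inv_mul_cancel_left] at h3
  have h4 := ((le_gromov_iff k b (b * a)).1 (by omega)).2.2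
  have h5 := ((le_gromov_iff k b⁻¹ a).1 (by omega)).2.2
  have h6 := norm_inv_mul_add a⁻¹ (b * a)⁻¹
  rw [inv_inv, mul_inv_rev, mul_inv_cancel_left, norm_inv_eq, norm_inv_eq, ← mul_inv_rev,
    norm_inv_eq] at h6
  have h7 := ((le_gromov_iff ((norm a + 1) / 2) a⁻¹ (b * a)⁻¹).1 (by omega)).2.2
  have h8 : halfCode (b * a)⁻¹ = halfCode a⁻¹ := by
    rw [halfCode, halfCode, norm_inv_eq, norm_inv_eq, h2, h7]
  have h9 : halfCode (b * a) < halfCode a := by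
    rw [halfCode, halfCode, h2]
    refine code_lt_of_take k ?_ ?_
    · simpa [norm] using congrArg (min _) h2
    · rw [List.take_take, List.take_take, min_eq_left (by omega), ← h4, ← h5]
      exact hc
  rw [weight, weight, h8]
  omega

/-- Equal codes would give `b` and `b⁻¹` a common prefix of half their length, so that half of `b`
would cancel in `b * b`. -/
lemma code_take_ne {b : FreeGroup β} {k : ℕ} (hb1 : b ≠ 1) (hb : norm b = 2 * k) :
    code (b.toWord.take k) ≠ code (b⁻¹.toWord.take k) := by
  intro h
  have h0 : norm b⁻¹ = 2 * k := by rw [norm_inv_eq, hb]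
  have h1 : b.toWord.take k = b⁻¹.toWord.take k := by
    refine code_injective ?_ h
    have e1 : b.toWord.length = 2 * k := hb
    have e2 : b⁻¹.toWord.length = 2 * k := h0
    rw [List.length_take, List.length_take, e1, e2]
  have h2 := (le_gromov_iff k b⁻¹ b).2 ⟨by omega, by omega, h1.symm⟩
  have h3 := two_mul_gromov_inv_self_lt hb1
  omega

end Weight

/-- A family of elements, closed under inversion, that cannot be shortened by Nielsen moves is
Nielsen reduced. -/
lemma nielsenReduced_of_minimal [Fintype β] {v : α × Bool → FreeGroup β}
    (hbar : ∀ x, v (bar x) = (v x)⁻¹) (hone : ∀ x, v x ≠ 1)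
    (hmin : ∀ x y, x.1 ≠ y.1 → norm (v x) ≤ norm (v x * v y) ∧
      (norm (v x) = norm (v x * v y) → weight (v x) ≤ weight (v x * v y))) :
    NielsenReduced v := by
  have hmin' : ∀ x y, x.1 ≠ y.1 → norm (v y) ≤ norm (v x * v y) ∧
      (norm (v y) = norm (v x * v y) → weight (v y) ≤ weight (v x * v y)) := fun x y h => by
    have := hmin (bar y) (bar x) (by simpa using h.symm)
    rwa [hbar, hbar, ← mul_inv_rev, norm_inv_eq, norm_inv_eq, weight_inv, weight_inv] at this
  -- A letter that is not inverse to `x` repeats it or involves another generator; only in the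
  -- second case is there a Nielsen move.
  have hfst : ∀ {x y : α × Bool}, y ≠ bar x → x = y ∨ x.1 ≠ y.1 := by
    rintro ⟨a, b⟩ ⟨c, d⟩ h
    by_cases hac : a = c
    · subst hac
      left
      revert h
      cases b <;> cases d <;> simp [bar]
    · exact Or.inr hac
  have hl : ∀ x y, y ≠ bar x → 2 * gromov (v x)⁻¹ (v y) ≤ norm (v x) := fun x y hxy => by
    rcases hfst hxy with rfl | h
    · exact (two_mul_gromov_inv_self_lt (hone _)).le
    · have h1 := norm_mul_add (v x) (v y)
      have h2 := (hmin' x y h).1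
      omega
  have hr : ∀ x y, y ≠ bar x → 2 * gromov (v x)⁻¹ (v y) ≤ norm (v y) := fun x y hxy => by
    rcases hfst hxy with rfl | h
    · exact (two_mul_gromov_inv_self_lt (hone _)).le
    · have h1 := norm_mul_add (v x) (v y)
      have h2 := (hmin x y h).1
      omega
  -- If exactly half of `v y` cancels against `v z`, the move `v z ↦ v y * v z` preserves the length
  -- and exchanges one half of `v y` for the other. Minimality forbids it to lower the weight.
  have key : ∀ y z k, z ≠ bar y → norm (v y) = 2 * k → gromov (v y)⁻¹ (v z) = k →
      ¬ code ((v y).toWord.take k) < code ((v y)⁻¹.toWord.take k) := fun y z k hyz h1 h2 h3 => by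
    rcases hfst hyz with rfl | h
    · have := two_mul_gromov_inv_self_lt (hone y)
      omega
    · obtain ⟨h4, h5⟩ := weight_mul_lt h1 h2 (by have := hr y z hyz; omega) h3
      have := (hmin' y z h).2 h4.symm
      omega
  refine ⟨hone, hl, hr, fun x y z hxy hyz => ?_⟩
  -- Failure means that each neighbour cancels exactly half of `v y`. Then `key`, applied from both
  -- sides, says that neither half has the smaller code, while `code_take_ne` says that the codes
  -- differ.
  by_contra! hcon
  have h1 := hr x y hxy
  have h2 := hl y z hyz
  have h3 : norm (v y) = 2 * gromov (v y)⁻¹ (v z) := by omega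
  have h4 := key y z _ hyz h3 rfl
  have h5 := key (bar y) (bar x) (gromov (v y)⁻¹ (v z))
    (fun h => hxy (by rw [bar_bar] at h; exact h.symm))
    (by rw [hbar, norm_inv_eq, h3])
    (by rw [hbar, hbar, inv_inv, gromov_comm]; omega)
  rw [hbar, inv_inv] at h5
  have h6 := code_take_ne (hone y) h3
  omega

lemma map_mk_eq_prod {G : Type*} [Group G] (φ : FreeGroup α →* G) (L : List (α × Bool)) :
    φ (mk L) = (L.map fun x => φ (mk [x])).prod := by
  induction L with
  | nil => exact _root_.map_one φ
  | cons x L ih => rw [← List.singleton_append, ← mul_mk, _root_.map_mul, ih]; simp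

/-- Nielsen's theorem: the automorphism group of a free group of finite rank is generated by the
signed permutations and the transvections `xᵢ ↦ xᵢ xⱼ^±`, `xᵢ ↦ xⱼ^± xᵢ`. -/
theorem nielsen_generation [Fintype α] [DecidableEq α] (K : Subgroup (MulAut (FreeGroup α)))
    (hW : ∀ φ : MulAut (FreeGroup α), (∀ i, ∃ x, φ (of i) = mk [x]) → φ ∈ K)
    (hR : ∀ (i : α) (x : α × Bool), x.1 ≠ i →
      ∃ ψ ∈ K, ψ (of i) = of i * mk [x] ∧ ∀ j, j ≠ i → ψ (of j) = of j)
    (hL : ∀ (i : α) (x : α × Bool), x.1 ≠ i →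
      ∃ ψ ∈ K, ψ (of i) = mk [x] * of i ∧ ∀ j, j ≠ i → ψ (of j) = of j) : K = ⊤ := by
  refine (Subgroup.eq_top_iff' K).2 fun φ => ?_
  -- Total length first, total weight to break ties. A minimum over the coset `φ K` takes the place
  -- of a descent by successive Nielsen moves.
  let μ : K → ℕ ×ₗ ℕ := fun ψ =>
    toLex (∑ i, norm ((φ * ψ.1) (of i)), ∑ i, weight ((φ * ψ.1) (of i)))
  obtain ⟨ψ, hψ⟩ : ∃ ψ, ∀ ψ', μ ψ ≤ μ ψ' := by
    obtain ⟨-, ⟨ψ, rfl⟩, hψ⟩ := (wellFounded_lt (α := ℕ ×ₗ ℕ)).has_min (Set.range μ) ⟨_, 1, rfl⟩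
    exact ⟨ψ, fun ψ' => not_lt.1 (hψ _ ⟨ψ', rfl⟩)⟩
  set θ : MulAut (FreeGroup α) := φ * ψ.1 with hθ
  have hmove : ∀ (i : α) (χ : MulAut (FreeGroup α)), χ ∈ K → (∀ j, j ≠ i → χ (of j) = of j) →
      norm (θ (of i)) ≤ norm (θ (χ (of i))) ∧ (norm (θ (of i)) = norm (θ (χ (of i))) →
        weight (θ (of i)) ≤ weight (θ (χ (of i)))) := fun i χ hχ hj => by
    have h1 := hψ (ψ * ⟨χ, hχ⟩)
    have h2 : ∀ f : FreeGroup α → ℕ, ∑ j, f ((φ * (ψ * ⟨χ, hχ⟩ : K).1) (of j)) =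
        f (θ (χ (of i))) + ∑ j ∈ Finset.univ.erase i, f (θ (of j)) := fun f => by
      rw [← Finset.add_sum_erase _ _ (Finset.mem_univ i)]
      congr 1
      exact Finset.sum_congr rfl fun j hji =>
        congrArg f (congrArg θ (hj j (Finset.ne_of_mem_erase hji)))
    have h3 : ∀ f : FreeGroup α → ℕ, ∑ j, f ((φ * ψ.1) (of j)) =
        f (θ (of i)) + ∑ j ∈ Finset.univ.erase i, f (θ (of j)) := fun f =>
      (Finset.add_sum_erase _ _ (Finset.mem_univ i)).symm
    simp only [μ, h2, h3] at h1
    rw [Prod.Lex.le_iff] at h1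
    simp only [ofLex_toLex] at h1
    omega
  have hv : NielsenReduced fun x => θ (mk [x]) := by
    have hbar : ∀ x, θ (mk [bar x]) = (θ (mk [x]))⁻¹ := fun x => by rw [mk_bar, _root_.map_inv]
    refine nielsenReduced_of_minimal hbar (fun x h => ?_) fun x y hxy => ?_
    · have h1 : mk [x] = 1 := by simpa using h
      have h2 := congrArg (fun g => norm g) h1
      simp [norm] at h2
    · obtain ⟨i, b⟩ := x
      cases b with
      | true =>
        obtain ⟨χ, hχ, h1, h2⟩ := hR i y hxy.symm
        have := hmove i χ hχ h2
        rw [h1, _root_.map_mul] at this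
        exact this
      | false =>
        -- A right move at an inverse letter is a left move at the letter itself: `x_i⁻¹ y = (y⁻¹
        -- x_i)⁻¹`.
        obtain ⟨χ, hχ, h1, h2⟩ := hL i (bar y) hxy.symm
        have := hmove i χ hχ h2
        have h3 : θ (mk [(i, false)]) = (θ (of i))⁻¹ := hbar (i, true)
        rw [h1, _root_.map_mul, hbar] at this
        rw [h3, ← norm_inv_eq (x := (θ (of i))⁻¹ * _), ← weight_inv ((θ (of i))⁻¹ * _),
          norm_inv_eq (x := θ (of i)), mul_inv_rev, inv_inv, weight_inv]
        exact this
  -- Each generator is the image under `θ` of a reduced word. Its norm is one, so by `eq_singleton`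
  -- that word is a single letter.
  have hW' : θ⁻¹ ∈ K := hW _ fun i => by
    have h1 : θ (mk (θ⁻¹ (of i)).toWord) = of i := by
      rw [mk_toWord]
      exact θ.apply_symm_apply _
    obtain ⟨x, hx⟩ := hv.eq_singleton (isReduced_toWord (x := θ⁻¹ (of i))) (by
      have := map_mk_eq_prod θ.toMonoidHom (θ⁻¹ (of i)).toWord
      change θ _ = (List.map (fun x => θ (mk [x])) _).prod at this
      rw [← this, h1, norm_of])
    exact ⟨x, by rw [← hx, mk_toWord]⟩
  have : φ = θ⁻¹⁻¹ * ψ.1⁻¹ := by rw [hθ]; group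
  rw [this]
  exact K.mul_mem (K.inv_mem hW') (K.inv_mem ψ.2)

end Nielsen

end FreeGroup

/-! ## Groups with elementary and signed permutation elements over `GL_n(ℤ)` -/

/-- A group `G` acting on `ℤ^ι`, with elements acting as the elementary matrices and a subgroup
acting as the signed permutation matrices, that satisfy the usual relations. -/
structure ElementaryData (ι : Type*) [Fintype ι] [DecidableEq ι] (G : Type*) [Group G] where
  ρ : G →* Module.End ℤ (ι → ℤ)
  E : ι → ι → G
  W : Subgroup G
  ρ_E : ∀ a b v, a ≠ b → ρ (E a b) v = Function.update v b (v b + v a)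
  comm : ∀ a b c d, a ≠ b → c ≠ d → b ≠ c → d ≠ a → Commute (E a b) (E c d)
  chain : ∀ a b c, a ≠ b → b ≠ c → a ≠ c → ∀ s t : ℤ,
    E b c ^ s * E a b ^ t = E a b ^ t * E b c ^ s * E a c ^ (s * t)
  -- Equivalently, `E b a ^ (-t) * E a b ^ t * E b a ^ (-t)` lies in `W`. Its matrix exchanges the
  -- coordinates `a` and `b` up to sign.
  weyl : ∀ a b, a ≠ b → ∀ t : ℤ, t = 1 ∨ t = -1 →
    ∃ w ∈ W, E b a ^ (-t) * E a b ^ t = w * E b a ^ t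
  flip : ∀ a, ∃ w ∈ W, ∀ v, ρ w v = Function.update v a (-v a)
  W_conj : ∀ w ∈ W, ∃ (σ : Equiv.Perm ι) (ε : ι → ℤ), (∀ i, ε i = 1 ∨ ε i = -1) ∧
    (∀ v i, ρ w v (σ i) = ε i * v i) ∧
    ∀ a b, a ≠ b → w * E a b * w⁻¹ = E (σ a) (σ b) ^ (ε a * ε b)
  -- Faithfulness is assumed on `W` only; for the group generated by `W` and the `E a b` it is
  -- derived in `eq_one_of_ρ_eq_one`.
  W_faithful : ∀ w ∈ W, ρ w = 1 → w = 1

namespace ElementaryData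

variable {ι : Type*} [Fintype ι] [DecidableEq ι] {G : Type*} [Group G] (D : ElementaryData ι G)

lemma ρ_inv_apply (g : G) (v : ι → ℤ) : D.ρ g⁻¹ (D.ρ g v) = v := by
  rw [← Module.End.mul_apply, ← map_mul, inv_mul_cancel, map_one, Module.End.one_apply]

lemma ρ_apply_inv (g : G) (v : ι → ℤ) : D.ρ g (D.ρ g⁻¹ v) = v := by
  simpa only [inv_inv] using D.ρ_inv_apply g⁻¹ v

lemma ρ_mul_apply (g h : G) (v : ι → ℤ) : D.ρ (g * h) v = D.ρ g (D.ρ h v) := by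
  rw [map_mul, Module.End.mul_apply]

lemma ρ_zpow {a b : ι} (hab : a ≠ b) (t : ℤ) (v : ι → ℤ) :
    D.ρ (D.E a b ^ t) v = Function.update v b (v b + t * v a) := by
  have h1 : ∀ v, D.ρ (D.E a b)⁻¹ v = Function.update v b (v b - v a) := fun v => by
    have h2 : D.ρ (D.E a b) (Function.update v b (v b - v a)) = v := by
      rw [D.ρ_E _ _ _ hab]
      simp [Function.update_of_ne hab]
    rw [← h2, ρ_inv_apply, h2]
  induction t using Int.induction_on with
  | zero => simp
  | succ i ih =>
    rw [zpow_add_one, (Commute.refl (D.E a b)).zpow_left i |>.eq, ρ_mul_apply, ih,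
      D.ρ_E _ _ _ hab]
    simp only [Function.update_self, Function.update_of_ne hab, Function.update_idem]
    congr 1
    ring
  | pred i ih =>
    rw [zpow_sub_one, ((Commute.refl (D.E a b)).zpow_left (-(i : ℤ))).inv_right.eq, ρ_mul_apply,
      ih, h1]
    simp only [Function.update_self, Function.update_of_ne hab, Function.update_idem]
    congr 1
    ring

/-- The `ℓ¹` norm. -/
def nrm (v : ι → ℤ) : ℕ := ∑ i, (v i).natAbs

lemma nrm_update (v : ι → ℤ) (b : ι) (x : ℤ) :
    nrm (Function.update v b x) + (v b).natAbs = nrm v + x.natAbs := by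
  rw [nrm, nrm, ← Finset.add_sum_erase _ _ (Finset.mem_univ b),
    ← Finset.add_sum_erase _ (fun i => (v i).natAbs) (Finset.mem_univ b), Function.update_self]
  have : ∑ i ∈ Finset.univ.erase b, (Function.update v b x i).natAbs =
      ∑ i ∈ Finset.univ.erase b, (v i).natAbs :=
    Finset.sum_congr rfl fun i hi => by rw [Function.update_of_ne (Finset.ne_of_mem_erase hi)]
  rw [this]
  omega

lemma nrm_zpow {a b : ι} (hab : a ≠ b) (t : ℤ) (v : ι → ℤ) :
    nrm (D.ρ (D.E a b ^ t) v) + (v b).natAbs = nrm v + (v b + t * v a).natAbs := by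
  rw [D.ρ_zpow hab, nrm_update]

lemma ρ_zpow_same {a b : ι} (hab : a ≠ b) (t : ℤ) (v : ι → ℤ) :
    D.ρ (D.E a b ^ t) v b = v b + t * v a := by
  rw [D.ρ_zpow hab, Function.update_self]

lemma ρ_zpow_ne {a b c : ι} (hab : a ≠ b) (hc : c ≠ b) (t : ℤ) (v : ι → ℤ) :
    D.ρ (D.E a b ^ t) v c = v c := by
  rw [D.ρ_zpow hab, Function.update_of_ne hc]

/-- The vectors whose entries have no common divisor. -/
def Prim (v : ι → ℤ) : Prop := ∀ d : ℤ, (∀ i, d ∣ v i) → IsUnit d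

lemma prim_ρ (g : G) {v : ι → ℤ} (hv : Prim v) : Prim (D.ρ g v) := fun d hd => by
  choose u hu using hd
  refine hv d fun i => ?_
  have h1 : D.ρ g v = d • u := funext fun i => by simpa using hu i
  rw [← D.ρ_inv_apply g v, h1, map_smul]
  exact ⟨_, rfl⟩

/-- The vectors supported on `S`. -/
def Supp (S : Finset ι) (v : ι → ℤ) : Prop := ∀ i, i ∉ S → v i = 0

/-- The signed permutations supported on `S`. -/
def WS (S : Finset ι) : Set G :=
  {w | w ∈ D.W ∧ ∀ i, i ∉ S → D.ρ w (Pi.single i 1) = Pi.single i 1}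

lemma WS_inv {S : Finset ι} {w : G} (hw : w ∈ D.WS S) : w⁻¹ ∈ D.WS S :=
  ⟨inv_mem hw.1, fun i hi => by
    conv_lhs => rw [← hw.2 i hi]
    exact D.ρ_inv_apply _ _⟩

lemma WS_mul {S : Finset ι} {w w' : G} (hw : w ∈ D.WS S) (hw' : w' ∈ D.WS S) :
    w * w' ∈ D.WS S :=
  ⟨mul_mem hw.1 hw'.1, fun i hi => by rw [ρ_mul_apply, hw'.2 i hi, hw.2 i hi]⟩

lemma WS_conj {S : Finset ι} {w : G} (hw : w ∈ D.WS S) :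
    ∃ (σ : Equiv.Perm ι) (ε : ι → ℤ), (∀ i, ε i = 1 ∨ ε i = -1) ∧
    (∀ v i, D.ρ w v (σ i) = ε i * v i) ∧ (∀ i, σ i ∈ S ↔ i ∈ S) ∧
    ∀ a b, a ≠ b → ∀ t : ℤ, w * D.E a b ^ t * w⁻¹ = D.E (σ a) (σ b) ^ (ε a * ε b * t) := by
  obtain ⟨σ, ε, h1, h2, h3⟩ := D.W_conj w hw.1
  have h4 : ∀ i, i ∉ S → σ i = i := fun i hi => by
    have h5 := h2 (Pi.single i 1) i
    rw [hw.2 i hi, Pi.single_eq_same] at h5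
    by_contra h6
    rw [Pi.single_eq_of_ne h6] at h5
    rcases h1 i with h | h <;> rw [h] at h5 <;> omega
  refine ⟨σ, ε, h1, h2, fun i => ⟨fun h => ?_, fun h => ?_⟩, fun a b hab t => ?_⟩
  · by_contra h5
    exact h5 (h4 i h5 ▸ h)
  · by_contra h5
    have h6 := h4 _ h5
    exact h5 ((σ.injective h6).symm ▸ h)
  · rw [← conj_zpow, h3 a b hab, ← zpow_mul]

lemma nrm_W {w : G} (hw : w ∈ D.W) (v : ι → ℤ) : nrm (D.ρ w v) = nrm v := by
  obtain ⟨σ, ε, h1, h2, -⟩ := D.W_conj w hw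
  rw [nrm, ← Equiv.sum_comp σ]
  refine Finset.sum_congr rfl fun i _ => ?_
  rw [h2, Int.natAbs_mul]
  rcases h1 i with h | h <;> simp [h]

lemma supp_WS {S : Finset ι} {w : G} (hw : w ∈ D.WS S) {v : ι → ℤ} (hv : Supp S v) :
    Supp S (D.ρ w v) := fun i hi => by
  obtain ⟨σ, ε, h1, h2, h3, -⟩ := D.WS_conj hw
  obtain ⟨j, rfl⟩ := σ.surjective i
  rw [h2, hv j (fun h => hi ((h3 j).2 h)), mul_zero]

lemma supp_zpow {S : Finset ι} {a b : ι} (hab : a ≠ b) (hb : b ∈ S) (t : ℤ) {v : ι → ℤ}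
    (hv : Supp S v) : Supp S (D.ρ (D.E a b ^ t) v) := fun i hi => by
  rw [D.ρ_zpow_ne hab (c := i) (by rintro rfl; exact hi hb), hv i hi]

/-- The subgroup generated by the elementary and signed permutation elements supported on `S`. -/
def GS (S : Finset ι) : Subgroup G :=
  Subgroup.closure ({g | ∃ a ∈ S, ∃ b ∈ S, a ≠ b ∧ g = D.E a b} ∪ D.WS S)

/-- The subgroup generated by the elementary and signed permutation elements supported on `S` that
fix the `m`-th unit vector. -/
def PS (S : Finset ι) (m : ι) : Subgroup G :=
  Subgroup.closure ({g | ∃ a ∈ S, ∃ b ∈ S, a ≠ b ∧ a ≠ m ∧ g = D.E a b} ∪ D.WS (S.erase m))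

variable (S : Finset ι) (m : ι)

/-- A step of the Euclidean algorithm: the entry `v b` decreases to `|v b| - |v a|`. -/
structure Desc (v : ι → ℤ) (a b : ι) (t : ℤ) : Prop where
  left_mem : a ∈ S
  right_mem : b ∈ S
  ne : a ≠ b
  unit : t = 1 ∨ t = -1
  ne_zero : v a ≠ 0
  eq : (v b + t * v a).natAbs + (v a).natAbs = (v b).natAbs

/-- The cosets obtained by reducing `v` to a unit vector by the Euclidean algorithm. -/
inductive Red : (ι → ℤ) → G ⧸ D.PS S m → Prop
  | base (w : G) (hw : w ∈ D.WS S) : Red (D.ρ w (Pi.single m 1)) (w : G ⧸ D.PS S m)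
  | step (v : ι → ℤ) (a b : ι) (t : ℤ) (h : Desc S v a b t) (c : G ⧸ D.PS S m)
      (hc : Red (D.ρ (D.E a b ^ t) v) c) : Red v ((D.E a b ^ t)⁻¹ • c)

variable {S m}

lemma red_iff {v : ι → ℤ} {c : G ⧸ D.PS S m} : D.Red S m v c ↔
    (∃ w ∈ D.WS S, v = D.ρ w (Pi.single m 1) ∧ c = (w : G ⧸ D.PS S m)) ∨
    ∃ a b t, Desc S v a b t ∧ ∃ x, D.Red S m (D.ρ (D.E a b ^ t) v) x ∧
      c = (D.E a b ^ t)⁻¹ • x := by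
  constructor
  · rintro (⟨w, hw⟩ | ⟨_, a, b, t, h, x, hx⟩)
    · exact Or.inl ⟨w, hw, rfl, rfl⟩
    · exact Or.inr ⟨a, b, t, h, x, hx, rfl⟩
  · rintro (⟨w, hw, rfl, rfl⟩ | ⟨a, b, t, h, x, hx, rfl⟩)
    · exact .base w hw
    · exact .step v a b t h x hx

/-- A signed permutation relabels the entries and changes their signs. It turns descents into
descents, with the exponent corrected by the two signs involved, so reduction is equivariant. -/
lemma red_W {w : G} (hw : w ∈ D.WS S) {v : ι → ℤ} {c : G ⧸ D.PS S m} (h : D.Red S m v c) :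
    D.Red S m (D.ρ w v) (w • c) := by
  induction h with
  | base w' hw' =>
    rw [← ρ_mul_apply]
    exact .base _ (D.WS_mul hw hw')
  | step v a b t h c hc ih =>
    obtain ⟨σ, ε, h1, h2, h3, h4⟩ := D.WS_conj hw
    have h5 := h4 a b h.ne t
    have h6 : w * D.E a b ^ t = D.E (σ a) (σ b) ^ (ε a * ε b * t) * w := by
      rw [← h5, inv_mul_cancel_right]
    have h7 : w • (D.E a b ^ t)⁻¹ • c = (D.E (σ a) (σ b) ^ (ε a * ε b * t))⁻¹ • w • c := by
      rw [eq_inv_smul_iff, smul_smul, smul_smul, ← h6, mul_inv_cancel_right]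
    rw [h7]
    refine .step _ _ _ _ ⟨(h3 a).2 h.left_mem, (h3 b).2 h.right_mem,
      fun h' => h.ne (σ.injective h'), ?_, ?_, ?_⟩ _ ?_
    · rcases h1 a with ha | ha <;> rcases h1 b with hb | hb <;> rcases h.unit with ht | ht <;>
        simp [ha, hb, ht]
    · rw [h2]
      rcases h1 a with ha | ha <;> simp [ha, h.ne_zero]
    · have := h.eq
      rw [h2, h2]
      rcases h1 a with ha | ha <;> rcases h1 b with hb | hb <;> rcases h.unit with ht | ht <;>
        rw [ht] at this <;> rw [ha, hb, ht] <;> omega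
    · rw [← ρ_mul_apply, ← h6, ρ_mul_apply]
      exact ih

/-- The reduction of `v` is well-defined and is invariant under the elementary elements that
obviously fix `v`. -/
def Good (S : Finset ι) (m : ι) (v : ι → ℤ) : Prop :=
  ∃ c, D.Red S m v c ∧ (∀ c', D.Red S m v c' → c' = c) ∧
    ∀ a b, a ∈ S → b ∈ S → a ≠ b → v a = 0 → D.E a b • c = c

lemma Good.eq {D : ElementaryData ι G} {v : ι → ℤ} (h : D.Good S m v) {c c' : G ⧸ D.PS S m}
    (hc : D.Red S m v c) (hc' : D.Red S m v c') : c = c' := by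
  obtain ⟨x, -, h2, -⟩ := h
  rw [h2 c hc, h2 c' hc']

lemma Good.fix {D : ElementaryData ι G} {v : ι → ℤ} (h : D.Good S m v) {c : G ⧸ D.PS S m}
    (hc : D.Red S m v c) {a b : ι} (ha : a ∈ S) (hb : b ∈ S) (hab : a ≠ b) (h0 : v a = 0)
    (t : ℤ) : D.E a b ^ t • c = c := by
  obtain ⟨x, -, h2, h3⟩ := h
  rw [h2 c hc]
  exact zpow_mem (K := MulAction.stabilizer G x) (h3 a b ha hb hab h0) t

/-- The effect on reductions of an elementary element that changes the norm monotonically. -/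
lemma Good.move {D : ElementaryData ι G} {v : ι → ℤ} {a b : ι} {t : ℤ} (ha : a ∈ S) (hb : b ∈ S)
    (hab : a ≠ b) (ht : t = 1 ∨ t = -1) (h : D.Good S m v)
    (h' : D.Good S m (D.ρ (D.E a b ^ t) v)) {c c' : G ⧸ D.PS S m} (hc : D.Red S m v c)
    (hc' : D.Red S m (D.ρ (D.E a b ^ t) v) c')
    (hm : (v b + t * v a).natAbs + (v a).natAbs = (v b).natAbs ∨
      (v b + t * v a).natAbs = (v b).natAbs + (v a).natAbs) : c' = D.E a b ^ t • c := by
  -- If `v a = 0` the vector does not move and goodness says that the coset is fixed. If the norm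
  -- drops, the move is a descent from `v`; if it rises, the inverse move is a descent from the new
  -- vector.
  by_cases h0 : v a = 0
  · rw [h.fix hc ha hb hab h0]
    have h1 : D.ρ (D.E a b ^ t) v = v := by
      rw [D.ρ_zpow hab, h0, mul_zero, add_zero, Function.update_eq_self]
    rw [h1] at hc'
    exact h.eq hc' hc
  · rcases hm with hm | hm
    · rw [← inv_smul_eq_iff]
      exact h.eq (.step v a b t ⟨ha, hb, hab, ht, h0, hm⟩ _ hc') hc
    · have h1 : D.ρ (D.E a b ^ (-t)) (D.ρ (D.E a b ^ t) v) = v := by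
        rw [zpow_neg, ρ_inv_apply]
      refine (h'.eq hc' (.step _ a b (-t) ⟨ha, hb, hab, by omega, ?_, ?_⟩ c ?_)).trans ?_
      · rwa [D.ρ_zpow_ne hab hab]
      · rw [D.ρ_zpow_ne hab hab, D.ρ_zpow_same hab]
        rcases ht with rfl | rfl <;> omega
      · rwa [h1]
      · rw [zpow_neg, inv_inv]

end ElementaryData

/-! ### Confluence of the Euclidean algorithm -/

namespace ElementaryData

variable {ι : Type*} [Fintype ι] [DecidableEq ι] {G : Type*} [Group G] {D : ElementaryData ι G}
  {S : Finset ι} {m : ι}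

/-- The goodness of all vectors of norm less than `N`. -/
def GoodBelow (D : ElementaryData ι G) (S : Finset ι) (m : ι) (N : ℕ) : Prop :=
  ∀ v : ι → ℤ, nrm v < N → Supp S v → Prim v → D.Good S m v

/-- The arithmetic behind `confluent_chain`: once `|y|` has dropped by `|x|`, the drop of `|z|` by
`|y|` splits into a drop by `|y| - |x|` and one by `|x|`. -/
lemma natAbs_chain {x y z s t : ℤ} (ht : t = 1 ∨ t = -1) (hs : s = 1 ∨ s = -1)
    (e1 : (y + t * x).natAbs + x.natAbs = y.natAbs)
    (e2 : (z + s * y).natAbs + y.natAbs = z.natAbs) :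
    (z + s * (y + t * x)).natAbs + (y + t * x).natAbs = z.natAbs ∧
      (z + s * (y + t * x) + -(s * t) * x).natAbs + x.natAbs = (z + s * (y + t * x)).natAbs := by
  rcases ht with rfl | rfl <;> rcases hs with rfl | rfl <;> omega

lemma Desc.nrm_lt {v : ι → ℤ} {a b : ι} {t : ℤ} (h : Desc S v a b t) :
    nrm (D.ρ (D.E a b ^ t) v) < nrm v := by
  have h1 := D.nrm_zpow h.ne t v
  have h2 := h.eq
  have h3 := h.ne_zero
  omega

section Confluence

variable {v : ι → ℤ} (hN : D.GoodBelow S m (nrm v)) (hs : Supp S v) (hp : Prim v)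

include hN hs hp

lemma Desc.good {a b : ι} {t : ℤ} (h : Desc S v a b t) :
    D.Good S m (D.ρ (D.E a b ^ t) v) :=
  hN _ h.nrm_lt (D.supp_zpow h.ne h.right_mem _ hs) (D.prim_ρ _ hp)

/-- Neither descent touches the entries used by the other, so each remains a descent after the
other, and the square closes at a vector of smaller norm. -/
lemma confluent_comm {a b c d : ι} {t s : ℤ} (h : Desc S v a b t) (h' : Desc S v c d s)
    (hbc : b ≠ c) (hda : d ≠ a) (hbd : b ≠ d) {x y : G ⧸ D.PS S m}
    (hx : D.Red S m (D.ρ (D.E a b ^ t) v) x) (hy : D.Red S m (D.ρ (D.E c d ^ s) v) y) :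
    (D.E a b ^ t)⁻¹ • x = (D.E c d ^ s)⁻¹ • y := by
  have hcomm : Commute (D.E a b ^ t) (D.E c d ^ s) :=
    ((D.comm a b c d h.ne h'.ne hbc hda).zpow_left t).zpow_right s
  have g1 := h.good hN hs hp
  have g2 := h'.good hN hs hp
  have d1 : Desc S (D.ρ (D.E a b ^ t) v) c d s :=
    ⟨h'.left_mem, h'.right_mem, h'.ne, h'.unit, by rw [D.ρ_zpow_ne h.ne hbc.symm]; exact h'.ne_zero,
      by rw [D.ρ_zpow_ne h.ne hbc.symm, D.ρ_zpow_ne h.ne hbd.symm]; exact h'.eq⟩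
  have d2 : Desc S (D.ρ (D.E c d ^ s) v) a b t :=
    ⟨h.left_mem, h.right_mem, h.ne, h.unit, by rw [D.ρ_zpow_ne h'.ne hda.symm]; exact h.ne_zero,
      by rw [D.ρ_zpow_ne h'.ne hda.symm, D.ρ_zpow_ne h'.ne hbd]; exact h.eq⟩
  have g3 : D.Good S m (D.ρ (D.E c d ^ s) (D.ρ (D.E a b ^ t) v)) :=
    hN _ (d1.nrm_lt.trans h.nrm_lt)
      (D.supp_zpow h'.ne h'.right_mem _ (D.supp_zpow h.ne h.right_mem _ hs))
      (D.prim_ρ _ (D.prim_ρ _ hp))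
  obtain ⟨z, hz, -, -⟩ := g3
  have hz' : D.Red S m (D.ρ (D.E a b ^ t) (D.ρ (D.E c d ^ s) v)) z := by
    rwa [← ρ_mul_apply, hcomm.eq, ρ_mul_apply]
  rw [g1.eq hx (.step _ _ _ _ d1 _ hz), g2.eq hy (.step _ _ _ _ d2 _ hz'), smul_smul, smul_smul,
    ← mul_inv_rev, ← mul_inv_rev, hcomm.eq]

/-- By `chain`, following `E a b ^ t` with `E b c ^ s` and `E a c ^ (-(s * t))` has the same effect
as following `E b c ^ s` with `E a b ^ t`. All vectors met after `v` have smaller norm and are good.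
The entry `b` may become zero on the way, so a move need not be a descent; `Good.move` allows for
that. -/
lemma confluent_chain {a b c : ι} {t s : ℤ} (h : Desc S v a b t) (h' : Desc S v b c s)
    (hac : a ≠ c) {x y : G ⧸ D.PS S m}
    (hx : D.Red S m (D.ρ (D.E a b ^ t) v) x) (hy : D.Red S m (D.ρ (D.E b c ^ s) v) y) :
    (D.E a b ^ t)⁻¹ • x = (D.E b c ^ s)⁻¹ • y := by
  have hchain := D.chain a b c h.ne h'.ne hac s t
  have e1 := h.eq
  have e2 := h'.eq
  have e3 := h'.ne_zero
  have ut := h.unit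
  have us := h'.unit
  have g1 := h.good hN hs hp
  have g2 := h'.good hN hs hp
  have s1 := D.supp_zpow h.ne h.right_mem t hs
  have s2 := D.supp_zpow h'.ne h'.right_mem s hs
  have p1 := D.prim_ρ (D.E a b ^ t) hp
  have p2 := D.prim_ρ (D.E b c ^ s) hp
  have n1 : nrm (D.ρ (D.E a b ^ t) v) < nrm v := h.nrm_lt
  have n2 : nrm (D.ρ (D.E b c ^ s) v) < nrm v := h'.nrm_lt
  have v1a : D.ρ (D.E a b ^ t) v a = v a := D.ρ_zpow_ne h.ne h.ne t v
  have v1b : D.ρ (D.E a b ^ t) v b = v b + t * v a := D.ρ_zpow_same h.ne t v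
  have v1c : D.ρ (D.E a b ^ t) v c = v c := D.ρ_zpow_ne h.ne h'.ne.symm t v
  have v2a : D.ρ (D.E b c ^ s) v a = v a := D.ρ_zpow_ne h'.ne hac s v
  have v2b : D.ρ (D.E b c ^ s) v b = v b := D.ρ_zpow_ne h'.ne h'.ne s v
  have hgrp : D.E a c ^ (-(s * t)) * (D.E b c ^ s * D.E a b ^ t) = D.E a b ^ t * D.E b c ^ s := by
    have c1 : Commute (D.E a b ^ t * D.E b c ^ s) (D.E a c ^ (s * t)) :=
      Commute.mul_left
        (((D.comm a b a c h.ne hac h.ne.symm hac.symm).zpow_left _).zpow_right _)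
        (((D.comm b c a c h'.ne hac hac.symm h'.ne.symm).zpow_left _).zpow_right _)
    rw [hchain, c1.eq, zpow_neg, inv_mul_cancel_left]
  have hfin : D.ρ (D.E a c ^ (-(s * t))) (D.ρ (D.E b c ^ s) (D.ρ (D.E a b ^ t) v)) =
      D.ρ (D.E a b ^ t) (D.ρ (D.E b c ^ s) v) := by
    rw [← ρ_mul_apply, ← ρ_mul_apply, ← ρ_mul_apply, mul_assoc, hgrp]
  generalize D.ρ (D.E a b ^ t) v = v1 at *
  generalize D.ρ (D.E b c ^ s) v = v2 at *
  have m1 : (v1 c + s * v1 b).natAbs + (v1 b).natAbs = (v1 c).natAbs := by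
    rw [v1b, v1c]
    exact (natAbs_chain ut us e1 e2).1
  have n3 := D.nrm_zpow h'.ne s v1
  have w1a : D.ρ (D.E b c ^ s) v1 a = v1 a := D.ρ_zpow_ne h'.ne hac s v1
  have w1c : D.ρ (D.E b c ^ s) v1 c = v1 c + s * v1 b := D.ρ_zpow_same h'.ne s v1
  have gw : D.Good S m (D.ρ (D.E b c ^ s) v1) :=
    hN _ (by omega) (D.supp_zpow h'.ne h'.right_mem s s1) (D.prim_ρ _ p1)
  have m3 : (v2 b + t * v2 a).natAbs + (v2 a).natAbs = (v2 b).natAbs := by rw [v2a, v2b]; exact e1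
  have n5 := D.nrm_zpow h.ne t v2
  have gz : D.Good S m (D.ρ (D.E a b ^ t) v2) :=
    hN _ (by omega) (D.supp_zpow h.ne h.right_mem _ s2) (D.prim_ρ _ p2)
  obtain ⟨r, hr, -⟩ := id gw
  obtain ⟨z, hz, -⟩ := id gz
  have k1 : r = D.E b c ^ s • x := g1.move h'.left_mem h'.right_mem h'.ne us gw hx hr (Or.inl m1)
  have k3 : z = D.E a b ^ t • y := g2.move h.left_mem h.right_mem h.ne ut gz hy hz (Or.inl m3)
  have k2 : z = D.E a c ^ (-(s * t)) • r := by
    rw [← hfin] at gz hz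
    refine gw.move h.left_mem h'.right_mem hac ?_ gz hr hz (Or.inl ?_)
    · rcases ut with rfl | rfl <;> rcases us with rfl | rfl <;> simp
    · rw [w1a, w1c, v1a, v1b, v1c]
      exact (natAbs_chain ut us e1 e2).2
  have k4 : D.E a b ^ t • y = (D.E a b ^ t * D.E b c ^ s * (D.E a b ^ t)⁻¹) • x := by
    rw [← k3, k2, k1, smul_smul, ← hgrp, ← mul_assoc, mul_inv_cancel_right]
  rw [eq_inv_smul_iff, ← smul_left_cancel_iff (D.E a b ^ t), k4, smul_smul, smul_smul, mul_assoc]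

/-- Both descents exist only if the two entries have equal absolute value, so the first makes the
entry `b` vanish. Then `E b a` fixes the coset reached, and `weyl` matches it with the other
reduction through a signed permutation. -/
lemma confluent_opposite {a b : ι} {t : ℤ} (h : Desc S v a b t) (h' : Desc S v b a t)
    {x y : G ⧸ D.PS S m}
    (hx : D.Red S m (D.ρ (D.E a b ^ t) v) x) (hy : D.Red S m (D.ρ (D.E b a ^ t) v) y) :
    (D.E a b ^ t)⁻¹ • x = (D.E b a ^ t)⁻¹ • y := by
  obtain ⟨w, hw, hrel⟩ := D.weyl a b h.ne t h.unit
  have g1 := h.good hN hs hp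
  have e1 := h.eq
  have e2 := h'.eq
  have h0 : D.ρ (D.E a b ^ t) v b = 0 := by
    rw [D.ρ_zpow_same h.ne]
    omega
  have h1 := g1.fix hx h.right_mem h.left_mem h'.ne h0 (-t)
  have h2 : D.ρ (D.E b a ^ (-t)) (D.ρ (D.E a b ^ t) v) = D.ρ (D.E a b ^ t) v := by
    rw [D.ρ_zpow h'.ne, h0, mul_zero, add_zero, Function.update_eq_self]
  have hwS : w ∈ D.WS S := by
    refine ⟨hw, fun i hi => ?_⟩
    have ha : a ≠ i := by rintro rfl; exact hi h.left_mem
    have hb : b ≠ i := by rintro rfl; exact hi h.right_mem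
    have h3 : w = D.E b a ^ (-t) * D.E a b ^ t * (D.E b a ^ (-t)) := by
      rw [hrel, zpow_neg, mul_inv_cancel_right]
    rw [h3]
    simp only [ρ_mul_apply, D.ρ_zpow h.ne, D.ρ_zpow h'.ne]
    simp [ha, hb, h.ne, h'.ne]
    ext j
    simp only [Function.update_apply, Pi.single_apply]
    split_ifs <;> simp_all
  have h4 : D.ρ w (D.ρ (D.E b a ^ t) v) = D.ρ (D.E a b ^ t) v := by
    rw [← ρ_mul_apply, ← hrel, ρ_mul_apply, h2]
  have h5 := D.red_W hwS hy
  rw [h4] at h5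
  have h6 : x = w • y := g1.eq hx h5
  rw [← smul_left_cancel_iff (D.E b a ^ (-t) * D.E a b ^ t), ← smul_smul, smul_inv_smul, h1, h6,
    hrel, ← smul_smul, smul_inv_smul]

lemma confluent {a b c d : ι} {t s : ℤ} (h : Desc S v a b t) (h' : Desc S v c d s)
    {x y : G ⧸ D.PS S m}
    (hx : D.Red S m (D.ρ (D.E a b ^ t) v) x) (hy : D.Red S m (D.ρ (D.E c d ^ s) v) y) :
    (D.E a b ^ t)⁻¹ • x = (D.E c d ^ s)⁻¹ • y := by
  -- Two sources `a` and `c` with the same target `b`: the smaller of their entries also decreases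
  -- the larger one, and the descent from `a` to `c` can be compared with both.
  have aux : ∀ {a c : ι} {t s : ℤ}, Desc S v a b t → Desc S v c b s → a ≠ c →
      (v a).natAbs ≤ (v c).natAbs → ∀ {x y : G ⧸ D.PS S m},
      D.Red S m (D.ρ (D.E a b ^ t) v) x → D.Red S m (D.ρ (D.E c b ^ s) v) y →
      (D.E a b ^ t)⁻¹ • x = (D.E c b ^ s)⁻¹ • y := fun {a c t s} h h' hac hle {x y} hx hy => by
    obtain ⟨r, hr⟩ : ∃ r, Desc S v a c r := by
      rcases le_total (v c * v a) 0 with h0 | h0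
      · refine ⟨1, h.left_mem, h'.left_mem, hac, Or.inl rfl, h.ne_zero, ?_⟩
        rcases mul_nonpos_iff.1 h0 with h1 | h1 <;> omega
      · refine ⟨-1, h.left_mem, h'.left_mem, hac, Or.inr rfl, h.ne_zero, ?_⟩
        rcases mul_nonneg_iff.1 h0 with h1 | h1 <;> omega
    obtain ⟨z, hz, -⟩ := hr.good hN hs hp
    exact (confluent_comm hN hs hp h hr h.ne.symm hac.symm h'.ne.symm hx hz).trans
      (confluent_chain hN hs hp hr h' h.ne hz hy)
  by_cases hbd : b = d
  · subst hbd
    by_cases hac : a = c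
    · subst hac
      have hts : t = s := by
        have e1 := h.eq
        have e2 := h'.eq
        have e3 := h.ne_zero
        rcases h.unit with rfl | rfl <;> rcases h'.unit with rfl | rfl <;> omega
      subst hts
      rw [(h.good hN hs hp).eq hx hy]
    · rcases le_total (v a).natAbs (v c).natAbs with hle | hle
      · exact aux h h' hac hle hx hy
      · exact (aux h' h (Ne.symm hac) hle hy hx).symm
  · by_cases hbc : b = c
    · subst hbc
      by_cases had : a = d
      · subst had
        have hts : t = s := by
          have e1 := h.eq
          have e2 := h'.eq
          have e3 := h.ne_zero
          rcases h.unit with rfl | rfl <;> rcases h'.unit with rfl | rfl <;> omega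
        subst hts
        exact confluent_opposite hN hs hp h h' hx hy
      · exact confluent_chain hN hs hp h h' had hx hy
    · by_cases had : a = d
      · subst had
        exact (confluent_chain hN hs hp h' h (Ne.symm hbc) hy hx).symm
      · exact confluent_comm hN hs hp h h' hbc (Ne.symm had) hbd hx hy

omit [Fintype ι] hN hp in
lemma exists_desc {a b : ι} (hab : a ≠ b) (ha : v a ≠ 0) (hb : v b ≠ 0) :
    ∃ a b t, Desc S v a b t := by
  have hS : ∀ i, v i ≠ 0 → i ∈ S := fun i hi => by
    by_contra h
    exact hi (hs i h)
  have aux : ∀ {a b : ι}, a ≠ b → v a ≠ 0 → v b ≠ 0 → (v a).natAbs ≤ (v b).natAbs →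
      ∃ a b t, Desc S v a b t := fun {a b} hab ha hb hle => by
    rcases le_total (v b * v a) 0 with h0 | h0
    · refine ⟨a, b, 1, hS a ha, hS b hb, hab, Or.inl rfl, ha, ?_⟩
      rcases mul_nonpos_iff.1 h0 with h1 | h1 <;> omega
    · refine ⟨a, b, -1, hS a ha, hS b hb, hab, Or.inr rfl, ha, ?_⟩
      rcases mul_nonneg_iff.1 h0 with h1 | h1 <;> omega
  rcases le_total (v a).natAbs (v b).natAbs with hle | hle
  · exact aux hab ha hb hle
  · exact aux hab.symm hb ha hle

/-- Uniqueness is confluence at the first step. For the fixing property, a zero entry `p` is neither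
the source nor the target of the descent. So `E p q` commutes with the descent or, if `q` is its
source, produces an extra power of `E p b`, which also fixes the coset reached. -/
lemma good_of_desc {a b : ι} {t : ℤ} (h : Desc S v a b t) : D.Good S m v := by
  have g := h.good hN hs hp
  obtain ⟨x, hx, -⟩ := id g
  refine ⟨(D.E a b ^ t)⁻¹ • x, .step _ _ _ _ h _ hx, fun c hc => ?_, fun p q hP hQ hpq h0 => ?_⟩
  · rcases D.red_iff.1 hc with ⟨w, hw, rfl, rfl⟩ | ⟨c, d, s, h', y, hy, rfl⟩
    -- Here `v` would have norm one, so a descent would lead to the zero vector, which is not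
    -- primitive.
    · exfalso
      have h1 := h.nrm_lt (D := D)
      rw [D.nrm_W hw.1] at h1
      have h2 : nrm (Pi.single m 1 : ι → ℤ) = 1 := by
        rw [nrm, Finset.sum_eq_single m] <;> simp +contextual
      rw [h2, Nat.lt_one_iff, nrm, Finset.sum_eq_zero_iff] at h1
      have h3 := D.prim_ρ (D.E a b ^ t) hp 0 fun i => by
        have := h1 i (Finset.mem_univ i)
        simpa using this
      simp at h3
    · exact confluent hN hs hp h' h hy hx
  · have hpa : p ≠ a := by rintro rfl; exact h.ne_zero h0
    have hpb : p ≠ b := by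
      rintro rfl
      have e1 := h.eq
      have e2 := h.ne_zero
      omega
    have h1 : D.ρ (D.E a b ^ t) v p = 0 := by rw [D.ρ_zpow_ne h.ne hpb, h0]
    have hfix : ∀ q, q ∈ S → p ≠ q → ∀ s : ℤ, D.E p q ^ s • x = x := fun q hQ hpq s =>
      g.fix hx hP hQ hpq h1 s
    have hfix1 := hfix q hQ hpq 1
    rw [zpow_one] at hfix1
    by_cases hqa : q = a
    · subst hqa
      have hc := D.chain p q b hpq h.ne hpb t 1
      rw [zpow_one, mul_one] at hc
      have c1 : Commute (D.E q b ^ t) (D.E p b ^ t) :=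
        ((D.comm q b p b h.ne hpb hpb.symm h.ne.symm).zpow_left _).zpow_right _
      rw [eq_inv_smul_iff, smul_smul, smul_smul, hc, mul_assoc _ _ (D.E p b ^ t), c1.eq,
        mul_assoc, mul_inv_cancel_right, ← smul_smul, hfix b h.right_mem hpb, hfix1]
    · have c1 : Commute (D.E p q) (D.E a b ^ t) := (D.comm p q a b hpq h.ne hqa hpb.symm).zpow_right t
      rw [smul_smul, c1.inv_right.eq, ← smul_smul, hfix1]

end Confluence

/-- Such a vector is a unit vector up to sign. At the index `m` a wrong sign is corrected by `flip`;
every other index is reached from `m` by a Weyl element, with either sign. -/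
lemma exists_WS_eq (hm : m ∈ S) {v : ι → ℤ} (hs : Supp S v) (hp : Prim v)
    (h1 : ∀ a b, a ≠ b → v a ≠ 0 → v b = 0) : ∃ w ∈ D.WS S, v = D.ρ w (Pi.single m 1) := by
  obtain ⟨i, hi⟩ : ∃ i, v i ≠ 0 := by
    by_contra! h
    simpa using hp 0 fun i => by rw [h i]
  have hiS : i ∈ S := by
    by_contra h
    exact hi (hs i h)
  have h2 : v = Pi.single i (v i) := by
    ext j
    by_cases hj : j = i
    · subst hj; simp
    · rw [Pi.single_eq_of_ne hj, h1 i j (Ne.symm hj) hi]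
  have h3 : v i = 1 ∨ v i = -1 := by
    rw [← Int.isUnit_iff]
    refine hp _ fun j => ?_
    by_cases hj : j = i
    · subst hj; rfl
    · rw [h1 i j (Ne.symm hj) hi]
      exact dvd_zero _
  by_cases him : i = m
  · subst him
    rcases h3 with h3 | h3
    · exact ⟨1, ⟨one_mem _, by simp⟩, by rw [map_one, Module.End.one_apply, h2, h3]⟩
    · obtain ⟨w, hw, hw'⟩ := D.flip i
      refine ⟨w, ⟨hw, fun j hj => ?_⟩, ?_⟩
      · have hij : i ≠ j := by rintro rfl; exact hj hiS
        rw [hw']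
        simp [hij]
      · rw [hw', h2, h3]
        ext j
        by_cases hj : j = i
        · subst hj; simp
        · simp [hj]
  -- The exponent `-(v i)` is chosen so that `w` sends the unit vector at `m` to `v i` times the one
  -- at `i`.
  · obtain ⟨w, hw, hw'⟩ := D.weyl i m him (-(v i)) (by omega)
    have h4 : w = D.E m i ^ (v i) * D.E i m ^ (-(v i)) * D.E m i ^ (v i) := by
      rw [← mul_inv_eq_iff_eq_mul, ← zpow_neg] at hw'
      rw [← hw', neg_neg]
    have h5 : ∀ u, D.ρ w u = D.ρ (D.E m i ^ (v i)) (D.ρ (D.E i m ^ (-(v i)))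
        (D.ρ (D.E m i ^ (v i)) u)) := fun u => by rw [h4, ρ_mul_apply, ρ_mul_apply]
    simp only [D.ρ_zpow him, D.ρ_zpow (Ne.symm him)] at h5
    refine ⟨w, ⟨hw, fun j hj => ?_⟩, ?_⟩
    · have hij : i ≠ j := by rintro rfl; exact hj hiS
      have hmj : m ≠ j := by rintro rfl; exact hj hm
      rw [h5]
      simp [hij, hmj, him, Ne.symm him]
      clear h2 h5
      ext j
      simp only [Function.update_apply, Pi.single_apply]
      split_ifs <;> simp_all
    · rw [h5]
      ext j
      by_cases hj : j = i
      · subst hj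
        rcases h3 with h3 | h3 <;> simp [h3, him, Ne.symm him]
      · rw [h1 i j (Ne.symm hj) hi]
        by_cases hjm : j = m
        · subst hjm
          rcases h3 with h3 | h3 <;> simp [h3, him, Ne.symm him]
        · simp [hj, hjm]

/-- The Euclidean reduction of a primitive vector is well-defined. -/
theorem good (hm : m ∈ S) (v : ι → ℤ) (hs : Supp S v) (hp : Prim v) : D.Good S m v := by
  induction hN : nrm v using Nat.strong_induction_on generalizing v with
  | _ N ih =>
    have hN' : D.GoodBelow S m (nrm v) := fun u hu hsu hpu => ih _ (hN ▸ hu) u hsu hpu rfl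
    by_cases hterm : ∃ a b, a ≠ b ∧ v a ≠ 0 ∧ v b ≠ 0
    · obtain ⟨a, b, hab, ha, hb⟩ := hterm
      obtain ⟨a, b, t, h⟩ := exists_desc hs hab ha hb
      exact good_of_desc hN' hs hp h
    · push Not at hterm
      obtain ⟨w, hw, hv⟩ := exists_WS_eq (D := D) hm hs hp hterm
      refine ⟨(w : G ⧸ D.PS S m), hv ▸ .base w hw, fun c hc => ?_, fun a b ha hb hab h0 => ?_⟩
      · rcases D.red_iff.1 hc with ⟨w', hw', hv', rfl⟩ | ⟨a, b, t, h, -⟩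
        -- Two signed permutations with the same effect on the unit vector at `m` differ by one that
        -- fixes it, and this is a generator of `PS S m`.
        · refine QuotientGroup.eq.2 (Subgroup.subset_closure (Or.inr ?_))
          have h1 := D.WS_mul (D.WS_inv hw') hw
          refine ⟨h1.1, fun i hi => ?_⟩
          by_cases hi' : i = m
          · subst hi'
            rw [ρ_mul_apply, ← hv, hv', ρ_inv_apply]
          · exact h1.2 i fun h => hi (Finset.mem_erase.2 ⟨hi', h⟩)
        · have e1 := hterm a b h.ne h.ne_zero
          have e2 := h.eq
          have e3 := h.ne_zero
          omega
      -- Conjugation by `w⁻¹` turns `E a b` into an elementary element up to inversion. Its source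
      -- is not `m`, because `v` is zero at `a`, so it lies in `PS S m`.
      · obtain ⟨σ, ε, h1, h2, h3, h4⟩ := D.WS_conj (D.WS_inv hw)
        have h5 := h4 a b hab 1
        rw [zpow_one, inv_inv] at h5
        change ((D.E a b * w : G) : G ⧸ D.PS S m) = (w : G ⧸ D.PS S m)
        refine (QuotientGroup.eq.2 ?_).symm
        rw [← mul_assoc, h5]
        refine zpow_mem (K := D.PS S m) (Subgroup.subset_closure (Or.inl ⟨_, (h3 a).2 ha, _,
          (h3 b).2 hb, fun h => hab (σ.injective h), fun h => ?_, rfl⟩)) _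
        have h6 := h2 v a
        rw [hv, ρ_inv_apply, ← hv, h0, h, Pi.single_eq_same, mul_zero] at h6
        exact one_ne_zero h6

end ElementaryData

/-! ### Stabilizers of unit vectors and induction on the support -/

namespace ElementaryData

variable {ι : Type*} [Fintype ι] [DecidableEq ι] {G : Type*} [Group G] {D : ElementaryData ι G}
  {S : Finset ι} {m : ι}

/-- A monotone change of the norm is covered by `Good.move`. Otherwise the entry `b` overshoots
zero; then `weyl` rewrites the move as `E b a ^ t * w * E b a ^ t`, where both elementary factors do
change the norm monotonically. -/
lemma red_zpow (hm : m ∈ S) {v : ι → ℤ} (hs : Supp S v) (hp : Prim v) {c : G ⧸ D.PS S m}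
    (hc : D.Red S m v c) {a b : ι} (ha : a ∈ S) (hb : b ∈ S) (hab : a ≠ b) {t : ℤ}
    (ht : t = 1 ∨ t = -1) : D.Red S m (D.ρ (D.E a b ^ t) v) (D.E a b ^ t • c) := by
  have hgood : ∀ {a b : ι} {v : ι → ℤ} (t : ℤ), Supp S v → Prim v → b ∈ S → a ≠ b →
      D.Good S m (D.ρ (D.E a b ^ t) v) := fun t hs hp hb hab =>
    good hm _ (D.supp_zpow hab hb _ hs) (D.prim_ρ _ hp)
  have gu := hgood t hs hp hb hab
  obtain ⟨x, hx, -⟩ := id gu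
  by_cases hmono : (v b + t * v a).natAbs + (v a).natAbs = (v b).natAbs ∨
      (v b + t * v a).natAbs = (v b).natAbs + (v a).natAbs
  · rwa [← (good hm v hs hp).move ha hb hab ht gu hc hx hmono]
  · obtain ⟨w, hw, hrel⟩ := D.weyl a b hab t ht
    have hwS : w ∈ D.WS S := by
      refine ⟨hw, fun i hi => ?_⟩
      have hai : a ≠ i := by rintro rfl; exact hi ha
      have hbi : b ≠ i := by rintro rfl; exact hi hb
      have h3 : w = D.E b a ^ (-t) * D.E a b ^ t * (D.E b a ^ (-t)) := by
        rw [hrel, zpow_neg, mul_inv_cancel_right]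
      rw [h3]
      simp only [ρ_mul_apply, D.ρ_zpow hab, D.ρ_zpow hab.symm]
      ext j
      simp only [Function.update_apply, Pi.single_apply]
      split_ifs <;> simp_all
    obtain ⟨n1, n2⟩ : (v a + t * v b).natAbs + (v b).natAbs = (v a).natAbs ∧
        (v a + (-t) * (v b + t * v a)).natAbs + (v b + t * v a).natAbs = (v a).natAbs := by
      rcases ht with rfl | rfl <;> omega
    have gv' := hgood t hs hp ha hab.symm
    obtain ⟨y, hy, -⟩ := id gv'
    have hy' := (good hm v hs hp).move hb ha hab.symm ht gv' hc hy (Or.inl n1)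
    have hz := D.red_W hwS hy
    rw [← ρ_mul_apply, ← hrel, ρ_mul_apply, hy', smul_smul, ← hrel] at hz
    have gz := hgood (-t) (D.supp_zpow hab hb t hs) (D.prim_ρ (D.E a b ^ t) hp) ha hab.symm
    have hfin := gu.move hb ha hab.symm (by omega) gz hx hz
      (Or.inl (by rw [D.ρ_zpow_ne hab hab, D.ρ_zpow_same hab]; exact n2))
    rw [← smul_smul, smul_left_cancel_iff] at hfin
    rwa [hfin]

lemma red_GS (hm : m ∈ S) {g : G} (hg : g ∈ D.GS S) : ∀ {v : ι → ℤ}, Supp S v → Prim v →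
    ∀ {c : G ⧸ D.PS S m}, D.Red S m v c → Supp S (D.ρ g v) ∧ D.Red S m (D.ρ g v) (g • c) := by
  induction hg using Subgroup.closure_induction'' with
  | mem x hx =>
    intro v hs hp c hc
    rcases hx with ⟨a, ha, b, hb, hab, rfl⟩ | hx
    · have h1 := red_zpow hm hs hp hc ha hb hab (Or.inl rfl)
      have h2 := D.supp_zpow hab hb 1 hs
      rw [zpow_one] at h1 h2
      exact ⟨h2, h1⟩
    · exact ⟨D.supp_WS hx hs, D.red_W hx hc⟩
  | inv_mem x hx =>
    intro v hs hp c hc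
    rcases hx with ⟨a, ha, b, hb, hab, rfl⟩ | hx
    · have h1 := red_zpow hm hs hp hc ha hb hab (Or.inr rfl)
      have h2 := D.supp_zpow hab hb (-1) hs
      rw [zpow_neg_one] at h1 h2
      exact ⟨h2, h1⟩
    · exact ⟨D.supp_WS (D.WS_inv hx) hs, D.red_W (D.WS_inv hx) hc⟩
  | one =>
    intro v hs hp c hc
    rw [map_one, one_smul]
    exact ⟨hs, hc⟩
  | mul x y _ _ hx hy =>
    intro v hs hp c hc
    obtain ⟨h1, h2⟩ := hy hs hp hc
    obtain ⟨h3, h4⟩ := hx h1 (D.prim_ρ _ hp) h2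
    rw [ρ_mul_apply, ← smul_smul]
    exact ⟨h3, h4⟩

omit [Fintype ι] in
lemma prim_single (m : ι) : Prim (Pi.single m 1 : ι → ℤ) := fun d hd => by
  have := hd m
  rw [Pi.single_eq_same] at this
  exact isUnit_of_dvd_one this

omit [Fintype ι] in
lemma supp_single (hm : m ∈ S) : Supp S (Pi.single m 1 : ι → ℤ) := fun i hi =>
  Pi.single_eq_of_ne (by rintro rfl; exact hi hm) _

/-- The stabilizer of a unit vector. -/
theorem mem_PS (hm : m ∈ S) {g : G} (hg : g ∈ D.GS S)
    (h : D.ρ g (Pi.single m 1) = Pi.single m 1) : g ∈ D.PS S m := by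
  have h1 : D.Red S m (Pi.single m 1) ((1 : G) : G ⧸ D.PS S m) := by
    have := Red.base (D := D) (S := S) (m := m) 1 ⟨one_mem _, by simp⟩
    rwa [map_one, Module.End.one_apply] at this
  -- Equivariance attaches the coset of `g` as well as the trivial coset to the unit vector;
  -- uniqueness of the reduction identifies them.
  have h2 := (red_GS hm hg (supp_single hm) (prim_single m) h1).2
  rw [h] at h2
  have h3 := (good hm _ (supp_single hm) (prim_single m)).eq h1 h2
  change ((1 : G) : G ⧸ D.PS S m) = ((g * 1 : G) : G ⧸ D.PS S m) at h3
  rw [QuotientGroup.eq, inv_one, one_mul, mul_one] at h3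
  exact h3

lemma GS_fix {g : G} (hg : g ∈ D.GS S) {i : ι} (hi : i ∉ S) :
    D.ρ g (Pi.single i 1) = Pi.single i 1 ∧ ∀ v, D.ρ g v i = v i := by
  induction hg using Subgroup.closure_induction with
  | mem x hx =>
    rcases hx with ⟨a, ha, b, hb, hab, rfl⟩ | hx
    · have hai : a ≠ i := by rintro rfl; exact hi ha
      have hbi : b ≠ i := by rintro rfl; exact hi hb
      simp [D.ρ_E _ _ _ hab, hai, hbi, hbi.symm]
    · refine ⟨hx.2 i hi, fun v => ?_⟩
      obtain ⟨σ, ε, h1, h2, -⟩ := D.WS_conj hx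
      have h3 := hx.2 i hi
      have h4 := h2 (Pi.single i 1) i
      rw [h3, Pi.single_eq_same, mul_one] at h4
      have h5 : σ i = i := by
        by_contra h
        rw [Pi.single_eq_of_ne h] at h4
        rcases h1 i with h | h <;> omega
      have h6 := h2 v i
      rw [h5, Pi.single_eq_same] at h4
      rw [h5, ← h4, one_mul] at h6
      exact h6
  | one => simp
  | mul x y _ _ hx hy =>
    refine ⟨by rw [ρ_mul_apply, hy.1, hx.1], fun v => by rw [ρ_mul_apply, hx.2, hy.2]⟩
  | inv x _ hx =>
    refine ⟨?_, fun v => ?_⟩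
    · conv_lhs => rw [← hx.1]
      exact D.ρ_inv_apply _ _
    · conv_rhs => rw [← D.ρ_apply_inv x v]
      exact (hx.2 _).symm

/-- The product of the elementary elements `E i m ^ x i` for `i ∈ S`, `i ≠ m`. -/
noncomputable def transl (D : ElementaryData ι G) (S : Finset ι) (m : ι) :
    (ι → Multiplicative ℤ) →* G :=
  MonoidHom.noncommPiCoprod (fun i => zpowersHom G (if i ∈ S ∧ i ≠ m then D.E i m else 1)) (by
    intro i j hij x y
    simp only [zpowersHom_apply]
    refine Commute.zpow_zpow ?_ _ _
    split_ifs with h1 h2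
    · exact D.comm _ _ _ _ h1.2 h2.2 h2.2.symm h1.2.symm
    all_goals first | exact Commute.one_right _ | exact Commute.one_left _)

lemma transl_single {i : ι} (hi : i ∈ S) (him : i ≠ m) :
    D.transl S m (Pi.mulSingle i (Multiplicative.ofAdd 1)) = D.E i m := by
  refine (MonoidHom.noncommPiCoprod_mulSingle _ _ _).trans ?_
  simp [hi, him]

/-- The group generated by the elementary elements `E i m`. -/
def TS (D : ElementaryData ι G) (S : Finset ι) (m : ι) : Subgroup G :=
  Subgroup.closure {g | ∃ i ∈ S, i ≠ m ∧ g = D.E i m}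

/-- For fixed `m` the `E i m` commute, so an element of `TS S m` is determined by its exponents, and
these can be read off from its matrix. -/
lemma exists_transl {g : G} (hg : g ∈ D.TS S m) : ∃ x : ι → ℤ, (∀ i, i ∉ S ∨ i = m → x i = 0) ∧
    g = D.transl S m (fun i => Multiplicative.ofAdd (x i)) ∧
    ∀ v, D.ρ g v = Function.update v m (v m + ∑ i, x i * v i) := by
  induction hg using Subgroup.closure_induction with
  | mem g hg =>
    obtain ⟨i, hi, him, rfl⟩ := hg
    refine ⟨Pi.single i 1, fun j hj => Pi.single_eq_of_ne ?_ _, ?_, fun v => ?_⟩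
    · rintro rfl
      tauto
    · rw [← transl_single hi him]
      rfl
    · rw [D.ρ_E _ _ _ him, Finset.sum_eq_single i]
      · simp
      · intro j _ hj
        simp [hj]
      · simp
  | one =>
    refine ⟨0, fun _ _ => rfl, ?_, fun v => by simp⟩
    exact (map_one (D.transl S m)).symm
  | mul g h _ _ hg hh =>
    obtain ⟨x, x1, x2, x3⟩ := hg
    obtain ⟨y, y1, y2, y3⟩ := hh
    refine ⟨x + y, fun i hi => by simp [x1 i hi, y1 i hi], ?_, fun v => ?_⟩
    · rw [x2, y2, ← map_mul]
      rfl
    · rw [ρ_mul_apply, y3, x3]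
      simp only [Function.update_self, Function.update_idem]
      congr 1
      have : ∑ i, x i * Function.update v m (v m + ∑ i, y i * v i) i = ∑ i, x i * v i :=
        Finset.sum_congr rfl fun i _ => by
          by_cases him : i = m
          · rw [x1 i (Or.inr him), zero_mul, zero_mul]
          · rw [Function.update_of_ne him]
      rw [this]
      simp only [Pi.add_apply, add_mul, Finset.sum_add_distrib]
      ring
  | inv g _ hg =>
    obtain ⟨x, x1, x2, x3⟩ := hg
    refine ⟨-x, fun i hi => by simp [x1 i hi], ?_, fun v => ?_⟩
    · rw [x2, ← map_inv]
      rfl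
    · have h : D.ρ g (Function.update v m (v m + ∑ i, (-x) i * v i)) = v := by
        rw [x3]
        have : ∑ i, x i * Function.update v m (v m + ∑ i, (-x) i * v i) i = ∑ i, x i * v i :=
          Finset.sum_congr rfl fun i _ => by
            by_cases him : i = m
            · rw [x1 i (Or.inr him), zero_mul, zero_mul]
            · rw [Function.update_of_ne him]
        rw [this]
        simp
      conv_lhs => rw [← h]
      rw [ρ_inv_apply]

lemma exists_mem_TS (x : ι → ℤ) (hx : ∀ i, i ∉ S ∨ i = m → x i = 0) :
    ∃ g ∈ D.TS S m, ∀ v, D.ρ g v = Function.update v m (v m + ∑ i, x i * v i) := by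
  have key : ∀ T : Finset ι, ∃ g ∈ D.TS S m,
      ∀ v, D.ρ g v = Function.update v m (v m + ∑ i ∈ T, x i * v i) := fun T => by
    induction T using Finset.induction_on with
    | empty => exact ⟨1, one_mem _, fun v => by simp⟩
    | insert j T hj ih =>
      obtain ⟨g, hg, hg'⟩ := ih
      by_cases hj' : j ∉ S ∨ j = m
      · refine ⟨g, hg, fun v => ?_⟩
        rw [hg', Finset.sum_insert hj, hx j hj', zero_mul, zero_add]
      · push Not at hj'
        refine ⟨D.E j m ^ x j * g, mul_mem (zpow_mem (K := D.TS S m)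
          (Subgroup.subset_closure ⟨j, hj'.1, hj'.2, rfl⟩) _) hg, fun v => ?_⟩
        rw [ρ_mul_apply, hg', D.ρ_zpow hj'.2, Finset.sum_insert hj]
        simp only [Function.update_self, Function.update_idem, Function.update_of_ne hj'.2]
        congr 1
        ring
  exact key Finset.univ

/-- This makes `PS S m` a product of translations and a smaller block, like an affine group. By
`chain`, an elementary element with target `i` multiplies `E i m` by a power of some `E a m`; the
other ones in the block commute with `E i m`. -/
lemma TS_conj {h : G} (hh : h ∈ D.GS (S.erase m)) :
    ∀ g ∈ D.TS S m, h * g * h⁻¹ ∈ D.TS S m := by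
  have red : ∀ h : G, (∀ i ∈ S, i ≠ m → h * D.E i m * h⁻¹ ∈ D.TS S m) →
      ∀ g ∈ D.TS S m, h * g * h⁻¹ ∈ D.TS S m := fun h hgen g hg => by
    induction hg using Subgroup.closure_induction with
    | mem x hx =>
      obtain ⟨i, hi, him, rfl⟩ := hx
      exact hgen i hi him
    | one => simp
    | mul x y _ _ hx hy =>
      have : h * (x * y) * h⁻¹ = h * x * h⁻¹ * (h * y * h⁻¹) := by group
      rw [this]
      exact mul_mem hx hy
    | inv x _ hx =>
      have : h * x⁻¹ * h⁻¹ = (h * x * h⁻¹)⁻¹ := by group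
      rw [this]
      exact inv_mem hx
  have hE : ∀ i ∈ S, i ≠ m → D.E i m ∈ D.TS S m := fun i hi him =>
    Subgroup.subset_closure ⟨i, hi, him, rfl⟩
  have elem : ∀ a ∈ S.erase m, ∀ b ∈ S.erase m, a ≠ b → ∀ t : ℤ, ∀ i ∈ S, i ≠ m →
      D.E a b ^ t * D.E i m * (D.E a b ^ t)⁻¹ ∈ D.TS S m := fun a ha b hb hab t i hi him => by
    obtain ⟨ham, ha⟩ := Finset.mem_erase.1 ha
    obtain ⟨hbm, hb⟩ := Finset.mem_erase.1 hb
    by_cases hbi : b = i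
    · subst hbi
      have hc := D.chain a b m hab him ham 1 t
      rw [zpow_one, one_mul] at hc
      have c1 : Commute (D.E b m) (D.E a m ^ t) :=
        (D.comm b m a m him ham ham.symm him.symm).zpow_right t
      have c2 : Commute (D.E a b ^ t) (D.E a m ^ t) :=
        ((D.comm a b a m hab ham hab.symm ham.symm).zpow_left t).zpow_right t
      have e : D.E a b ^ t * D.E b m * (D.E a b ^ t)⁻¹ = D.E b m * (D.E a m ^ t)⁻¹ := by
        rw [mul_inv_eq_iff_eq_mul, mul_assoc, ← c2.inv_right.eq, ← mul_assoc, hc,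
          mul_inv_cancel_right]
      rw [e]
      exact mul_mem (hE b hb hbm) (inv_mem (zpow_mem (K := D.TS S m) (hE a ha ham) _))
    · have c : Commute (D.E a b ^ t) (D.E i m) :=
        (D.comm a b i m hab him hbi ham.symm).zpow_left t
      rw [c.eq, mul_inv_cancel_right]
      exact hE i hi him
  have weyl : ∀ w ∈ D.WS (S.erase m), ∀ i ∈ S, i ≠ m → w * D.E i m * w⁻¹ ∈ D.TS S m :=
    fun w hw i hi him => by
      obtain ⟨σ, ε, h1, h2, h3, h4⟩ := D.WS_conj hw
      have h5 : σ m = m := by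
        have h6 := hw.2 m (Finset.notMem_erase m S)
        have h7 := h2 (Pi.single m 1) m
        rw [h6, Pi.single_eq_same] at h7
        by_contra h
        rw [Pi.single_eq_of_ne h] at h7
        rcases h1 m with h | h <;> omega
      have h6 := h4 i m him 1
      rw [zpow_one, h5] at h6
      rw [h6]
      obtain ⟨h7, h8⟩ := Finset.mem_erase.1 ((h3 i).2 (Finset.mem_erase.2 ⟨him, hi⟩))
      exact zpow_mem (K := D.TS S m) (hE _ h8 h7) _
  induction hh using Subgroup.closure_induction'' with
  | mem x hx =>
    rcases hx with ⟨a, ha, b, hb, hab, rfl⟩ | hx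
    · exact red _ (by simpa only [zpow_one] using elem a ha b hb hab 1)
    · exact red _ (weyl _ hx)
  | inv_mem x hx =>
    rcases hx with ⟨a, ha, b, hb, hab, rfl⟩ | hx
    · exact red _ (by simpa only [zpow_neg_one] using elem a ha b hb hab (-1))
    · exact red _ (weyl _ (D.WS_inv hx))
  | one => simp
  | mul x y _ _ hx hy =>
    intro g hg
    have : x * y * g * (x * y)⁻¹ = x * (y * g * y⁻¹) * x⁻¹ := by group
    rw [this]
    exact hx _ (hy _ hg)

lemma PS_decomp {g : G} (hg : g ∈ D.PS S m) :
    ∃ t ∈ D.TS S m, ∃ h ∈ D.GS (S.erase m), g = t * h := by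
  have htm : ∀ i ∈ S, i ≠ m → D.E i m ∈ D.TS S m := fun i hi him =>
    Subgroup.subset_closure ⟨i, hi, him, rfl⟩
  have base : ∀ x ∈ {g | ∃ a ∈ S, ∃ b ∈ S, a ≠ b ∧ a ≠ m ∧ g = D.E a b} ∪ D.WS (S.erase m),
      x ∈ D.TS S m ∨ x ∈ D.GS (S.erase m) := by
    rintro x (⟨a, ha, b, hb, hab, ham, rfl⟩ | hx)
    · by_cases hbm : b = m
      · subst hbm
        exact Or.inl (htm a ha ham)
      · exact Or.inr (Subgroup.subset_closure (Or.inl ⟨a, Finset.mem_erase.2 ⟨ham, ha⟩, b,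
          Finset.mem_erase.2 ⟨hbm, hb⟩, hab, rfl⟩))
    · exact Or.inr (Subgroup.subset_closure (Or.inr hx))
  have wrap : ∀ x, x ∈ D.TS S m ∨ x ∈ D.GS (S.erase m) →
      ∃ t ∈ D.TS S m, ∃ h ∈ D.GS (S.erase m), x = t * h := by
    rintro x (hx | hx)
    · exact ⟨x, hx, 1, one_mem _, (mul_one x).symm⟩
    · exact ⟨1, one_mem _, x, hx, (one_mul x).symm⟩
  induction hg using Subgroup.closure_induction'' with
  | mem x hx => exact wrap x (base x hx)
  | inv_mem x hx => exact wrap _ ((base x hx).imp inv_mem inv_mem)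
  | one => exact wrap 1 (Or.inl (one_mem _))
  | mul x y _ _ hx hy =>
    obtain ⟨t, ht, h, hh, rfl⟩ := hx
    obtain ⟨t', ht', h', hh', rfl⟩ := hy
    exact ⟨t * (h * t' * h⁻¹), mul_mem ht (TS_conj hh _ ht'), h * h', mul_mem hh hh', by group⟩

/-- The relations of `ElementaryData` present the group of invertible integral matrices. -/
theorem eq_one_of_ρ_eq_one (S : Finset ι) {g : G} (hg : g ∈ D.GS S) (h : D.ρ g = 1) : g = 1 := by
  induction S using Finset.strongInduction generalizing g with
  | H S ih =>
    rcases S.eq_empty_or_nonempty with rfl | ⟨m, hm⟩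
    · refine D.W_faithful g ?_ h
      suffices g ∈ D.WS ∅ from this.1
      clear h
      induction hg using Subgroup.closure_induction with
      | mem x hx =>
        rcases hx with ⟨a, ha, -⟩ | hx
        · simp at ha
        · exact hx
      | one => exact ⟨one_mem _, by simp⟩
      | mul x y _ _ hx hy => exact D.WS_mul hx hy
      | inv x _ hx => exact D.WS_inv hx
    -- An element acting trivially fixes the unit vector at `m`, hence is a translation `t` times an
    -- element `k` of the smaller block. Only the row `m` is changed by `t` and only the other rows
    -- by `k`, so both act trivially: induction disposes of `k`, and the exponents of `t` vanish.
    · obtain ⟨t, ht, k, hk, rfl⟩ := PS_decomp (mem_PS (D := D) hm hg (by rw [h]; rfl))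
      obtain ⟨x, x1, x2, x3⟩ := exists_transl ht
      have h1 : ∀ v, D.ρ t (D.ρ k v) = v := fun v => by
        rw [← ρ_mul_apply, h]
        rfl
      have h2 : D.ρ k = 1 := by
        refine LinearMap.ext fun v => funext fun i => ?_
        by_cases him : i = m
        · subst him
          exact (GS_fix hk (Finset.notMem_erase _ _)).2 v
        · conv_rhs => rw [← h1 v]
          rw [x3, Module.End.one_apply, Function.update_of_ne him]
      have h3 := ih (S.erase m) (Finset.erase_ssubset hm) hk h2
      subst h3
      rw [mul_one]
      have h4 : x = 0 := by
        ext i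
        by_cases him : i = m
        · exact x1 i (Or.inr him)
        · have h5 := congrFun (h1 (Pi.single i 1)) m
          rw [h2, Module.End.one_apply, x3, Function.update_self, Finset.sum_eq_single i] at h5
          · simpa [Ne.symm him] using h5
          · intro j _ hj
            simp [hj]
          · simp
      rw [x2, h4]
      exact map_one (D.transl S m)

lemma exists_of_red {v : ι → ℤ} {c : G ⧸ D.PS S m} (h : D.Red S m v c) :
    ∃ g ∈ D.GS S, v = D.ρ g (Pi.single m 1) := by
  induction h with
  | base w hw => exact ⟨w, Subgroup.subset_closure (Or.inr hw), rfl⟩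
  | step v a b t h c _ ih =>
    obtain ⟨g, hg, hv⟩ := ih
    refine ⟨(D.E a b ^ t)⁻¹ * g, mul_mem (inv_mem (zpow_mem (K := D.GS S) (Subgroup.subset_closure
      (Or.inl ⟨a, h.left_mem, b, h.right_mem, h.ne, rfl⟩)) _)) hg, ?_⟩
    rw [ρ_mul_apply, ← hv, ρ_inv_apply]

lemma GS_mono {S T : Finset ι} (h : S ⊆ T) : D.GS S ≤ D.GS T := by
  refine (Subgroup.closure_le _).2 ?_
  rintro x (⟨a, ha, b, hb, hab, rfl⟩ | hx)
  · exact Subgroup.subset_closure (Or.inl ⟨a, h ha, b, h hb, hab, rfl⟩)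
  · exact Subgroup.subset_closure (Or.inr ⟨hx.1, fun i hi => hx.2 i fun h' => hi (h h')⟩)

lemma TS_le_GS (hm : m ∈ S) : D.TS S m ≤ D.GS S := by
  refine (Subgroup.closure_le _).2 ?_
  rintro x ⟨i, hi, him, rfl⟩
  exact Subgroup.subset_closure (Or.inl ⟨i, hi, m, hm, him, rfl⟩)

/-- Every invertible integral matrix is a product of elementary and signed permutation matrices. -/
theorem exists_toHomUnits_eq (S : Finset ι) (A : (Module.End ℤ (ι → ℤ))ˣ)
    (hA : ∀ i, i ∉ S → (A : Module.End ℤ (ι → ℤ)) (Pi.single i 1) = Pi.single i 1)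
    (hA' : ∀ i, i ∉ S → ∀ v, (A : Module.End ℤ (ι → ℤ)) v i = v i) :
    ∃ g ∈ D.GS S, D.ρ.toHomUnits g = A := by
  induction S using Finset.strongInduction generalizing A with
  | H S ih =>
    rcases S.eq_empty_or_nonempty with rfl | ⟨m, hm⟩
    · refine ⟨1, one_mem _, ?_⟩
      rw [map_one]
      exact Units.ext (LinearMap.ext fun v => funext fun i => (hA' i (by simp) v).symm)
    -- The column `m` of an invertible matrix is primitive, so the Euclidean algorithm brings it to
    -- the unit vector.
    · obtain ⟨c, hc, -⟩ := good (D := D) hm ((A : Module.End ℤ (ι → ℤ)) (Pi.single m 1))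
        (fun i hi => by rw [hA' i hi, supp_single hm i hi])
        (fun d hd => by
          choose u hu using hd
          have h1 : (A : Module.End ℤ (ι → ℤ)) (Pi.single m 1) = d • u :=
            funext fun i => by simpa using hu i
          refine prim_single m d fun i => ?_
          have h2 : ((A⁻¹ : (Module.End ℤ (ι → ℤ))ˣ) : Module.End ℤ (ι → ℤ))
              ((A : Module.End ℤ (ι → ℤ)) (Pi.single m 1)) = Pi.single m 1 := by
            rw [← Module.End.mul_apply, Units.inv_mul, Module.End.one_apply]
          rw [← h2, h1, map_smul]
          exact ⟨_, rfl⟩)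
      obtain ⟨g, hg, hv⟩ := exists_of_red hc
      set B : (Module.End ℤ (ι → ℤ))ˣ := D.ρ.toHomUnits g⁻¹ * A with hB
      have hBv : ∀ v, (B : Module.End ℤ (ι → ℤ)) v = D.ρ g⁻¹ ((A : Module.End ℤ (ι → ℤ)) v) :=
        fun v => rfl
      have hBm : (B : Module.End ℤ (ι → ℤ)) (Pi.single m 1) = Pi.single m 1 := by
        rw [hBv, hv, ρ_inv_apply]
      have hB1 : ∀ i, i ∉ S → (B : Module.End ℤ (ι → ℤ)) (Pi.single i 1) = Pi.single i 1 :=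
        fun i hi => by rw [hBv, hA i hi, (GS_fix (inv_mem hg) hi).1]
      have hB2 : ∀ i, i ∉ S → ∀ v, (B : Module.End ℤ (ι → ℤ)) v i = v i := fun i hi v => by
        rw [hBv, (GS_fix (inv_mem hg) hi).2, hA' i hi]
      -- The off-diagonal entries of `B` in the row `m`. Dividing by the corresponding translation
      -- on the right leaves a matrix supported on `S.erase m`.
      let x : ι → ℤ := fun i =>
        if i = m then 0 else (B : Module.End ℤ (ι → ℤ)) (Pi.single i 1) m
      have hx : ∀ i, i ∉ S ∨ i = m → x i = 0 := fun i hi => by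
        by_cases him : i = m
        · simp [x, him]
        · simp only [x, him, if_false]
          rw [hB1 i (by tauto), Pi.single_eq_of_ne (Ne.symm him)]
      obtain ⟨t, ht, ht'⟩ := exists_mem_TS (D := D) x hx
      have hBx : ∀ v, (B : Module.End ℤ (ι → ℤ)) v m = D.ρ t v m := fun v => by
        rw [ht', Function.update_self]
        conv_lhs => rw [pi_eq_sum_univ' v]
        rw [map_sum, Finset.sum_apply, ← Finset.add_sum_erase _ _ (Finset.mem_univ m),
          ← Finset.add_sum_erase _ (fun i => x i * v i) (Finset.mem_univ m)]
        have e1 : x m * v m = 0 := by simp [x]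
        rw [e1, zero_add, map_smul]
        rw [hBm]
        congr 1
        · simp
        · refine Finset.sum_congr rfl fun i hi => ?_
          rw [map_smul]
          simp [x, Finset.ne_of_mem_erase hi, mul_comm]
      have htS : t ∈ D.GS S := TS_le_GS hm ht
      set C : (Module.End ℤ (ι → ℤ))ˣ := B * D.ρ.toHomUnits t⁻¹ with hC
      have hCv : ∀ v, (C : Module.End ℤ (ι → ℤ)) v = (B : Module.End ℤ (ι → ℤ)) (D.ρ t⁻¹ v) :=
        fun v => rfl
      have htfix : ∀ i, i ∉ S ∨ i = m → D.ρ t⁻¹ (Pi.single i 1) = Pi.single i 1 := fun i hi => by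
        have : D.ρ t (Pi.single i 1) = Pi.single i 1 := by
          rw [ht', Finset.sum_eq_single i, hx i hi]
          · simp
          · intro j _ hj
            simp [hj]
          · simp
        conv_lhs => rw [← this]
        rw [ρ_inv_apply]
      obtain ⟨k, hk, hk'⟩ := ih (S.erase m) (Finset.erase_ssubset hm) C
        (fun i hi => by
          by_cases him : i = m
          · subst him
            rw [hCv, htfix i (Or.inr rfl), hBm]
          · have hiS : i ∉ S := fun h => hi (Finset.mem_erase.2 ⟨him, h⟩)
            rw [hCv, htfix i (Or.inl hiS), hB1 i hiS])
        (fun i hi v => by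
          by_cases him : i = m
          · subst him
            rw [hCv, hBx, ρ_apply_inv]
          · have hiS : i ∉ S := fun h => hi (Finset.mem_erase.2 ⟨him, h⟩)
            rw [hCv, hB2 i hiS, (GS_fix (inv_mem htS) hiS).2])
      refine ⟨g * k * t, mul_mem (mul_mem hg (GS_mono (Finset.erase_subset _ _) hk)) htS, ?_⟩
      rw [map_mul, map_mul, hk', hC, hB, map_inv, map_inv]
      group

end ElementaryData

/-! ## Generators of `IA_n` -/

namespace AutFree

variable {n : ℕ}

open FreeGroup (of)
open scoped commutatorElement

lemma mulAut_ext {φ ψ : MulAut (F n)} (h : ∀ i, φ (of i) = ψ (of i)) : φ = ψ := by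
  have : φ.toMonoidHom = ψ.toMonoidHom := FreeGroup.ext_hom _ _ h
  exact MulEquiv.ext fun x => DFunLike.congr_fun this x

lemma cls_one : cls (1 : F n) = 0 := rfl

lemma cls_inv (γ : F n) : cls γ⁻¹ = -cls γ := by simp [cls]

lemma cls_map (φ : MulAut (F n)) (γ : F n) : cls (φ γ) = absEnd n φ (cls γ) := rfl

lemma cls_eq_zero_iff {γ : F n} : cls γ = 0 ↔ γ ∈ commutator (F n) := by
  rw [← Abelianization.ker_of, MonoidHom.mem_ker]
  rfl

/-- The endomorphism of `F_n` that kills `x_i` and fixes the other generators. -/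
def kill (i : Fin n) : F n →* F n := FreeGroup.lift fun j => if j = i then 1 else of j

@[simp] lemma kill_self (i : Fin n) : kill i (of i) = 1 := by simp [kill]

lemma kill_of_ne {i j : Fin n} (h : j ≠ i) : kill i (of j) = of j := by simp [kill, h]

@[simp] lemma kill_kill (i : Fin n) (g : F n) : kill i (kill i g) = kill i g := by
  have : (kill i).comp (kill i) = kill i := FreeGroup.ext_hom _ _ fun j => by
    by_cases h : j = i
    · simp [h]
    · simp [kill_of_ne h]
  exact DFunLike.congr_fun this g

/-- The endomorphism `x_i ↦ a x_i b` of `F_n`, where `x_i` is first removed from `a` and `b`. -/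
def transvHom (i : Fin n) (a b : F n) : F n →* F n :=
  FreeGroup.lift fun j => if j = i then kill i a * of i * kill i b else of j

lemma transvHom_self (i : Fin n) (a b : F n) :
    transvHom i a b (of i) = kill i a * of i * kill i b := by simp [transvHom]

lemma transvHom_of_ne {i j : Fin n} (h : j ≠ i) (a b : F n) :
    transvHom i a b (of j) = of j := by simp [transvHom, h]

lemma transvHom_kill (i : Fin n) (a b g : F n) : transvHom i a b (kill i g) = kill i g := by
  have : (transvHom i a b).comp (kill i) = kill i := FreeGroup.ext_hom _ _ fun j => by
    by_cases h : j = i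
    · simp [h]
    · simp [kill_of_ne h, transvHom_of_ne h]
  exact DFunLike.congr_fun this g

lemma transvHom_transvHom (i : Fin n) (a b a' b' g : F n) :
    transvHom i a b (transvHom i a' b' g) = transvHom i (a' * a) (b * b') g := by
  have : (transvHom i a b).comp (transvHom i a' b') = transvHom i (a' * a) (b * b') :=
    FreeGroup.ext_hom _ _ fun j => by
      by_cases h : j = i
      · subst h
        simp [transvHom_self, transvHom_kill, mul_assoc]
      · simp [transvHom_of_ne h]
  exact DFunLike.congr_fun this g

lemma transvHom_one (i : Fin n) (g : F n) : transvHom i 1 1 g = g := by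
  have : transvHom i 1 1 = MonoidHom.id (F n) := FreeGroup.ext_hom _ _ fun j => by
    by_cases h : j = i
    · subst h
      simp [transvHom_self]
    · simp [transvHom_of_ne h]
  exact DFunLike.congr_fun this g

/-- The automorphism `x_i ↦ a x_i b` of `F_n`, where `x_i` is first removed from `a` and `b`. -/
def transv (i : Fin n) (a b : F n) : MulAut (F n) :=
  { transvHom i a b with
    invFun := transvHom i a⁻¹ b⁻¹
    left_inv := fun g => by
      change transvHom i _ _ (transvHom i _ _ g) = g
      rw [transvHom_transvHom, mul_inv_cancel, inv_mul_cancel, transvHom_one]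
    right_inv := fun g => by
      change transvHom i _ _ (transvHom i _ _ g) = g
      rw [transvHom_transvHom, mul_inv_cancel, inv_mul_cancel, transvHom_one] }

lemma transv_self (i : Fin n) (a b : F n) :
    transv i a b (of i) = kill i a * of i * kill i b := transvHom_self i a b

lemma transv_of_ne {i j : Fin n} (h : j ≠ i) (a b : F n) : transv i a b (of j) = of j :=
  transvHom_of_ne h a b

lemma transv_kill (i : Fin n) (a b g : F n) : transv i a b (kill i g) = kill i g :=
  transvHom_kill i a b g

lemma transv_mul (i : Fin n) (a b a' b' : F n) :
    transv i a b * transv i a' b' = transv i (a' * a) (b * b') :=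
  MulEquiv.ext fun g => transvHom_transvHom i a b a' b' g

lemma transv_one (i : Fin n) : transv i (1 : F n) 1 = 1 :=
  MulEquiv.ext fun g => transvHom_one i g

lemma transv_inv (i : Fin n) (a b : F n) : (transv i a b)⁻¹ = transv i a⁻¹ b⁻¹ := by
  rw [inv_eq_iff_mul_eq_one, transv_mul, inv_mul_cancel, mul_inv_cancel, transv_one]

lemma transv_congr (i : Fin n) {a b a' b' : F n} (ha : kill i a = kill i a')
    (hb : kill i b = kill i b') : transv i a b = transv i a' b' := by
  refine mulAut_ext fun j => ?_
  by_cases h : j = i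
  · subst h
    rw [transv_self, transv_self, ha, hb]
  · rw [transv_of_ne h, transv_of_ne h]

/-- The subgroup generated by Magnus' automorphisms `x_i ↦ x_j x_i x_j⁻¹` and
`x_i ↦ x_i [x_j, x_k]`. -/
def magnusSubgroup (n : ℕ) : Subgroup (MulAut (F n)) :=
  Subgroup.closure ({φ | ∃ i j, φ = transv i (of j) (of j)⁻¹} ∪
    {φ | ∃ i j k, φ = transv i 1 ⁅(of j : F n), of k⁆})

lemma transv_conj_mem (i : Fin n) (g : F n) : transv i g g⁻¹ ∈ magnusSubgroup n := by
  induction g using FreeGroup.induction_on with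
  | C1 => rw [inv_one, transv_one]; exact one_mem _
  | of j => exact Subgroup.subset_closure (Or.inl ⟨i, j, rfl⟩)
  | inv_of j h => rw [← transv_inv]; exact inv_mem h
  | mul a b ha hb =>
    rw [mul_inv_rev, ← transv_mul]
    exact mul_mem hb ha

/-- The `c` for which the claim holds form a subgroup. It is normal because conjugating `c` amounts
to conjugating `transv i 1 c` by the automorphisms of `transv_conj_mem`. Modulo this subgroup the
generators of `F n` commute, so it contains all commutators. -/
lemma transv_mem_of_mem_commutator (i : Fin n) {c : F n} (hc : c ∈ commutator (F n)) :
    transv i 1 c ∈ magnusSubgroup n := by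
  let R : Subgroup (F n) :=
    { carrier := {c | transv i 1 c ∈ magnusSubgroup n}
      one_mem' := by
        change transv i 1 1 ∈ magnusSubgroup n
        rw [transv_one]
        exact one_mem _
      mul_mem' := fun {a b} ha hb => by
        change transv i 1 (a * b) ∈ magnusSubgroup n
        have := transv_mul i 1 a 1 b
        rw [mul_one] at this
        rw [← this]
        exact mul_mem ha hb
      inv_mem' := fun {a} ha => by
        change transv i 1 a⁻¹ ∈ magnusSubgroup n
        have := transv_inv i 1 a
        rw [inv_one] at this
        rw [← this]
        exact inv_mem ha }
  have hR : R.Normal := ⟨fun c hc g => by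
    change transv i 1 (g * c * g⁻¹) ∈ magnusSubgroup n
    have : transv i 1 (g * c * g⁻¹) = transv i g⁻¹ g⁻¹⁻¹ * transv i 1 c * transv i g g⁻¹ := by
      rw [transv_mul, transv_mul]
      congr 1 <;> group
    rw [this]
    exact mul_mem (mul_mem (transv_conj_mem i _) hc) (transv_conj_mem i _)⟩
  have key : ∀ a b : F n, Commute (QuotientGroup.mk' R a) (QuotientGroup.mk' R b) := by
    intro a b
    induction a using FreeGroup.induction_on with
    | C1 => rw [map_one]; exact Commute.one_left _
    | inv_of j h => rw [map_inv]; exact h.inv_left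
    | mul x y hx hy => rw [map_mul]; exact hx.mul_left hy
    | of j =>
      induction b using FreeGroup.induction_on with
      | C1 => rw [map_one]; exact Commute.one_right _
      | inv_of k h => rw [map_inv]; exact h.inv_right
      | mul x y hx hy => rw [map_mul]; exact hx.mul_right hy
      | of k =>
        rw [← commutatorElement_eq_one_iff_commute, ← map_commutatorElement, ← MonoidHom.mem_ker,
          QuotientGroup.ker_mk']
        exact Subgroup.subset_closure (Or.inr ⟨i, j, k, rfl⟩)
  have hle : commutator (F n) ≤ R := by
    rw [commutator_eq_closure, Subgroup.closure_le]
    rintro _ ⟨a, b, rfl⟩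
    have := commutatorElement_eq_one_iff_commute.2 (key a b)
    rwa [← map_commutatorElement, ← MonoidHom.mem_ker, QuotientGroup.ker_mk'] at this
  exact hle hc

/-- Up to the automorphism `transv i a a⁻¹`, what remains is right multiplication of `x_i` by `kill
i (b * a)`, which lies in the commutator subgroup by hypothesis. -/
lemma transv_mem (i : Fin n) {a b : F n} (h : cls (kill i (a * b)) = 0) :
    transv i a b ∈ magnusSubgroup n := by
  have h1 : transv i a b = transv i 1 (kill i (b * a)) * transv i a a⁻¹ := by
    rw [transv_mul]
    refine transv_congr i (by simp) (by simp)
  rw [h1]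
  refine mul_mem (transv_mem_of_mem_commutator i (cls_eq_zero_iff.1 ?_)) (transv_conj_mem i a)
  rw [map_mul, cls_mul] at h ⊢
  rw [add_comm, h]

/-! ### Signed permutations -/

/-- The signed permutations of the generators. -/
def IsLetter (φ : MulAut (F n)) : Prop := ∀ i, ∃ x, φ (of i) = FreeGroup.mk [x]

/-- Two generators sent to letters with the same index would be equal or inverse to each other, by
injectivity of `φ`. -/
lemma IsLetter.exists_perm {φ : MulAut (F n)} (h : IsLetter φ) :
    ∃ (σ : Equiv.Perm (Fin n)) (b : Fin n → Bool), ∀ i, φ (of i) = FreeGroup.mk [(σ i, b i)] := by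
  choose x hx using h
  have hinj : Function.Injective fun i => (x i).1 := fun i j hij => by
    have key : ∀ {i j : Fin n}, (x i).1 = (x j).1 → x i = x j ∨ x i = FreeGroup.bar (x j) := by
      intro i j hij
      simp only [FreeGroup.bar]
      generalize x i = y at hij ⊢
      generalize x j = z at hij ⊢
      obtain ⟨a, b⟩ := y
      obtain ⟨c, d⟩ := z
      obtain rfl : a = c := hij
      cases b <;> cases d <;> simp
    rcases key hij with h1 | h1
    · have h2 : φ (of i) = φ (of j) := by rw [hx, hx, h1]
      exact FreeGroup.of_injective (φ.injective h2)
    · have h2 : φ (of i) = φ (of j)⁻¹ := by rw [map_inv, hx, hx, h1, FreeGroup.mk_bar]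
      have h3 := congrArg FreeGroup.toWord (φ.injective h2)
      simp [FreeGroup.toWord_inv, FreeGroup.invRev] at h3
  exact ⟨Equiv.ofBijective _ (Finite.injective_iff_bijective.1 hinj), fun i => (x i).2, hx⟩

lemma mk_letter (i : Fin n) (b : Bool) :
    FreeGroup.mk [(i, b)] = if b then of i else (of i)⁻¹ := by
  cases b <;> rfl

lemma IsLetter.inv {φ : MulAut (F n)} (h : IsLetter φ) : IsLetter φ⁻¹ := fun i => by
  obtain ⟨σ, b, hσ⟩ := h.exists_perm
  obtain ⟨j, rfl⟩ := σ.surjective i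
  refine ⟨(j, b j), ?_⟩
  have h1 := hσ j
  apply φ.injective
  change φ (φ.symm _) = _
  rw [φ.apply_symm_apply]
  rw [mk_letter] at h1 ⊢
  split_ifs at h1 ⊢
  · exact h1.symm
  · rw [map_inv, h1, inv_inv]

lemma IsLetter.mul {φ ψ : MulAut (F n)} (hφ : IsLetter φ) (hψ : IsLetter ψ) :
    IsLetter (φ * ψ) := fun i => by
  obtain ⟨⟨j, b⟩, hj⟩ := hψ i
  obtain ⟨y, hy⟩ := hφ j
  change ∃ x, φ (ψ (of i)) = _
  rw [hj, mk_letter]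
  split_ifs
  · exact ⟨y, hy⟩
  · exact ⟨FreeGroup.bar y, by rw [map_inv, hy, FreeGroup.mk_bar]⟩

lemma kill_letter {φ : MulAut (F n)} {σ : Equiv.Perm (Fin n)} {b : Fin n → Bool}
    (h : ∀ i, φ (of i) = FreeGroup.mk [(σ i, b i)]) (i : Fin n) (g : F n) :
    kill (σ i) (φ g) = φ (kill i g) := by
  have : (kill (σ i)).comp φ.toMonoidHom = φ.toMonoidHom.comp (kill i) :=
    FreeGroup.ext_hom _ _ fun j => by
      change kill (σ i) (φ (of j)) = φ (kill i (of j))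
      by_cases hij : j = i
      · subst hij
        rw [kill_self, map_one, h, mk_letter]
        split_ifs <;> simp
      · have h1 : σ j ≠ σ i := fun h => hij (σ.injective h)
        rw [kill_of_ne hij, h, mk_letter]
        split_ifs <;> simp [kill_of_ne h1]
  exact DFunLike.congr_fun this g

/-- If `φ` sends `x_i` to an inverse letter, the left and the right factor trade places and are
inverted. -/
lemma letter_mul_transv {φ : MulAut (F n)} {σ : Equiv.Perm (Fin n)} {b : Fin n → Bool}
    (h : ∀ i, φ (of i) = FreeGroup.mk [(σ i, b i)]) (i : Fin n) (x y : F n) :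
    φ * transv i x y * φ⁻¹ =
      if b i then transv (σ i) (φ x) (φ y) else transv (σ i) (φ y)⁻¹ (φ x)⁻¹ := by
  rw [mul_inv_eq_iff_eq_mul]
  refine mulAut_ext fun j => ?_
  by_cases hij : j = i
  · subst hij
    have h1 := h j
    rw [mk_letter] at h1
    split_ifs at h1 ⊢
    · rw [MulAut.mul_apply, MulAut.mul_apply, transv_self, map_mul, map_mul, h1, transv_self,
        kill_letter h, kill_letter h]
    · rw [MulAut.mul_apply, MulAut.mul_apply, transv_self, map_mul, map_mul, h1, map_inv,
        transv_self, map_inv, map_inv, kill_letter h, kill_letter h]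
      group
  · have h1 : σ j ≠ σ i := fun h => hij (σ.injective h)
    have h2 : ∀ a c, transv (σ i) a c (φ (of j)) = φ (of j) := fun a c => by
      rw [h, mk_letter]
      split_ifs <;> simp [transv_of_ne h1]
    rw [MulAut.mul_apply, MulAut.mul_apply, transv_of_ne hij]
    split_ifs <;> rw [h2]

/-! ### Normality -/

lemma conj_mem_magnus {φ : MulAut (F n)}
    (h1 : ∀ i j, φ * transv i (of j) (of j)⁻¹ * φ⁻¹ ∈ magnusSubgroup n)
    (h2 : ∀ i j k, φ * transv i 1 ⁅(of j : F n), of k⁆ * φ⁻¹ ∈ magnusSubgroup n)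
    {ψ : MulAut (F n)} (hψ : ψ ∈ magnusSubgroup n) : φ * ψ * φ⁻¹ ∈ magnusSubgroup n := by
  induction hψ using Subgroup.closure_induction with
  | mem x hx =>
    rcases hx with ⟨i, j, rfl⟩ | ⟨i, j, k, rfl⟩
    · exact h1 i j
    · exact h2 i j k
  | one => simp
  | mul x y _ _ hx hy =>
    have : φ * (x * y) * φ⁻¹ = φ * x * φ⁻¹ * (φ * y * φ⁻¹) := by group
    rw [this]
    exact mul_mem hx hy
  | inv x _ hx =>
    have : φ * x⁻¹ * φ⁻¹ = (φ * x * φ⁻¹)⁻¹ := by group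
    rw [this]
    exact inv_mem hx

lemma cls_kill_commutator (i : Fin n) (a b : F n) : cls (kill i ⁅a, b⁆) = 0 := by
  rw [map_commutatorElement, cls_eq_zero_iff]
  exact Subgroup.commutator_mem_commutator (Subgroup.mem_top _) (Subgroup.mem_top _)

lemma letter_conj_transv_mem {φ : MulAut (F n)} (h : IsLetter φ) (i : Fin n) {a b : F n}
    (hab : cls (kill i (a * b)) = 0) : φ * transv i a b * φ⁻¹ ∈ magnusSubgroup n := by
  obtain ⟨σ, c, hσ⟩ := h.exists_perm
  rw [letter_mul_transv hσ]
  split_ifs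
  · refine transv_mem _ ?_
    rw [← map_mul, kill_letter hσ, cls_map, hab, map_zero]
  · refine transv_mem _ ?_
    rw [← mul_inv_rev, ← map_mul, map_inv, cls_inv, kill_letter hσ, cls_map, hab, map_zero,
      neg_zero]

lemma letter_conj_mem {φ : MulAut (F n)} (h : IsLetter φ) {ψ : MulAut (F n)}
    (hψ : ψ ∈ magnusSubgroup n) : φ * ψ * φ⁻¹ ∈ magnusSubgroup n :=
  conj_mem_magnus (fun i j => letter_conj_transv_mem h i (by simp [cls_one]))
    (fun i j k => letter_conj_transv_mem h i (by rw [one_mul, cls_kill_commutator])) hψ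

section Elementary

variable {i j : Fin n} (hij : i ≠ j)

include hij

/-- The transvection `x_i ↦ x_i x_j` does not involve `x_k` and commutes with `kill k`, so
conjugation by it just applies it to `a` and `b`. -/
lemma elem_conj_transv_of_ne {k : Fin n} (hki : k ≠ i) (hkj : k ≠ j) {a b : F n}
    (hab : cls (kill k (a * b)) = 0) :
    transv i 1 (of j) * transv k a b * (transv i 1 (of j))⁻¹ ∈ magnusSubgroup n := by
  set E := transv i 1 (of j) with hE
  have hk : ∀ g, kill k (E g) = E (kill k g) := fun g => by
    have : (kill k).comp E.toMonoidHom = E.toMonoidHom.comp (kill k) :=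
      FreeGroup.ext_hom _ _ fun l => by
        change kill k (E (of l)) = E (kill k (of l))
        by_cases hl : l = i
        · subst hl
          rw [kill_of_ne hki.symm, hE, transv_self]
          simp [kill_of_ne hki.symm, kill_of_ne hkj.symm, kill_of_ne hij.symm]
        · rw [hE, transv_of_ne hl]
          by_cases hlk : l = k
          · subst hlk
            simp
          · rw [kill_of_ne hlk, transv_of_ne hl]
    exact DFunLike.congr_fun this g
  have h1 : E * transv k a b * E⁻¹ = transv k (E a) (E b) := by
    rw [mul_inv_eq_iff_eq_mul]
    refine mulAut_ext fun l => ?_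
    rw [MulAut.mul_apply, MulAut.mul_apply]
    by_cases hl : l = k
    · subst hl
      rw [transv_self, map_mul, map_mul, hE, transv_of_ne hki, ← hE, transv_self, hk, hk]
    · rw [transv_of_ne hl]
      have h2 : kill k (E (of l)) = E (of l) := by rw [hk, kill_of_ne hl]
      rw [← h2, transv_kill]
  rw [h1]
  refine transv_mem _ ?_
  rw [← map_mul, hk, cls_map, hab, map_zero]

/-- Conjugation only adds a factor that multiplies `x_i` by `x_j b⁻¹ x_j⁻¹ a⁻¹`, whose class
vanishes together with that of `a * b`. -/
lemma elem_conj_transv_target {a b : F n} (hai : kill i a = a) (hbi : kill i b = b)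
    (haj : kill j a = a) (hbj : kill j b = b) (hab : cls (a * b) = 0) :
    transv i 1 (of j) * transv j a b * (transv i 1 (of j))⁻¹ ∈ magnusSubgroup n := by
  have hE : ∀ x y g, kill i g = g → transv i x y g = g := fun x y g hg => by
    rw [← hg, transv_kill]
  have hE' : ∀ x y g, kill j g = g → transv j x y g = g := fun x y g hg => by
    rw [← hg, transv_kill]
  have h1 : transv i 1 (of j) * transv j a b * (transv i 1 (of j))⁻¹ =
      transv i 1 (of j * b⁻¹ * (of j)⁻¹ * a⁻¹) * transv j a b := by
    rw [mul_inv_eq_iff_eq_mul]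
    refine mulAut_ext fun l => ?_
    simp only [MulAut.mul_apply]
    by_cases hli : l = i
    · subst hli
      simp only [transv_of_ne hij, transv_self, map_mul, map_inv, map_one, kill_of_ne hij.symm,
        hai, hbi, haj, hbj, hE _ _ _ hai, hE _ _ _ hbi, transv_of_ne hij.symm]
      group
    · rw [transv_of_ne hli]
      by_cases hlj : l = j
      · subst hlj
        simp only [transv_of_ne hij.symm, transv_self, map_mul, haj, hbj, hE _ _ _ hai,
          hE _ _ _ hbi]
      · simp only [transv_of_ne hlj, transv_of_ne hli]
  rw [h1]
  refine mul_mem (transv_mem _ ?_) (transv_mem _ ?_)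
  · simp only [one_mul, map_mul, map_inv, hai, hbi, cls_mul, cls_inv] at hab ⊢
    have : cls b = -cls a := by rw [eq_neg_iff_add_eq_zero, add_comm, hab]
    rw [this]
    abel
  · rw [map_mul, haj, hbj, hab]

set_option linter.unusedSimpArgs false in
lemma elem_conj_transv_swap :
    transv i 1 (of j) * transv j (of i) (of i)⁻¹ * (transv i 1 (of j))⁻¹ ∈ magnusSubgroup n := by
  have h1 : transv i 1 (of j) * transv j (of i) (of i)⁻¹ * (transv i 1 (of j))⁻¹ =
      transv j (of i) (of i)⁻¹ * transv i (of j) (of j)⁻¹ := by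
    rw [mul_inv_eq_iff_eq_mul]
    refine mulAut_ext fun l => ?_
    simp only [MulAut.mul_apply]
    by_cases hli : l = i
    · subst hli
      simp only [transv_of_ne hij, transv_self, map_mul, map_inv, map_one, kill_of_ne hij.symm,
        kill_of_ne hij, transv_of_ne hij.symm]
      group
    · by_cases hlj : l = j
      · subst hlj
        simp only [transv_of_ne hij.symm, transv_of_ne hij, transv_self, map_mul, map_inv, map_one,
          kill_of_ne hij.symm, kill_of_ne hij]
        group
      · simp only [transv_of_ne hlj, transv_of_ne hli]
  rw [h1]
  exact mul_mem (transv_conj_mem _ _) (transv_conj_mem _ _)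

-- The delicate case: the commutator inserted at `x_j` involves `x_i` itself. Multiplied on the left
-- by three elements of Magnus' subgroup, the conjugate becomes an element of that subgroup; the
-- identity is verified on generators.
set_option linter.unusedSimpArgs false in
lemma elem_conj_transv_commutator {m : Fin n} (hmi : m ≠ i) (hmj : m ≠ j) :
    transv i 1 (of j) * transv j 1 ⁅of i, of m⁆ * (transv i 1 (of j))⁻¹ ∈ magnusSubgroup n := by
  have h1 : transv j ((of i)⁻¹ * of m * of i) (of m)⁻¹ *
      (transv i (of m)⁻¹ (of j * of m * (of j)⁻¹) *
      (transv m (of i * of j)⁻¹ (of i * of j)⁻¹⁻¹ *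
      (transv i 1 (of j) * transv j 1 ⁅of i, of m⁆ * (transv i 1 (of j))⁻¹))) =
      transv m (of i * of j)⁻¹ (of i * of j)⁻¹⁻¹ := by
    rw [← mul_assoc, ← mul_assoc, ← mul_assoc, mul_inv_eq_iff_eq_mul]
    refine mulAut_ext fun l => ?_
    simp only [MulAut.mul_apply]
    by_cases hli : l = i
    · subst hli
      simp only [transv_of_ne hij, transv_of_ne hij.symm, transv_of_ne hmi, transv_of_ne hmj,
        transv_of_ne hmi.symm, transv_of_ne hmj.symm, transv_self, map_mul, map_inv, map_one,
        kill_of_ne hij, kill_of_ne hij.symm, kill_of_ne hmi, kill_of_ne hmi.symm, kill_of_ne hmj,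
        kill_of_ne hmj.symm, commutatorElement_def]
      group
    · by_cases hlj : l = j
      · subst hlj
        simp only [transv_of_ne hij, transv_of_ne hij.symm, transv_of_ne hmi, transv_of_ne hmj,
          transv_of_ne hmi.symm, transv_of_ne hmj.symm, transv_self, map_mul, map_inv, map_one,
          kill_of_ne hij, kill_of_ne hij.symm, kill_of_ne hmi, kill_of_ne hmi.symm, kill_of_ne hmj,
          kill_of_ne hmj.symm, commutatorElement_def]
        group
      · by_cases hlm : l = m
        · subst hlm
          simp only [transv_of_ne hij, transv_of_ne hij.symm, transv_of_ne hmi, transv_of_ne hmj,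
            transv_of_ne hmi.symm, transv_of_ne hmj.symm, transv_self, map_mul, map_inv, map_one,
            kill_of_ne hij, kill_of_ne hij.symm, kill_of_ne hmi, kill_of_ne hmi.symm,
            kill_of_ne hmj, kill_of_ne hmj.symm, commutatorElement_def]
          group
        · simp only [transv_of_ne hlj, transv_of_ne hli, transv_of_ne hlm]
  have h2 : transv m (of i * of j)⁻¹ (of i * of j)⁻¹⁻¹ ∈ magnusSubgroup n := transv_conj_mem _ _
  have h3 := mul_mem_cancel_left (transv_mem (n := n) j (a := (of i)⁻¹ * of m * of i)
    (b := (of m)⁻¹) (by simp [kill_of_ne hij, kill_of_ne hmj, cls_mul, cls_inv])) |>.1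
    (h1.symm ▸ h2)
  have h4 := mul_mem_cancel_left (transv_mem (n := n) i (a := (of m)⁻¹)
    (b := of j * of m * (of j)⁻¹)
    (by simp [kill_of_ne hij.symm, kill_of_ne hmi, cls_mul, cls_inv])) |>.1 h3
  exact (mul_mem_cancel_left h2).1 h4

lemma elem_conj_mem {ψ : MulAut (F n)} (hψ : ψ ∈ magnusSubgroup n) :
    transv i 1 (of j) * ψ * (transv i 1 (of j))⁻¹ ∈ magnusSubgroup n := by
  have hsame : ∀ a b : F n, cls (kill i (a * b)) = 0 →
      transv i 1 (of j) * transv i a b * (transv i 1 (of j))⁻¹ ∈ magnusSubgroup n := by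
    intro a b hab
    rw [transv_inv, transv_mul, transv_mul]
    refine transv_mem _ ?_
    simp only [map_mul, map_inv, cls_mul, cls_inv, inv_one, one_mul, mul_one] at hab ⊢
    rw [← hab]
    abel
  have htriv : ∀ a b : F n, kill j a = 1 → kill j b = 1 →
      transv i 1 (of j) * transv j a b * (transv i 1 (of j))⁻¹ ∈ magnusSubgroup n := by
    intro a b ha hb
    rw [transv_congr j (a' := 1) (b' := 1) (by simpa) (by simpa), transv_one]
    simp
  refine conj_mem_magnus (fun k l => ?_) (fun k l m => ?_) hψ
  · by_cases hki : k = i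
    · subst hki
      exact hsame _ _ (by simp [cls_one])
    · by_cases hkj : k = j
      · subst hkj
        by_cases hlj : l = k
        · subst hlj
          exact htriv _ _ (by simp) (by simp)
        · by_cases hli : l = i
          · subst hli
            exact elem_conj_transv_swap hij
          · exact elem_conj_transv_target hij (kill_of_ne hli) (by rw [map_inv, kill_of_ne hli])
              (kill_of_ne hlj) (by rw [map_inv, kill_of_ne hlj]) (by simp [cls_one])
      · exact elem_conj_transv_of_ne hij hki hkj (by simp [cls_one])
  · by_cases hki : k = i
    · subst hki
      exact hsame _ _ (by rw [one_mul, cls_kill_commutator])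
    · by_cases hkj : k = j
      · subst hkj
        by_cases hlj : l = k
        · subst hlj
          exact htriv _ _ (by simp) (by simp [map_commutatorElement])
        · by_cases hmj : m = k
          · subst hmj
            exact htriv _ _ (by simp) (by simp [map_commutatorElement])
          · by_cases hlm : l = m
            · subst hlm
              exact htriv _ _ (by simp) (by simp)
            · by_cases hli : l = i
              · subst hli
                exact elem_conj_transv_commutator hij (Ne.symm hlm) hmj
              · by_cases hmi : m = i
                · subst hmi
                  have h1 := inv_mem (elem_conj_transv_commutator hij hli hlj)
                  have h2 : transv k 1 ⁅of l, of m⁆ = (transv k 1 ⁅of m, of l⁆)⁻¹ := by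
                    rw [transv_inv, inv_one, commutatorElement_inv]
                  rw [h2]
                  convert h1 using 1
                  group
                · refine elem_conj_transv_target hij (map_one _) ?_ (map_one _) ?_ ?_
                  · rw [map_commutatorElement, kill_of_ne hli, kill_of_ne hmi]
                  · rw [map_commutatorElement, kill_of_ne hlj, kill_of_ne hmj]
                  · rw [one_mul, cls_eq_zero_iff]
                    exact Subgroup.commutator_mem_commutator (Subgroup.mem_top _)
                      (Subgroup.mem_top _)
      · exact elem_conj_transv_of_ne hij hki hkj (by rw [one_mul, cls_kill_commutator])

end Elementary

end AutFree

/-! ## The kernel and the image of `Aut(F_n) → GL(H_ℤ)` -/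

namespace AutFree

variable {n : ℕ}

open FreeGroup (of)

/-- The automorphism inverting one generator. -/
def flip (i : Fin n) : MulAut (F n) :=
  let f : F n →* F n := FreeGroup.lift fun j => if j = i then (of j)⁻¹ else of j
  have hf : ∀ g, f (f g) = g := fun g => by
    have : f.comp f = MonoidHom.id _ := FreeGroup.ext_hom _ _ fun j => by
      by_cases h : j = i
      · simp [f, h]
      · simp [f, h]
    exact DFunLike.congr_fun this g
  { f with invFun := f, left_inv := hf, right_inv := hf }

lemma flip_of (i j : Fin n) : flip i (of j) = if j = i then (of j)⁻¹ else of j :=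
  FreeGroup.lift_apply_of ..

lemma flip_of_eq_mk (i j : Fin n) : flip i (of j) = FreeGroup.mk [(j, decide (j ≠ i))] := by
  rw [flip_of, mk_letter]
  by_cases h : j = i <;> simp [h]

lemma isLetter_flip (i : Fin n) : IsLetter (flip i) := fun j => ⟨_, flip_of_eq_mk i j⟩

lemma flip_conj_transv {i j : Fin n} (hij : i ≠ j) :
    flip j * transv i 1 (of j) * (flip j)⁻¹ = (transv i 1 (of j))⁻¹ := by
  have h := letter_mul_transv (φ := flip j) (σ := Equiv.refl _) (b := fun k => decide (k ≠ j))
    (fun k => flip_of_eq_mk j k) i 1 (of j)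
  simp only [hij, ne_eq, not_false_eq_true, decide_true, if_true, map_one, flip_of,
    Equiv.refl_apply] at h
  rw [h, transv_inv, inv_one]

lemma transv_letter_mem {K : Subgroup (MulAut (F n))}
    (hK : ∀ i j, i ≠ j → transv i 1 (of j) ∈ K) (i : Fin n) (x : Fin n × Bool) (hx : x.1 ≠ i) :
    transv i 1 (FreeGroup.mk [x]) ∈ K := by
  obtain ⟨j, b⟩ := x
  rw [mk_letter]
  split_ifs
  · exact hK i j (Ne.symm hx)
  · have := inv_mem (hK i j (Ne.symm hx))
    rwa [transv_inv, inv_one] at this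

/-- Nielsen's theorem. The left transvections come for free: they differ from the right ones by
conjugations `x_i ↦ y x_i y⁻¹`, which lie in Magnus' subgroup. -/
lemma eq_top_of_generators {K : Subgroup (MulAut (F n))} (hW : ∀ φ, IsLetter φ → φ ∈ K)
    (hN : magnusSubgroup n ≤ K) (hE : ∀ i j, i ≠ j → transv i 1 (of j) ∈ K) : K = ⊤ := by
  have hk : ∀ (i : Fin n) (x : Fin n × Bool), x.1 ≠ i →
      kill i (FreeGroup.mk [x]) = FreeGroup.mk [x] := fun i x hx => by
    obtain ⟨j, b⟩ := x
    rw [mk_letter]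
    split_ifs <;> simp [kill_of_ne hx]
  refine FreeGroup.nielsen_generation K hW
    (fun i x hx => ⟨transv i 1 (FreeGroup.mk [x]), transv_letter_mem hE i x hx, ?_, ?_⟩)
    (fun i x hx => ⟨transv i (FreeGroup.mk [x]) 1, ?_, ?_, ?_⟩)
  · rw [transv_self, map_one, one_mul, hk i x hx]
  · exact fun j hj => transv_of_ne hj _ _
  · have h1 : transv i (FreeGroup.mk [x]) 1 =
        transv i 1 (FreeGroup.mk [x]) * transv i (FreeGroup.mk [x]) (FreeGroup.mk [x])⁻¹ := by
      rw [transv_mul, mul_one, mul_inv_cancel]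
    rw [h1]
    exact mul_mem (transv_letter_mem hE i x hx) (hN (transv_conj_mem i _))
  · rw [transv_self, map_one, mul_one, hk i x hx]
  · exact fun j hj => transv_of_ne hj _ _

/-- The automorphisms that, together with their inverses, conjugate the subgroup into itself form a
subgroup, so it suffices to check generators. The inverse of `x_i ↦ x_i x_j` is reduced to the
transvection itself by inverting `x_j`. -/
instance magnusSubgroup_normal : (magnusSubgroup n).Normal := by
  let K : Subgroup (MulAut (F n)) :=
    { carrier := {g | (∀ ψ ∈ magnusSubgroup n, g * ψ * g⁻¹ ∈ magnusSubgroup n) ∧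
        ∀ ψ ∈ magnusSubgroup n, g⁻¹ * ψ * g⁻¹⁻¹ ∈ magnusSubgroup n}
      one_mem' := by simp
      mul_mem' := by
        rintro a b ⟨ha, ha'⟩ ⟨hb, hb'⟩
        refine ⟨fun ψ hψ => ?_, fun ψ hψ => ?_⟩
        · convert ha _ (hb ψ hψ) using 1
          group
        · convert hb' _ (ha' ψ hψ) using 1
          group
      inv_mem' := by
        rintro a ⟨ha, ha'⟩
        exact ⟨ha', by simpa using ha⟩ }
  have hK : K = ⊤ := by
    refine eq_top_of_generators (fun φ hφ => ⟨fun ψ hψ => letter_conj_mem hφ hψ,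
      fun ψ hψ => letter_conj_mem hφ.inv hψ⟩) (fun φ hφ => ⟨fun ψ hψ => ?_, fun ψ hψ => ?_⟩)
      fun i j hij => ⟨fun ψ hψ => elem_conj_mem hij hψ, fun ψ hψ => ?_⟩
    · exact mul_mem (mul_mem hφ hψ) (inv_mem hφ)
    · exact mul_mem (mul_mem (inv_mem hφ) hψ) (inv_mem (inv_mem hφ))
    · rw [← flip_conj_transv hij]
      have h1 := letter_conj_mem (isLetter_flip j)
        (elem_conj_mem hij (letter_conj_mem (isLetter_flip j).inv hψ))
      convert h1 using 1
      group
  exact ⟨fun ψ hψ g => (show g ∈ K by rw [hK]; exact Subgroup.mem_top g).1 ψ hψ⟩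

/-! ### Coordinates on `H_ℤ` -/

lemma hom_ext {A : Type*} [AddCommGroup A] {f g : H n →ₗ[ℤ] A}
    (h : ∀ i, f (cls (of i)) = g (cls (of i))) : f = g := by
  have key : ∀ γ : F n, f (cls γ) = g (cls γ) := fun γ => by
    induction γ using FreeGroup.induction_on with
    | C1 => rw [cls_one, map_zero, map_zero]
    | of i => exact h i
    | inv_of i h => rw [cls_inv, map_neg, map_neg, h]
    | mul a b ha hb => rw [cls_mul, map_add, map_add, ha, hb]
  ext x
  induction x using Additive.rec with | _ x =>
  obtain ⟨x, rfl⟩ := QuotientGroup.mk_surjective x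
  exact key x

lemma cls_surjective (x : H n) : ∃ γ : F n, cls γ = x := by
  induction x using Additive.rec with | _ x =>
  obtain ⟨x, rfl⟩ := QuotientGroup.mk_surjective x
  exact ⟨x, rfl⟩

lemma dualBasis_cls_of (i j : Fin n) : dualBasis i (cls (of j)) = if j = i then 1 else 0 := by
  change Multiplicative.toAdd (FreeGroup.lift (fun j =>
    Multiplicative.ofAdd (if j = i then (1 : ℤ) else 0)) (of j)) = _
  rw [FreeGroup.lift_apply_of]
  rfl

/-- The coordinates of an element of `H_ℤ`. -/
noncomputable def coord (n : ℕ) : H n ≃ₗ[ℤ] (Fin n → ℤ) :=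
  LinearEquiv.ofLinearMap (LinearMap.pi fun i => dualBasis i)
    (Fintype.linearCombination ℤ fun i => cls (of i))
    (by
      refine LinearMap.pi_ext' fun j => LinearMap.ext_ring ?_
      ext i
      simp [Fintype.linearCombination_apply_single, dualBasis_cls_of, Pi.single_apply, eq_comm])
    (hom_ext fun j => by
      simp [Fintype.linearCombination_apply, dualBasis_cls_of])

lemma coord_cls_of (j : Fin n) : coord n (cls (of j)) = Pi.single j 1 := by
  ext i
  change dualBasis i _ = _
  rw [dualBasis_cls_of, Pi.single_apply]
  simp [eq_comm]

lemma coord_symm_single (j : Fin n) : (coord n).symm (Pi.single j 1) = cls (of j) := by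
  rw [LinearEquiv.symm_apply_eq, coord_cls_of]

/-- The action of `Aut(F_n)` on `ℤⁿ`. -/
noncomputable def coordEnd (n : ℕ) : MulAut (F n) →* Module.End ℤ (Fin n → ℤ) where
  toFun φ := (coord n).toLinearMap ∘ₗ absEnd n φ ∘ₗ (coord n).symm.toLinearMap
  map_one' := by
    ext
    simp
  map_mul' φ ψ := by
    ext
    simp

lemma coordEnd_single (φ : MulAut (F n)) (j : Fin n) :
    coordEnd n φ (Pi.single j 1) = coord n (cls (φ (of j))) := by
  change coord n (absEnd n φ ((coord n).symm _)) = _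
  rw [coord_symm_single]
  rfl

lemma coordEnd_eq_one_iff {φ : MulAut (F n)} : coordEnd n φ = 1 ↔ absEnd n φ = 1 := by
  constructor
  · intro h
    ext x
    have := DFunLike.congr_fun h (coord n x)
    change coord n (absEnd n φ ((coord n).symm (coord n x))) = coord n x at this
    rw [LinearEquiv.symm_apply_apply] at this
    exact (coord n).injective this
  · intro h
    ext : 2
    change coord n (absEnd n φ ((coord n).symm _)) = _
    rw [h]
    simp

lemma absEnd_transv {i : Fin n} {a b : F n} (h : cls (kill i (a * b)) = 0) :
    absEnd n (transv i a b) = 1 := by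
  refine hom_ext fun j => ?_
  rw [← cls_map]
  change _ = cls (of j)
  by_cases hj : j = i
  · subst hj
    rw [map_mul, cls_mul] at h
    rw [transv_self, cls_mul, cls_mul, add_right_comm, h, zero_add]
  · rw [transv_of_ne hj]

lemma magnusSubgroup_le : magnusSubgroup n ≤ (absEnd n).ker := by
  refine (Subgroup.closure_le _).2 ?_
  rintro _ (⟨i, j, rfl⟩ | ⟨i, j, k, rfl⟩)
  · exact absEnd_transv (by simp [cls_one])
  · exact absEnd_transv (by rw [one_mul, cls_kill_commutator])

/-! ### The quotient by Magnus' subgroup -/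

/-- The quotient of `Aut(F_n)` by Magnus' subgroup. -/
abbrev OutMagnus (n : ℕ) : Type := MulAut (F n) ⧸ magnusSubgroup n

/-- The projection to the quotient by Magnus' subgroup. -/
abbrev toQ (n : ℕ) : MulAut (F n) →* OutMagnus n := QuotientGroup.mk' (magnusSubgroup n)

/-- The two automorphisms differ by one to which `transv_mem` applies. Relations that fail in
`MulAut (F n)` hold in the quotient through this lemma. -/
lemma toQ_transv (i : Fin n) {a b a' b' : F n}
    (h : cls (kill i (a * b)) = cls (kill i (a' * b'))) :
    toQ n (transv i a b) = toQ n (transv i a' b') := by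
  refine QuotientGroup.eq.2 ?_
  rw [transv_inv, transv_mul]
  refine transv_mem i ?_
  simp only [map_mul, map_inv, cls_mul, cls_inv] at h ⊢
  rw [show ∀ a b c d : H n, a + -b + (-c + d) = a + d - (b + c) by intros; abel, h, sub_self]

/-- The homomorphism `b ↦ (x_i ↦ x_i b)`. -/
def transvRight (i : Fin n) : F n →* MulAut (F n) where
  toFun b := transv i 1 b
  map_one' := transv_one i
  map_mul' b b' := by rw [transv_mul, one_mul]

lemma transv_zpow (i : Fin n) (b : F n) (t : ℤ) : transv i 1 b ^ t = transv i 1 (b ^ t) :=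
  (map_zpow (transvRight i) b t).symm

lemma transv_commute {a c : Fin n} (hac : a ≠ c) {p q : F n} (hpa : kill a p = p)
    (hpc : kill c p = p) (hqa : kill a q = q) (hqc : kill c q = q) :
    transv a 1 p * transv c 1 q = transv c 1 q * transv a 1 p := by
  refine mulAut_ext fun l => ?_
  have h1 : transv c 1 q p = p := by rw [← hpc, transv_kill]
  have h2 : transv a 1 p q = q := by rw [← hqa, transv_kill]
  rw [MulAut.mul_apply, MulAut.mul_apply]
  by_cases hla : l = a
  · subst hla
    rw [transv_of_ne hac, transv_self, map_one, one_mul, map_mul, transv_of_ne hac, hpa, h1]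
  · rw [transv_of_ne hla]
    by_cases hlc : l = c
    · subst hlc
      rw [transv_self, map_one, one_mul, map_mul, transv_of_ne hla, hqc, h2]
    · rw [transv_of_ne hlc, transv_of_ne hla]

/-- In `MulAut (F n)`, moving one transvection past the other produces `x_a ↦ x_a (x_b x_c ^ s) ^
t`. Modulo Magnus' subgroup this power may be expanded as in an abelian group. -/
lemma toQ_chain {a b c : Fin n} (hab : a ≠ b) (hbc : b ≠ c) (hac : a ≠ c) (s t : ℤ) :
    toQ n (transv b 1 (of c)) ^ s * toQ n (transv a 1 (of b)) ^ t =
      toQ n (transv a 1 (of b)) ^ t * toQ n (transv b 1 (of c)) ^ s *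
        toQ n (transv a 1 (of c)) ^ (s * t) := by
  simp only [← map_zpow, transv_zpow]
  have h1 : transv b 1 (of c ^ s) * transv a 1 (of b ^ t) =
      transv a 1 ((of b * of c ^ s) ^ t) * transv b 1 (of c ^ s) := by
    refine mulAut_ext fun l => ?_
    rw [MulAut.mul_apply, MulAut.mul_apply]
    by_cases hla : l = a
    · subst hla
      simp only [transv_of_ne hab, transv_self, map_one, one_mul, map_mul, map_zpow,
        kill_of_ne hab.symm, kill_of_ne hac.symm, kill_of_ne hbc.symm]
    · rw [transv_of_ne hla]
      by_cases hlb : l = b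
      · subst hlb
        simp only [transv_self, map_one, one_mul, map_mul, map_zpow, transv_of_ne hla,
          kill_of_ne hbc.symm, transv_of_ne hac.symm]
      · rw [transv_of_ne hlb, transv_of_ne hla]
  have h2 : transv b 1 (of c ^ s) * transv a 1 (of c ^ (s * t)) =
      transv a 1 (of c ^ (s * t)) * transv b 1 (of c ^ s) :=
    transv_commute hab.symm (by rw [map_zpow, kill_of_ne hbc.symm])
      (by rw [map_zpow, kill_of_ne hac.symm]) (by rw [map_zpow, kill_of_ne hbc.symm])
      (by rw [map_zpow, kill_of_ne hac.symm])
  rw [mul_assoc, ← map_mul, ← map_mul, h1, h2, map_mul, map_mul, ← mul_assoc,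
    ← map_mul _ (transv a 1 _) (transv a 1 _), transv_mul]
  congr 1
  refine toQ_transv a ?_
  simp only [one_mul, map_mul, map_zpow, kill_of_ne hab.symm, kill_of_ne hac.symm]
  simp only [cls, map_zpow, map_mul, ofMul_zpow, ofMul_mul, smul_add]
  rw [smul_smul, mul_comm s t]

/-- The signed permutations of the generators, as a subgroup. -/
def letterSubgroup (n : ℕ) : Subgroup (MulAut (F n)) where
  carrier := {φ | IsLetter φ}
  one_mem' i := ⟨(i, true), rfl⟩
  mul_mem' := IsLetter.mul
  inv_mem' := IsLetter.inv

/-- In the quotient a transvection may be represented with its factor on the left or on the right.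
The representatives are chosen so that the triple product is a signed permutation in `MulAut (F n)`
itself. -/
lemma toQ_weyl {a b : Fin n} (hab : a ≠ b) {t : ℤ} (ht : t = 1 ∨ t = -1) :
    ∃ w ∈ (letterSubgroup n).map (toQ n),
      toQ n (transv b 1 (of a)) ^ (-t) * toQ n (transv a 1 (of b)) ^ t =
        w * toQ n (transv b 1 (of a)) ^ t := by
  have hE : ∀ s : ℤ, toQ n (transv b 1 (of a)) ^ s = toQ n (transv b 1 (of a ^ s)) := fun s => by
    rw [← map_zpow, transv_zpow]
  have hE' : ∀ s : ℤ, toQ n (transv b 1 (of a)) ^ s = toQ n (transv b (of a ^ s) 1) := fun s => by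
    rw [hE]
    exact toQ_transv b (by rw [one_mul, mul_one])
  have hM : toQ n (transv a 1 (of b)) ^ t = toQ n (transv a 1 (of b ^ t)) := by
    rw [← map_zpow, transv_zpow]
  have key : ∀ x y : MulAut (F n), toQ n x = toQ n (transv b 1 (of a)) ^ (-t) →
      toQ n y = toQ n (transv b 1 (of a)) ^ (-t) → IsLetter (x * transv a 1 (of b ^ t) * y) →
      ∃ w ∈ (letterSubgroup n).map (toQ n),
        toQ n (transv b 1 (of a)) ^ (-t) * toQ n (transv a 1 (of b)) ^ t =
          w * toQ n (transv b 1 (of a)) ^ t := fun x y hx hy hxy => by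
    refine ⟨_, ⟨_, hxy, rfl⟩, ?_⟩
    rw [map_mul, map_mul, hx, hy, hM, mul_assoc _ _ (toQ n (transv b 1 (of a)) ^ t), ← zpow_add,
      neg_add_cancel, zpow_zero, mul_one]
  rcases ht with rfl | rfl
  · refine key (transv b (of a ^ (-1 : ℤ)) 1) (transv b 1 (of a ^ (-1 : ℤ))) (hE' _).symm
      (hE _).symm fun l => ?_
    simp only [MulAut.mul_apply, zpow_neg, zpow_one]
    by_cases hla : l = a
    · subst hla
      refine ⟨(b, true), ?_⟩
      simp only [transv_of_ne hab, transv_self, map_one, one_mul, mul_one, map_mul, map_inv,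
        kill_of_ne hab, kill_of_ne hab.symm, mul_inv_cancel_left]
      rfl
    · by_cases hlb : l = b
      · subst hlb
        refine ⟨(a, false), ?_⟩
        simp only [transv_of_ne hab, transv_of_ne hab.symm, transv_self, map_one, one_mul, map_mul,
          map_inv, kill_of_ne hab, kill_of_ne hab.symm, mul_inv_rev, mul_inv_cancel_left]
        rfl
      · exact ⟨(l, true), by simp only [transv_of_ne hla, transv_of_ne hlb]; rfl⟩
  · refine key (transv b 1 (of a ^ (- -1 : ℤ))) (transv b (of a ^ (- -1 : ℤ)) 1) (hE _).symm
      (hE' _).symm fun l => ?_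
    simp only [MulAut.mul_apply, zpow_neg, zpow_one, inv_inv]
    by_cases hla : l = a
    · subst hla
      refine ⟨(b, false), ?_⟩
      simp only [transv_of_ne hab, transv_self, map_one, one_mul, map_mul, map_inv,
        kill_of_ne hab, kill_of_ne hab.symm, mul_inv_rev, mul_inv_cancel_left]
      rfl
    · by_cases hlb : l = b
      · subst hlb
        refine ⟨(a, true), ?_⟩
        simp only [transv_of_ne hab, transv_of_ne hab.symm, transv_self, map_one, one_mul, mul_one,
          map_mul, map_inv, kill_of_ne hab, kill_of_ne hab.symm, inv_mul_cancel_right]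
        rfl
      · exact ⟨(l, true), by simp only [transv_of_ne hla, transv_of_ne hlb]; rfl⟩

/-- The action of the quotient by Magnus' subgroup on `ℤⁿ`. -/
noncomputable def coordEndQ (n : ℕ) : OutMagnus n →* Module.End ℤ (Fin n → ℤ) :=
  QuotientGroup.lift (magnusSubgroup n) (coordEnd n) fun _ hφ =>
    coordEnd_eq_one_iff.2 (magnusSubgroup_le hφ)

/-- The sign of a letter. -/
def sgn (b : Bool) : ℤ := if b then 1 else -1

lemma sgn_eq (b : Bool) : sgn b = 1 ∨ sgn b = -1 := by cases b <;> simp [sgn]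

lemma mk_letter_zpow (i : Fin n) (b : Bool) : FreeGroup.mk [(i, b)] = of i ^ sgn b := by
  rw [mk_letter]
  cases b <;> simp [sgn]

lemma cls_zpow (γ : F n) (s : ℤ) : cls (γ ^ s) = s • cls γ := by
  simp [cls, ofMul_zpow]

lemma coordEnd_letter {φ : MulAut (F n)} {σ : Equiv.Perm (Fin n)} {b : Fin n → Bool}
    (h : ∀ i, φ (of i) = FreeGroup.mk [(σ i, b i)]) (v : Fin n → ℤ) (i : Fin n) :
    coordEnd n φ v (σ i) = sgn (b i) * v i := by
  have h1 : (LinearMap.proj (σ i) ∘ₗ coordEnd n φ : (Fin n → ℤ) →ₗ[ℤ] ℤ) =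
      sgn (b i) • LinearMap.proj i := by
    refine LinearMap.pi_ext' fun j => LinearMap.ext_ring ?_
    simp only [LinearMap.coe_comp, Function.comp_apply, LinearMap.coe_single, coordEnd_single, h,
      mk_letter_zpow, cls_zpow, map_smul, coord_cls_of, LinearMap.proj_apply, LinearMap.smul_apply,
      Pi.single_apply, σ.injective.eq_iff, smul_eq_mul]
    by_cases hij : i = j
    · subst hij
      simp
    · simp [hij]
  exact DFunLike.congr_fun h1 v

lemma coordEnd_flip (a : Fin n) (v : Fin n → ℤ) :
    coordEnd n (flip a) v = Function.update v a (-v a) := by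
  ext i
  have := coordEnd_letter (σ := Equiv.refl _) (fun j => flip_of_eq_mk a j) v i
  rw [Equiv.refl_apply] at this
  rw [this]
  by_cases h : i = a
  · subst h
    simp [sgn]
  · simp [sgn, h]

lemma coordEnd_transv {a b : Fin n} (hab : a ≠ b) (v : Fin n → ℤ) :
    coordEnd n (transv a 1 (of b)) v = Function.update v b (v b + v a) := by
  have h1 : coordEnd n (transv a 1 (of b)) =
      LinearMap.id + LinearMap.single ℤ (fun _ => ℤ) b ∘ₗ LinearMap.proj a := by
    refine LinearMap.pi_ext' fun j => LinearMap.ext_ring ?_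
    simp only [LinearMap.coe_comp, Function.comp_apply, LinearMap.coe_single, coordEnd_single,
      LinearMap.add_apply, LinearMap.id_apply, LinearMap.proj_apply]
    by_cases hj : j = a
    · subst hj
      rw [transv_self, map_one, one_mul, cls_mul, map_add, coord_cls_of, kill_of_ne hab.symm,
        coord_cls_of, Pi.single_eq_same]
    · rw [transv_of_ne hj, coord_cls_of, Pi.single_eq_of_ne (Ne.symm hj), Pi.single_zero, add_zero]
  rw [h1]
  ext i
  by_cases hi : i = b
  · subst hi
    simp
  · simp [hi]

/-- Elementary transvections and signed permutations in the quotient by Magnus' subgroup. -/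
noncomputable def elementaryData (n : ℕ) : ElementaryData (Fin n) (OutMagnus n) where
  ρ := coordEndQ n
  E a b := toQ n (transv a 1 (of b))
  W := (letterSubgroup n).map (toQ n)
  ρ_E a b v hab := coordEnd_transv hab v
  comm a b c d hab hcd hbc hda := by
    by_cases hac : a = c
    · subst hac
      change toQ n _ * toQ n _ = toQ n _ * toQ n _
      rw [← map_mul, ← map_mul, transv_mul, transv_mul]
      refine toQ_transv a ?_
      simp only [one_mul, map_mul, cls_mul, add_comm]
    · change toQ n _ * toQ n _ = toQ n _ * toQ n _
      rw [← map_mul, ← map_mul, transv_commute hac (kill_of_ne hab.symm) (kill_of_ne hbc)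
        (kill_of_ne hda) (kill_of_ne hcd.symm)]
  chain a b c hab hbc hac s t := toQ_chain hab hbc hac s t
  weyl a b hab t ht := toQ_weyl hab ht
  flip a := ⟨_, ⟨flip a, isLetter_flip a, rfl⟩, coordEnd_flip a⟩
  W_conj := by
    rintro _ ⟨φ, hφ, rfl⟩
    obtain ⟨σ, c, hσ⟩ := IsLetter.exists_perm hφ
    refine ⟨σ, fun i => sgn (c i), fun i => sgn_eq _, coordEnd_letter hσ, fun a b hab => ?_⟩
    have hne : σ b ≠ σ a := fun h => hab (σ.injective h).symm
    rw [← map_inv, ← map_mul, ← map_mul, letter_mul_transv hσ, ← map_zpow, transv_zpow, hσ,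
      mk_letter_zpow, map_one]
    split_ifs with h
    · simp [h, sgn]
    · refine toQ_transv _ ?_
      beta_reduce
      rw [inv_one, one_mul, mul_one, ← zpow_neg, show sgn (c a) = -1 by simp [sgn, h],
        neg_one_mul]
  W_faithful := by
    rintro _ ⟨φ, hφ, rfl⟩ h
    obtain ⟨σ, c, hσ⟩ := IsLetter.exists_perm hφ
    suffices φ = 1 by rw [this, map_one]
    refine mulAut_ext fun i => ?_
    have h1 := coordEnd_letter hσ (Pi.single i 1) i
    rw [show coordEnd n φ = 1 from h] at h1
    change (Pi.single i 1 : Fin n → ℤ) (σ i) = _ at h1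
    rw [Pi.single_eq_same, Pi.single_apply, mul_one] at h1
    rw [hσ, mk_letter_zpow, ← h1]
    split_ifs at h1 ⊢ with h2
    · rw [h2, zpow_one]
      rfl
    · exfalso
      rcases sgn_eq (c i) with h3 | h3 <;> simp [h3] at h1

lemma mem_GS (g : OutMagnus n) : g ∈ (elementaryData n).GS Finset.univ := by
  have h : ((elementaryData n).GS Finset.univ).comap (toQ n) = ⊤ := by
    refine eq_top_of_generators (fun φ hφ => ?_) (fun φ hφ => ?_) fun i j hij => ?_
    · exact Subgroup.subset_closure (Or.inr ⟨⟨φ, hφ, rfl⟩, fun i hi =>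
        absurd (Finset.mem_univ i) hi⟩)
    · rw [Subgroup.mem_comap, show toQ n φ = 1 from (QuotientGroup.eq_one_iff φ).2 hφ]
      exact one_mem _
    · exact Subgroup.subset_closure
        (Or.inl ⟨i, Finset.mem_univ i, j, Finset.mem_univ j, hij, rfl⟩)
  obtain ⟨φ, rfl⟩ := QuotientGroup.mk'_surjective _ g
  exact (show φ ∈ ((elementaryData n).GS Finset.univ).comap (toQ n) by
    rw [h]; exact Subgroup.mem_top φ)

/-- Magnus' theorem: `IA_n` is generated by the automorphisms `x_i ↦ x_j x_i x_j⁻¹` and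
`x_i ↦ x_i [x_j, x_k]`. -/
theorem IA_eq_magnusSubgroup (n : ℕ) : IA n = magnusSubgroup n := by
  refine le_antisymm (fun φ hφ => ?_) fun φ hφ => ?_
  · have h1 : absEnd n φ = 1 := congrArg Units.val hφ
    have h2 : coordEndQ n (toQ n φ) = 1 := coordEnd_eq_one_iff.2 h1
    -- Magnus' subgroup is the whole kernel because the quotient by it acts faithfully on `ℤⁿ`.
    exact (QuotientGroup.eq_one_iff φ).1 ((elementaryData n).eq_one_of_ρ_eq_one _ (mem_GS _) h2)
  · exact Units.ext (magnusSubgroup_le hφ)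

/-- `Aut(F_n) → GL(H_ℤ)` is surjective. -/
theorem abs_surjective (n : ℕ) : Function.Surjective (abs n) := by
  intro A
  let A' : (Module.End ℤ (Fin n → ℤ))ˣ := Units.map (coord n).conjRingEquiv.toMonoidHom A
  obtain ⟨g, -, hg⟩ := (elementaryData n).exists_toHomUnits_eq Finset.univ A'
    (fun i hi => absurd (Finset.mem_univ i) hi) fun i hi => absurd (Finset.mem_univ i) hi
  obtain ⟨φ, rfl⟩ := QuotientGroup.mk'_surjective _ g
  refine ⟨φ, Units.ext (LinearMap.ext fun x => ?_)⟩
  have h1 : coordEnd n φ = (coord n).conj (A : Module.End ℤ (H n)) := congrArg Units.val hg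
  have h2 := DFunLike.congr_fun h1 (coord n x)
  rw [LinearEquiv.conj_apply_apply, LinearEquiv.symm_apply_apply] at h2
  change coord n (absEnd n φ ((coord n).symm (coord n x))) = _ at h2
  rw [LinearEquiv.symm_apply_apply] at h2
  exact (coord n).injective h2

theorem proj_surjective (S : Subgroup (LinearMap.GeneralLinearGroup ℤ (H n))) :
    Function.Surjective (proj S) := by
  rintro ⟨A, hA⟩
  obtain ⟨φ, rfl⟩ := abs_surjective n A
  exact ⟨⟨φ, hA⟩, rfl⟩

end AutFree

/-! ## A crossed homomorphism extending twice the Johnson homomorphism -/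

namespace AutFree

variable {n : ℕ}

open FreeGroup (of)
open scoped commutatorElement

/-- The basis `X_i = [x_i]` of `H_ℤ`. -/
noncomputable def basisH (n : ℕ) : Module.Basis (Fin n) ℤ (H n) := Module.Basis.ofEquivFun (coord n)

@[simp] lemma basisH_apply (i : Fin n) : basisH n i = cls (of i) := by
  rw [basisH, Module.Basis.coe_ofEquivFun]
  exact coord_symm_single i

/-- The projection `H_ℤ^{⊗2} → Λ² H_ℤ`. -/
noncomputable def wedge (n : ℕ) : H n ⊗[ℤ] H n →ₗ[ℤ] ⋀[ℤ]^2 (H n) :=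
  TensorProduct.lift
    { toFun := fun a => (AlternatingMap.ofSubsingleton ℤ (H n) _ (0 : Fin 1)).symm
        ((exteriorPower.ιMulti ℤ 2 : (H n) [⋀^Fin 2]→ₗ[ℤ] _).curryLeft a)
      map_add' := fun a b => by
        rw [map_add]
        rfl
      map_smul' := fun c a => by
        rw [map_smul]
        rfl }

lemma wedge_tmul (a b : H n) : wedge n (a ⊗ₜ b) = exteriorPower.ιMulti ℤ 2 ![a, b] := by
  change exteriorPower.ιMulti ℤ 2 (Matrix.vecCons a fun _ : Fin 1 => b) = _
  congr 1
  ext i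
  fin_cases i <;> rfl

lemma antisym_wedge_tmul (a b : H n) : antisym n (wedge n (a ⊗ₜ b)) = a ⊗ₜ b - b ⊗ₜ a := by
  rw [wedge_tmul, antisym_wedge]

lemma vec_two_eta (v : Fin 2 → H n) : ![v 0, v 1] = v := by
  ext i
  fin_cases i <;> rfl

lemma wedge_swap (a b : H n) : wedge n (b ⊗ₜ a) = -wedge n (a ⊗ₜ b) := by
  have := (exteriorPower.ιMulti ℤ 2 : (H n) [⋀^Fin 2]→ₗ[ℤ] _).map_swap ![a, b]
    (show (0 : Fin 2) ≠ 1 by decide)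
  rw [wedge_tmul, wedge_tmul, ← this]
  congr 1
  ext i
  fin_cases i <;> rfl

/-- This is where the factor 2 enters: `crossed` is built with `wedge`, the Johnson homomorphism
with `antisym`. -/
lemma wedge_antisym (w : ⋀[ℤ]^2 (H n)) : wedge n (antisym n w) = (2 : ℤ) • w := by
  have : wedge n ∘ₗ antisym n = (2 : ℤ) • LinearMap.id := by
    refine exteriorPower.linearMap_ext (AlternatingMap.ext fun v => ?_)
    change wedge n (antisym n (exteriorPower.ιMulti ℤ 2 v)) = (2 : ℤ) • exteriorPower.ιMulti ℤ 2 v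
    rw [← vec_two_eta v, antisym_wedge, map_sub, wedge_swap (v 0) (v 1), wedge_tmul, two_smul,
      sub_neg_eq_add]
  exact DFunLike.congr_fun this w

lemma map_wedge (A : Module.End ℤ (H n)) (t : H n ⊗[ℤ] H n) :
    exteriorPower.map 2 A (wedge n t) = wedge n (TensorProduct.map A A t) := by
  induction t with
  | zero => simp
  | add x y hx hy => simp only [map_add, hx, hy]
  | tmul a b =>
    rw [wedge_tmul, exteriorPower.map_apply_ιMulti, TensorProduct.map_tmul, wedge_tmul]
    congr 1
    ext i
    fin_cases i <;> rfl

/-- The failure of the Magnus expansion to be equivariant in degree two: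
`[γ] ↦ θ₂(γ) - |φ| θ₂(φ⁻¹ γ)`. -/
noncomputable def magnusDefect (φ : MulAut (F n)) : H n →ₗ[ℤ] H n ⊗[ℤ] H n :=
  (MonoidHom.toAdditiveLeft (Abelianization.lift
    (MonoidHom.mk' (fun γ => Multiplicative.ofAdd
      (theta2 γ - TensorProduct.map (absEnd n φ) (absEnd n φ) (theta2 (φ⁻¹ γ)))) fun γ δ => by
        -- The quadratic term `[γ] ⊗ [δ]` of `theta2_mul` occurs in both summands and cancels, so
        -- the defect is additive.
        rw [← ofAdd_add, map_mul, theta2_mul, theta2_mul, map_add, map_add, TensorProduct.map_tmul,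
          ← cls_map, ← cls_map, ← MulAut.mul_apply, ← MulAut.mul_apply, mul_inv_cancel,
          MulAut.one_apply, MulAut.one_apply]
        congr 1
        abel))).toIntLinearMap

lemma magnusDefect_cls (φ : MulAut (F n)) (γ : F n) : magnusDefect φ (cls γ) =
    theta2 γ - TensorProduct.map (absEnd n φ) (absEnd n φ) (theta2 (φ⁻¹ γ)) :=
  rfl

/-- The crossed homomorphism `Aut(F_n) → H_ℤ^* ⊗ Λ² H_ℤ` that restricts to twice the Johnson
homomorphism. -/
noncomputable def crossed (φ : MulAut (F n)) : T n :=
  ∑ i, dualBasis i ⊗ₜ wedge n (magnusDefect φ (cls (of i)))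

/-- The identification of `H_ℤ^* ⊗ Λ² H_ℤ` with `Hom(H_ℤ, Λ² H_ℤ)`. -/
noncomputable abbrev ev (n : ℕ) : T n →ₗ[ℤ] H n →ₗ[ℤ] ⋀[ℤ]^2 (H n) :=
  dualTensorHom ℤ (H n) (⋀[ℤ]^2 (H n))

lemma ev_injective : Function.Injective (ev n) :=
  (dualTensorHomEquivOfBasis (N := ⋀[ℤ]^2 (H n)) (basisH n)).injective

lemma ev_tmul_apply (ℓ : Module.Dual ℤ (H n)) (w : ⋀[ℤ]^2 (H n)) (x : H n) :
    ev n (ℓ ⊗ₜ w) x = ℓ x • w :=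
  rfl

lemma ev_sum (w : Fin n → ⋀[ℤ]^2 (H n)) (j : Fin n) :
    ev n (∑ i, dualBasis i ⊗ₜ w i) (cls (of j)) = w j := by
  rw [map_sum, LinearMap.sum_apply]
  simp only [ev_tmul_apply, dualBasis_cls_of, ite_smul, one_smul, zero_smul]
  simp

lemma ev_crossed (φ : MulAut (F n)) : ev n (crossed φ) = wedge n ∘ₗ magnusDefect φ :=
  hom_ext fun j => ev_sum _ j

lemma ev_repT (A : LinearMap.GeneralLinearGroup ℤ (H n)) (t : T n) (x : H n) :
    ev n (repT n A t) x = extSq n A (ev n t (std n A⁻¹ x)) := by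
  induction t using TensorProduct.induction_on with
  | zero => simp
  | add a b ha hb => simp only [map_add, LinearMap.add_apply, ha, hb]
  | tmul ℓ w =>
    change ev n ((std n).dual A ℓ ⊗ₜ extSq n A w) x = _
    rw [ev_tmul_apply, ev_tmul_apply, map_smul]
    rfl

/-- The defect of a product telescopes through `|φ| θ₂(φ⁻¹ γ)`, and `wedge` is equivariant. -/
lemma crossed_mul (φ ψ : MulAut (F n)) :
    crossed (φ * ψ) = crossed φ + repT n (abs n φ) (crossed ψ) := by
  refine ev_injective (LinearMap.ext fun x => ?_)
  obtain ⟨γ, rfl⟩ := cls_surjective x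
  rw [map_add, LinearMap.add_apply, ev_repT, ev_crossed, ev_crossed, ev_crossed, ← map_inv,
    show std n (abs n φ⁻¹) (cls γ) = cls (φ⁻¹ γ) from rfl, LinearMap.comp_apply, LinearMap.comp_apply, LinearMap.comp_apply, magnusDefect_cls,
    magnusDefect_cls, magnusDefect_cls]
  change _ = _ + exteriorPower.map 2 (absEnd n φ) _
  rw [map_wedge, ← map_add]
  congr 1
  rw [map_sub, sub_add_sub_cancel, map_mul, Module.End.mul_eq_comp, TensorProduct.map_comp,
    mul_inv_rev]
  rfl

/-- On `IA n` the classes of `x_i` and `φ x_i` agree, so the defect may be evaluated at `φ x_i`,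
where it is `θ₂(φ x_i) - θ₂(x_i)`; then `wedge_antisym` doubles the Johnson value. -/
lemma crossed_coe (φ : IA n) : crossed (φ : MulAut (F n)) = (2 : ℤ) • johnson φ := by
  have h1 : absEnd n (φ : MulAut (F n)) = 1 := congrArg Units.val φ.2
  rw [crossed, johnson, Finset.smul_sum]
  refine Finset.sum_congr rfl fun i _ => ?_
  rw [← tmul_smul, ← wedge_antisym, Classical.choose_spec (exists_antisym φ (of i))]
  have h2 : cls (of i) = cls ((φ : MulAut (F n)) (of i)) := by
    rw [cls_map, h1]
    rfl
  rw [h2, magnusDefect_cls, h1, ← MulAut.mul_apply, inv_mul_cancel]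
  congr 3

lemma ev_crossed_of_IA {φ : MulAut (F n)} (h : absEnd n φ = 1) (γ : F n) :
    ev n (crossed φ) (cls γ) = wedge n (theta2 (φ γ) - theta2 γ) := by
  have h2 : cls γ = cls (φ γ) := by
    rw [cls_map, h]
    rfl
  rw [ev_crossed, LinearMap.comp_apply, h2, magnusDefect_cls, h, ← MulAut.mul_apply,
    inv_mul_cancel]
  congr 2
  exact DFunLike.congr_fun TensorProduct.map_id _

lemma theta2_of (i : Fin n) : theta2 (of i) = 0 := by simp [theta2, magnus]

lemma theta2_inv (γ : F n) : theta2 γ⁻¹ = -theta2 γ + cls γ ⊗ₜ cls γ := by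
  simp [theta2, magnus_one]

lemma theta2_commutator (a b : F n) : theta2 ⁅a, b⁆ = cls a ⊗ₜ cls b - cls b ⊗ₜ cls a := by
  simp only [commutatorElement_def, theta2_mul, theta2_inv, cls_mul, cls_inv, add_tmul, tmul_neg,
    neg_tmul]
  abel

lemma ev_crossed_transv {i : Fin n} {a b : F n} (h : cls (kill i (a * b)) = 0) (j : Fin n) :
    ev n (crossed (transv i a b)) (cls (of j)) = if j = i then
      wedge n (theta2 (kill i a * of i * kill i b)) else 0 := by
  rw [ev_crossed_of_IA (absEnd_transv h)]
  split_ifs with hj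
  · subst hj
    rw [transv_self, theta2_of, sub_zero]
  · rw [transv_of_ne hj, sub_self, map_zero]

lemma ev_tmul (i j : Fin n) (w : ⋀[ℤ]^2 (H n)) :
    ev n (dualBasis i ⊗ₜ w) (cls (of j)) = if j = i then w else 0 := by
  rw [ev_tmul_apply, dualBasis_cls_of, ite_smul, one_smul, zero_smul]

/-- With `crossed_commutator`, this exhibits twice a basis of `T n`, up to signs, as values of
`crossed` on Magnus' generators. -/
lemma crossed_conj {i j : Fin n} (hij : j ≠ i) : crossed (transv i (of j) (of j)⁻¹) =
    (2 : ℤ) • dualBasis i ⊗ₜ wedge n (cls (of j) ⊗ₜ cls (of i)) := by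
  refine ev_injective (hom_ext fun l => ?_)
  rw [map_smul, LinearMap.smul_apply, ev_tmul, ev_crossed_transv (by simp [cls_one])]
  split_ifs
  · rw [map_inv, kill_of_ne hij]
    simp only [theta2_mul, theta2_inv, theta2_of, cls_mul, cls_inv, add_tmul, tmul_neg, map_add,
      map_neg, map_zero]
    rw [wedge_swap (cls (of j)) (cls (of i))]
    simp only [two_smul, neg_add, zero_add, neg_zero, neg_neg, add_zero]
    abel
  · simp

lemma crossed_commutator {i j k : Fin n} (hj : j ≠ i) (hk : k ≠ i) :
    crossed (transv i 1 ⁅(of j : F n), of k⁆) =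
      (2 : ℤ) • dualBasis i ⊗ₜ wedge n (cls (of j) ⊗ₜ cls (of k)) := by
  refine ev_injective (hom_ext fun l => ?_)
  rw [map_smul, LinearMap.smul_apply, ev_tmul,
    ev_crossed_transv (by rw [one_mul, cls_kill_commutator])]
  split_ifs
  · have h1 : cls ⁅(of j : F n), of k⁆ = 0 := by
      rw [commutatorElement_def]
      simp only [cls_mul, cls_inv]
      abel
    rw [map_commutatorElement, kill_of_ne hj, kill_of_ne hk, map_one, one_mul, theta2_mul,
      theta2_commutator, theta2_of, h1, tmul_zero, add_zero, zero_add, map_sub,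
      wedge_swap (cls (of j)) (cls (of k)), two_smul, sub_neg_eq_add]
  · simp

end AutFree

/-! ## Homomorphisms from `IA_n` to a `ℤ[1/2]`-module -/

namespace AutFree

variable {n : ℕ}

open FreeGroup (of)
open scoped commutatorElement

/-- The element `1/2` of `ℤ[1/2]`. -/
noncomputable def half : ZHalf := IsLocalization.Away.invSelf (2 : ℤ)

section

variable {M : Type*} [AddCommGroup M] [Module ZHalf M]

lemma half_smul_two (x : M) : half • (2 : ℤ) • x = x := by
  have h : (algebraMap ℤ ZHalf 2) * half = 1 := IsLocalization.Away.mul_invSelf (2 : ℤ)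
  rw [← Int.cast_smul_eq_zsmul ZHalf (2 : ℤ) x, smul_smul, mul_comm]
  have h2 : ((2 : ℤ) : ZHalf) * half = 1 := by simpa using h
  rw [h2, one_smul]

lemma two_smul_half (x : M) : (2 : ℤ) • half • x = x := by
  rw [smul_comm, half_smul_two]

lemma eq_of_two_smul_eq {x y : M} (h : (2 : ℤ) • x = (2 : ℤ) • y) : x = y := by
  rw [← half_smul_two x, h, half_smul_two]

/-- The map `Aut(F_n) → M` attached to a homomorphism `u : H_ℤ^* ⊗ Λ² H_ℤ → M`, which extends
`u ∘ τ₁`. -/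
noncomputable def extJohnson (u : T n →ₗ[ℤ] M) (φ : MulAut (F n)) : M := half • u (crossed φ)

lemma extJohnson_coe (u : T n →ₗ[ℤ] M) (φ : IA n) :
    extJohnson u (φ : MulAut (F n)) = u (johnson φ) := by
  rw [extJohnson, crossed_coe, map_smul, half_smul_two]

lemma mem_IA_iff {φ : MulAut (F n)} : φ ∈ IA n ↔ absEnd n φ = 1 :=
  ⟨fun h => congrArg Units.val h, fun h => Units.ext h⟩

lemma crossed_one : crossed (1 : MulAut (F n)) = 0 := by
  have h := crossed_mul (1 : MulAut (F n)) 1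
  rwa [mul_one, map_one, map_one, Module.End.one_apply, left_eq_add] at h

lemma transv_conj_mem_IA (i j : Fin n) : transv i (of j) (of j)⁻¹ ∈ IA n :=
  mem_IA_iff.2 (absEnd_transv (by simp [cls_one]))

lemma transv_commutator_mem_IA (i j k : Fin n) : transv i 1 ⁅(of j : F n), of k⁆ ∈ IA n :=
  mem_IA_iff.2 (absEnd_transv (by rw [one_mul, cls_kill_commutator]))

/-- The Johnson images of the nontrivial Magnus generators are a basis of `T n` up to signs. So `u`
can be prescribed there, and agreement on generators of `IA n` is enough. -/
lemma exists_linearMap_johnson (f : IA n → M) (hf : ∀ x y, f (x * y) = f x + f y) :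
    ∃ u : T n →ₗ[ℤ] M, ∀ x, u (johnson x) = f x := by
  have f_one : f 1 = 0 := by simpa using hf 1 1
  have f_inv : ∀ x, f x⁻¹ = -f x := fun x => by
    rw [eq_neg_iff_add_eq_zero, ← hf, inv_mul_cancel, f_one]
  -- Since `u` is evaluated through `antisym`, `X_j ∧ X_k` receives `β i (X_j ⊗ X_k) - β i (X_k ⊗
  -- X_j)`. A conjugation is recorded only in the ordering with `X_i` second; a commutator is shared
  -- between both orderings, whence the `half`.
  let β (i : Fin n) : H n ⊗[ℤ] H n →ₗ[ℤ] M := ((basisH n).tensorProduct (basisH n)).constr ℤ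
    fun p => if p.2 = i then f ⟨_, transv_conj_mem_IA i p.1⟩ else if p.1 = i then 0 else
      half • f ⟨_, transv_commutator_mem_IA i p.1 p.2⟩
  have hβ : ∀ i j k, β i (cls (of j) ⊗ₜ cls (of k)) =
      if k = i then f ⟨_, transv_conj_mem_IA i j⟩ else if j = i then 0 else
        half • f ⟨_, transv_commutator_mem_IA i j k⟩ := fun i j k => by
    have := ((basisH n).tensorProduct (basisH n)).constr_basis ℤ (fun p : Fin n × Fin n =>
      if p.2 = i then f ⟨_, transv_conj_mem_IA i p.1⟩ else if p.1 = i then 0 else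
      half • f ⟨_, transv_commutator_mem_IA i p.1 p.2⟩) (j, k)
    rwa [Module.Basis.tensorProduct_apply, basisH_apply, basisH_apply] at this
  let u : T n →ₗ[ℤ] M := ∑ i, β i ∘ₗ antisym n ∘ₗ LinearMap.applyₗ (cls (of i)) ∘ₗ ev n
  have hu : ∀ t, u t = ∑ i, β i (antisym n (ev n t (cls (of i)))) := fun t => by
    simp [u]
  have key : ∀ i j k, u ((2 : ℤ) • dualBasis i ⊗ₜ wedge n (cls (of j) ⊗ₜ cls (of k))) =
      (2 : ℤ) • (β i (cls (of j) ⊗ₜ cls (of k)) - β i (cls (of k) ⊗ₜ cls (of j))) := by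
    intro i j k
    rw [map_smul, hu, Finset.sum_eq_single i]
    · rw [ev_tmul, if_pos rfl, antisym_wedge_tmul, map_sub]
    · intro l _ hl
      rw [ev_tmul, if_neg hl, map_zero, map_zero]
    · simp
  have main : ∀ φ (hφ : φ ∈ magnusSubgroup n),
      u (crossed φ) = (2 : ℤ) • f ⟨φ, (IA_eq_magnusSubgroup n).ge hφ⟩ := by
    intro φ hφ
    induction hφ using Subgroup.closure_induction with
    | mem x hx =>
      rcases hx with ⟨i, j, rfl⟩ | ⟨i, j, k, rfl⟩
      · by_cases hij : j = i
        · subst hij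
          have h1 : transv j (of j) (of j)⁻¹ = 1 := by
            rw [← transv_one j]
            exact transv_congr j (by simp) (by simp)
          simp only [h1, crossed_one, map_zero]
          exact ((congrArg _ f_one).trans (smul_zero _)).symm
        · rw [crossed_conj hij, key, hβ, hβ, if_pos rfl, if_neg hij, if_pos rfl, sub_zero]
      · by_cases hji : j = i
        · subst hji
          have h1 : transv j 1 ⁅(of j : F n), of k⁆ = 1 := by
            rw [← transv_one j]
            exact transv_congr j (by simp) (by simp [map_commutatorElement])
          simp only [h1, crossed_one, map_zero]
          exact ((congrArg _ f_one).trans (smul_zero _)).symm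
        · by_cases hki : k = i
          · subst hki
            have h1 : transv k 1 ⁅(of j : F n), of k⁆ = 1 := by
              rw [← transv_one k]
              exact transv_congr k (by simp) (by simp [map_commutatorElement])
            simp only [h1, crossed_one, map_zero]
            exact ((congrArg _ f_one).trans (smul_zero _)).symm
          · rw [crossed_commutator hji hki, key, hβ, hβ, if_neg hki, if_neg hji, if_neg hji,
              if_neg hki]
            have h1 : (⟨_, transv_commutator_mem_IA i k j⟩ : IA n) =
                ⟨_, transv_commutator_mem_IA i j k⟩⁻¹ := Subtype.ext (by
              change _ = (transv i 1 ⁅(of j : F n), of k⁆)⁻¹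
              rw [transv_inv, inv_one, commutatorElement_inv])
            rw [h1, f_inv, smul_neg, sub_neg_eq_add, ← two_smul ℤ (half • _), two_smul_half]
    | one => rw [crossed_one, map_zero]; exact ((congrArg _ f_one).trans (smul_zero _)).symm
    | mul x y hx hy h1 h2 =>
      have h3 : abs n x = 1 := (IA_eq_magnusSubgroup n).ge hx
      rw [crossed_mul, h3, map_one, Module.End.one_apply, map_add, h1, h2, ← smul_add, ← hf]
      rfl
    | inv x hx h1 =>
      have h3 : abs n x⁻¹ = 1 := (IA_eq_magnusSubgroup n).ge (inv_mem hx)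
      have h4 := crossed_mul x⁻¹ x
      rw [inv_mul_cancel, crossed_one, h3, map_one, Module.End.one_apply] at h4
      rw [eq_neg_of_add_eq_zero_left h4.symm, map_neg, h1, ← smul_neg, ← f_inv]
      rfl
  refine ⟨u, fun x => eq_of_two_smul_eq ?_⟩
  rw [← map_smul, ← crossed_coe]
  exact main _ ((IA_eq_magnusSubgroup n).le x.2)

/-- Up to signs, twice the basis vectors of `T n` are values of `crossed` on `IA n`, and 2 can be
cancelled in `M`. -/
lemma linearMap_ext_johnson {u v : T n →ₗ[ℤ] M} (h : ∀ x, u (johnson x) = v (johnson x)) :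
    u = v := by
  have h1 : ∀ x : IA n, u (crossed x) = v (crossed x) := fun x => by
    rw [crossed_coe, map_smul, map_smul, h]
  have h2 : ∀ i j k : Fin n, j ≠ k → j ≠ i →
      u (dualBasis i ⊗ₜ wedge n (cls (of j) ⊗ₜ cls (of k))) =
        v (dualBasis i ⊗ₜ wedge n (cls (of j) ⊗ₜ cls (of k))) := by
    intro i j k hjk hji
    apply eq_of_two_smul_eq
    rw [← map_smul, ← map_smul]
    by_cases hki : k = i
    · subst hki
      rw [← crossed_conj hji]
      exact h1 ⟨_, transv_conj_mem_IA k j⟩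
    · rw [← crossed_commutator hji hki]
      exact h1 ⟨_, transv_commutator_mem_IA i j k⟩
  have h3 : ∀ i w, u (dualBasis i ⊗ₜ w) = v (dualBasis i ⊗ₜ w) := fun i => by
    suffices h : u ∘ₗ TensorProduct.mk ℤ _ _ (dualBasis i) =
        v ∘ₗ TensorProduct.mk ℤ _ _ (dualBasis i) from fun w => DFunLike.congr_fun h w
    refine exteriorPower.linearMap_ext ((basisH n).ext_alternating fun p hp => ?_)
    change u (dualBasis i ⊗ₜ exteriorPower.ιMulti ℤ 2 fun l => basisH n (p l)) =
      v (dualBasis i ⊗ₜ exteriorPower.ιMulti ℤ 2 fun l => basisH n (p l))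
    rw [← vec_two_eta (fun l => basisH n (p l)), ← wedge_tmul, basisH_apply, basisH_apply]
    have hne : p 0 ≠ p 1 := fun h => absurd (hp h) (by decide)
    -- The formulas for `crossed` need a first vector other than `X_i`; if it is `X_i`, the wedge is
    -- swapped.
    by_cases h0 : p 0 = i
    · rw [wedge_swap, tmul_neg, map_neg, map_neg, h2 i _ _ hne.symm (h0 ▸ hne.symm)]
    · exact h2 i _ _ hne h0
  refine LinearMap.ext fun t => ?_
  induction t using TensorProduct.induction_on with
  | zero => rw [map_zero, map_zero]
  | add x y hx hy => rw [map_add, map_add, hx, hy]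
  | tmul ℓ w =>
    have h4 : ℓ = ∑ i, ℓ (cls (of i)) • dualBasis i := hom_ext fun j => by
      simp [dualBasis_cls_of]
    rw [h4, sum_tmul]
    change u.toAddMonoidHom _ = v.toAddMonoidHom _
    rw [map_sum, map_sum]
    refine Finset.sum_congr rfl fun i _ => ?_
    rw [smul_tmul]
    exact h3 i _

end

end AutFree

/-! ## The rows `q = 0, 1` of the Lyndon–Hochschild–Serre spectral sequence -/

namespace LHS

variable {k G Q : Type} [CommRing k] [Group G] [Group Q]

/-- For `p = 0` the index `p - 1` is again `0` and the differential `d 0 0` is zero, so the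
criterion then reads `f = 0`, as it should. -/
lemma π_cocyclesMk_eq_zero_iff (A : Rep.{0} k G) (p : ℕ) (f : (Fin p → G) → A)
    (hf : inhomogeneousCochains.d A p f = 0) :
    groupCohomology.π A p (groupCohomology.cocyclesMk f hf) = 0 ↔
      ∃ b : (groupCohomology.inhomogeneousCochains A).X (p - 1),
        ((groupCohomology.inhomogeneousCochains A).d (p - 1) p).hom b = f := by
  set C := groupCohomology.inhomogeneousCochains A
  have hprev : (ComplexShape.up ℕ).prev p = p - 1 := by
    cases p
    · simp
    · simp
  have hex := ShortComplex.exact_of_g_is_cokernel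
    (ShortComplex.mk (C.toCycles (p - 1) p) (C.homologyπ p) (by simp))
    (C.homologyIsCokernel (p - 1) p hprev)
  rw [ShortComplex.moduleCat_exact_iff] at hex
  have hi : Function.Injective (C.iCycles p) :=
    (ModuleCat.mono_iff_injective (C.iCycles p)).1 inferInstance
  constructor
  · intro h
    obtain ⟨b, hb⟩ := hex _ h
    refine ⟨b, ?_⟩
    have h1 := congrArg (C.iCycles p) hb
    rw [← C.toCycles_i (p - 1) p, ModuleCat.hom_comp, LinearMap.comp_apply]
    exact h1.trans (groupCohomology.iCocycles_mk f hf)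
  · rintro ⟨b, hb⟩
    have h1 : C.toCycles (p - 1) p b = groupCohomology.cocyclesMk f hf := by
      apply hi
      refine Eq.trans ?_ (groupCohomology.iCocycles_mk f hf).symm
      rw [← hb, ← C.toCycles_i (p - 1) p]
      rfl
    rw [← h1]
    have h2 := C.toCycles_comp_homologyπ (p - 1) p
    exact congrArg (fun φ => φ.hom b) h2

lemma cocyclesMk_surjective {A : Rep.{0} k G} {p : ℕ} (z : groupCohomology.cocycles A p) :
    ∃ f hf, groupCohomology.cocyclesMk f hf = z := by
  set C := groupCohomology.inhomogeneousCochains A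
  have hi : Function.Injective (C.iCycles p) :=
    (ModuleCat.mono_iff_injective (C.iCycles p)).1 inferInstance
  have hf : inhomogeneousCochains.d A p (C.iCycles p z) = 0 := by
    have h1 := C.iCycles_d p (p + 1)
    have h2 := congrArg (fun φ => φ.hom z) h1
    rw [groupCohomology.inhomogeneousCochains.d_def] at h2
    exact h2
  exact ⟨C.iCycles p z, hf, hi (groupCohomology.iCocycles_mk _ hf)⟩

/-- A linear map onto the cocycles induces an isomorphism to the cohomology. -/
lemma exists_quotient_equiv {A : Rep.{0} k G} {p : ℕ} {V : Type} [AddCommGroup V] [Module k V]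
    (B : Submodule k V) (s : V →ₗ[k] ((Fin p → G) → A))
    (hs : ∀ v, inhomogeneousCochains.d A p (s v) = 0)
    (hsurj : ∀ f, inhomogeneousCochains.d A p f = 0 → ∃ v, s v = f)
    (hB : ∀ v, v ∈ B ↔ ∃ b : (groupCohomology.inhomogeneousCochains A).X (p - 1),
      ((groupCohomology.inhomogeneousCochains A).d (p - 1) p).hom b = s v) :
    ∃ e : (V ⧸ B) ≃ₗ[k] groupCohomology A p, ∀ v,
      e (B.mkQ v) = groupCohomology.π A p (groupCohomology.cocyclesMk (s v) (hs v)) := by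
  have hi : Function.Injective (groupCohomology.iCocycles A p) :=
    (ModuleCat.mono_iff_injective (groupCohomology.iCocycles A p)).1 inferInstance
  let L : V →ₗ[k] groupCohomology A p :=
    (groupCohomology.π A p).hom ∘ₗ
      { toFun := fun v => groupCohomology.cocyclesMk (s v) (hs v)
        map_add' := fun v w => hi (by
          refine (groupCohomology.iCocycles_mk _ _).trans ?_
          rw [map_add, map_add, groupCohomology.iCocycles_mk, groupCohomology.iCocycles_mk])
        map_smul' := fun c v => hi (by
          refine (groupCohomology.iCocycles_mk _ _).trans ?_
          rw [map_smul, map_smul, groupCohomology.iCocycles_mk]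
          rfl) }
  have hL : ∀ v, L v = groupCohomology.π A p (groupCohomology.cocyclesMk (s v) (hs v)) :=
    fun _ => rfl
  have hker : LinearMap.ker L = B := by
    ext v
    rw [LinearMap.mem_ker, hL, π_cocyclesMk_eq_zero_iff, hB]
  have hLs : Function.Surjective L := fun x => by
    induction x using groupCohomology_induction_on with
    | h z =>
      obtain ⟨f, hf, rfl⟩ := cocyclesMk_surjective z
      obtain ⟨v, rfl⟩ := hsurj f hf
      exact ⟨v, rfl⟩
  subst hker
  exact ⟨L.quotKerEquivOfSurjective hLs, fun v => rfl⟩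

/-! ### Cochains -/

lemma contractNth_zero_cons {α : Type} (op : α → α → α) {m : ℕ} (a b : α) (h : Fin m → α) :
    Fin.contractNth 0 op (Fin.cons a (Fin.cons b h : Fin (m + 1) → α) : Fin (m + 2) → α) =
      (Fin.cons (op a b) h : Fin (m + 1) → α) := by
  ext i
  cases i using Fin.cases <;> simp [Fin.contractNth]

lemma contractNth_succ_cons {α : Type} (op : α → α → α) {m : ℕ} (a : α) (h : Fin (m + 1) → α)
    (i : Fin (m + 1)) :
    Fin.contractNth i.succ op (Fin.cons a h : Fin (m + 2) → α) =
      (Fin.cons a (Fin.contractNth i op h) : Fin (m + 1) → α) := by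
  ext j
  cases j using Fin.cases with
  | zero => simp [Fin.contractNth]
  | succ j => simp [Fin.contractNth, Fin.castSucc_succ] 

lemma d_cons_cons (A : Rep.{0} k G) {m : ℕ} (f : (Fin (m + 1) → G) → A) (a b : G)
    (h : Fin m → G) :
    (inhomogeneousCochains.d A (m + 1)).hom f (Fin.cons a (Fin.cons b h : Fin (m + 1) → G)) =
      A.ρ a (f (Fin.cons b h)) - f (Fin.cons (a * b) h) +
        ∑ i : Fin (m + 1), (-1 : k) ^ (i : ℕ) •
          f (Fin.cons a (Fin.contractNth i (· * ·) (Fin.cons b h : Fin (m + 1) → G))) := by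
  rw [inhomogeneousCochains.d_hom_apply, Fin.sum_univ_succ, contractNth_zero_cons, ← add_assoc]
  congr 1
  · simp [sub_eq_add_neg]
  · refine Finset.sum_congr rfl fun i _ => ?_
    rw [contractNth_succ_cons, Fin.val_succ, pow_succ, pow_succ, mul_assoc, neg_one_mul, neg_neg,
      mul_one]

lemma map_contractNth (φ : G →* Q) {m : ℕ} (i : Fin (m + 1)) (h : Fin (m + 1) → G) :
    (fun j => φ (Fin.contractNth i (· * ·) h j)) =
      Fin.contractNth i (· * ·) fun j => φ (h j) := by
  ext j
  simp only [Fin.contractNth]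
  split_ifs <;> simp

lemma map_cons (φ : G →* Q) {m : ℕ} (a : G) (h : Fin m → G) :
    (fun j => φ ((Fin.cons a h : Fin (m + 1) → G) j)) =
      (Fin.cons (φ a) fun j => φ (h j) : Fin (m + 1) → Q) := by
  ext j
  cases j using Fin.cases <;> rfl

variable (π : G →* Q)

lemma mem_F_self {A : Rep.{0} k G} {m : ℕ} {f : (Fin m → G) → A} :
    f ∈ (filtration π A).F m m ↔ ∀ g g' : Fin m → G, (∀ i, π (g i) = π (g' i)) → f g = f g' := by
  constructor
  · rintro ⟨-, h⟩ g g' hg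
    exact h g g' (fun i hi => by omega) hg
  · exact fun h => ⟨fun h => by omega, fun g g' _ hg => h g g' hg⟩

lemma mem_F_succ {A : Rep.{0} k G} {m : ℕ} {f : (Fin (m + 1) → G) → A} :
    f ∈ (filtration π A).F m (m + 1) ↔ ∀ (a : G) (h h' : Fin m → G),
      (∀ i, π (h i) = π (h' i)) → f (Fin.cons a h) = f (Fin.cons a h') := by
  constructor
  · rintro ⟨-, hf⟩ a h h' hh
    refine hf _ _ (fun i hi => ?_) fun i => ?_
    · cases i using Fin.cases with
      | zero => rfl
      | succ i => simp at hi
    · cases i using Fin.cases with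
      | zero => rfl
      | succ i => exact hh i
  · refine fun hf => ⟨fun h => by omega, fun g g' h0 hg => ?_⟩
    rw [← Fin.cons_self_tail g, ← Fin.cons_self_tail g', h0 0 (by simp)]
    exact hf _ _ _ fun i => hg i.succ

/-! ### Evaluation of classes in `H¹(ker π; M)` -/

variable (M : Rep.{0} k Q)

/-- Hence `H¹(ker π; M)` is the group of homomorphisms `ker π → M`. -/
instance : (kerRes π M).IsTrivial where
  out x := by
    have h : π (x : G) = 1 := x.2
    ext m
    simp [h]

lemma ρ_ker (x : π.ker) (m : M) : M.ρ (π (x : G)) m = m := by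
  have h : π (x : G) = 1 := x.2
  rw [h, map_one]
  rfl

variable (hπ : Function.Surjective π)

/-- The homomorphism `ker π → M` representing a class in `H¹(ker π; M)`. -/
noncomputable def evH1 : kerH1 π hπ M →ₗ[k] (Additive π.ker →+ M) :=
  (groupCohomology.H1IsoOfIsTrivial (kerRes π M)).hom.hom

lemma evH1_H1π (c : groupCohomology.cocycles₁ (kerRes π M)) (y : π.ker) :
    evH1 π M hπ (groupCohomology.H1π (kerRes π M) c) (Additive.ofMul y) = c y :=
  groupCohomology.H1IsoOfIsTrivial_H1π_apply_apply c _

lemma evH1_injective : Function.Injective (evH1 π M hπ) :=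
  (groupCohomology.H1IsoOfIsTrivial (kerRes π M)).toLinearEquiv.injective

lemma evH1_surjective : Function.Surjective (evH1 π M hπ) :=
  (groupCohomology.H1IsoOfIsTrivial (kerRes π M)).toLinearEquiv.surjective

variable {π M hπ}

lemma evH1_mul (z : kerH1 π hπ M) (x y : π.ker) : evH1 π M hπ z (Additive.ofMul (x * y)) =
    evH1 π M hπ z (Additive.ofMul x) + evH1 π M hπ z (Additive.ofMul y) :=
  map_add _ _ _

lemma exists_evH1 (f : π.ker → M) (hf : ∀ x y, f (x * y) = f x + f y) :
    ∃ z : kerH1 π hπ M, ∀ y, evH1 π M hπ z (Additive.ofMul y) = f y := by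
  obtain ⟨z, hz⟩ := evH1_surjective π M hπ (AddMonoidHom.mk' (fun x => f x.toMul) fun x y => hf _ _)
  exact ⟨z, fun y => by rw [hz]; rfl⟩

lemma evH1_ρ (z : kerH1 π hπ M) (g : G) (y : π.ker) :
    evH1 π M hπ ((kerH1 π hπ M).ρ (π g) z) (Additive.ofMul y) =
      M.ρ (π g) (evH1 π M hπ z (Additive.ofMul (kerConj π g y))) := by
  have h1 : (kerH1 π hπ M).ρ (π g) z = conjAct π M g z :=
    congrArg (fun φ => φ z) (conjAct_congr π M _ g (Function.surjInv_eq hπ _))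
  rw [h1]
  change groupCohomology (kerRes π M) 1 at z
  induction z using groupCohomology.H1_induction_on with
  | h c =>
    have h2 : conjAct π M g (groupCohomology.H1π _ c) = groupCohomology.H1π _
        (groupCohomology.mapCocycles₁ (kerConj π g) (kerCoeff π M g) c) :=
      groupCohomology.H1π_comp_map_apply (kerConj π g) (kerCoeff π M g) c
    rw [h2]
    refine (evH1_H1π π M hπ _ _).trans ?_
    refine Eq.trans ?_ (congrArg _ (evH1_H1π π M hπ _ _).symm)
    rfl

end LHS

/-! ### Symbols of cochains -/

namespace LHS

variable {k G Q : Type} [CommRing k] [Group G] [Group Q] {π : G →* Q}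
  {hπ : Function.Surjective π} {M : Rep.{0} k Q}

lemma surj_comp (hπ : Function.Surjective π) {m : ℕ} (q : Fin m → Q) :
    ∃ t : Fin m → G, (fun i => π (t i)) = q :=
  ⟨fun i => Function.surjInv hπ (q i), funext fun _ => Function.surjInv_eq hπ _⟩

lemma mem_Z_iff {A : Rep.{0} k G} {r p m : ℕ} {F : (Fin m → G) → A} :
    F ∈ (filtration π A).Z r p m ↔ F ∈ (filtration π A).F p m ∧
      (inhomogeneousCochains.d A m).hom F ∈ (filtration π A).F (p + r) (m + 1) := by
  rw [CochainFiltration.Z, Submodule.mem_inf, Submodule.mem_comap,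
    groupCohomology.inhomogeneousCochains.d_def]

/-- The cochain `F ∈ F^m C^{m+1}` has symbol `c` if `F(gy, h) = F(g, h) + g c_h(y)` for
`y ∈ ker π`. -/
structure HasSymbol (hπ : Function.Surjective π) {m : ℕ} (F : (Fin (m + 1) → G) → M)
    (c : (Fin m → Q) → kerH1 π hπ M) : Prop where
  mem : F ∈ (filtration π (Rep.res π M)).F m (m + 1)
  eq : ∀ (g : G) (y : π.ker) (h : Fin m → G), F (Fin.cons (g * (y : G)) h) =
    F (Fin.cons g h) + M.ρ (π g) (evH1 π M hπ (c fun i => π (h i)) (Additive.ofMul y))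

namespace HasSymbol

variable {m : ℕ} {F F' : (Fin (m + 1) → G) → M} {c c' : (Fin m → Q) → kerH1 π hπ M}

lemma add (h : HasSymbol hπ F c) (h' : HasSymbol hπ F' c') : HasSymbol hπ (F + F') (c + c') where
  mem := add_mem h.mem h'.mem
  eq g y t := by
    simp only [Pi.add_apply, h.eq, h'.eq, map_add, AddMonoidHom.add_apply]
    abel

lemma smul (r : k) (h : HasSymbol hπ F c) : HasSymbol hπ (r • F) (r • c) where
  mem := Submodule.smul_mem _ r h.mem
  eq g y t := by
    simp only [Pi.smul_apply, h.eq, map_smul, smul_add]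
    congr 1
    exact (map_smul (M.ρ (π g)) r _).symm

/-- At `g = 1` the symbol is read off as `c_h(y) = F(y, h) - F(1, h)`. -/
lemma unique (h : HasSymbol hπ F c) (h' : HasSymbol hπ F c') : c = c' := by
  funext q
  obtain ⟨t, rfl⟩ : ∃ t : Fin m → G, (fun i => π (t i)) = q := surj_comp hπ q
  refine evH1_injective π M hπ (AddMonoidHom.ext fun y => ?_)
  have h1 := (h.eq 1 y.toMul t).symm.trans (h'.eq 1 y.toMul t)
  rw [add_right_inj, map_one, map_one] at h1
  exact h1

lemma mem_top_of_zero (h : HasSymbol hπ F 0) :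
    F ∈ (filtration π (Rep.res π M)).F (m + 1) (m + 1) := by
  refine (mem_F_self π).2 fun g g' hg => ?_
  obtain ⟨y, hy⟩ : ∃ y : π.ker, g' 0 = g 0 * (y : G) :=
    ⟨⟨(g 0)⁻¹ * g' 0, by rw [MonoidHom.mem_ker, map_mul, map_inv, hg 0, inv_mul_cancel]⟩, by simp⟩
  rw [← Fin.cons_self_tail g, ← Fin.cons_self_tail g', hy, h.eq]
  simp only [Pi.zero_apply, map_zero, AddMonoidHom.zero_apply, add_zero]
  exact (mem_F_succ π).1 h.mem _ _ _ fun i => hg i.succ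

lemma of_mem_top (h : F ∈ (filtration π (Rep.res π M)).F (m + 1) (m + 1)) :
    HasSymbol hπ F 0 where
  mem := (filtration π (Rep.res π M)).F_anti _ _ h
  eq g y t := by
    simp only [Pi.zero_apply, map_zero, AddMonoidHom.zero_apply, add_zero]
    refine (mem_F_self π).1 h _ _ fun i => ?_
    have hy : π (y : G) = 1 := y.2
    cases i using Fin.cases <;> simp [hy]

lemma eq_congr (h : HasSymbol hπ F c) (a : G) {t t' : Fin m → G} (ht : ∀ i, π (t i) = π (t' i)) :
    F (Fin.cons a t) = F (Fin.cons a t') :=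
  (mem_F_succ π).1 h.mem a t t' ht

end HasSymbol

lemma d_cons (N : Rep.{0} k Q) {m : ℕ} (c : (Fin m → Q) → N) (q : Q) (t : Fin m → Q) :
    (inhomogeneousCochains.d N m).hom c (Fin.cons q t) = N.ρ q (c t) +
      ∑ i : Fin (m + 1), (-1 : k) ^ ((i : ℕ) + 1) •
        c (Fin.contractNth i (· * ·) (Fin.cons q t : Fin (m + 1) → Q)) :=
  rfl

lemma contractNth_map_eq {m : ℕ} (i : Fin (m + 1)) {h h' : Fin (m + 1) → G}
    (hh : ∀ j, π (h j) = π (h' j)) (j : Fin m) :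
    π (Fin.contractNth i (· * ·) h j) = π (Fin.contractNth i (· * ·) h' j) := by
  have h1 := congrFun (map_contractNth π i h) j
  have h2 := congrFun (map_contractNth π i h') j
  rw [h1, h2, funext hh]

lemma cons_map_eq {m : ℕ} {a a' : G} (ha : π a = π a') {t t' : Fin m → G}
    (ht : ∀ i, π (t i) = π (t' i)) (j : Fin (m + 1)) :
    π ((Fin.cons a t : Fin (m + 1) → G) j) = π ((Fin.cons a' t' : Fin (m + 1) → G) j) := by
  cases j using Fin.cases
  · exact ha
  · exact ht _

lemma exists_mul_ker {a a' : G} (h : π a = π a') : ∃ y : π.ker, a' = a * (y : G) :=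
  ⟨⟨a⁻¹ * a', by rw [MonoidHom.mem_ker, map_mul, map_inv, h, inv_mul_cancel]⟩, by simp⟩

lemma d_res_cons_cons {m : ℕ} (F : (Fin (m + 1) → G) → M) (a b : G) (h : Fin m → G) :
    (inhomogeneousCochains.d (Rep.res π M) (m + 1)).hom F
        (Fin.cons a (Fin.cons b h : Fin (m + 1) → G)) =
      M.ρ (π a) (F (Fin.cons b h)) - F (Fin.cons (a * b) h) +
        ∑ i : Fin (m + 1), (-1 : k) ^ (i : ℕ) •
          F (Fin.cons a (Fin.contractNth i (· * ·) (Fin.cons b h : Fin (m + 1) → G))) :=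
  d_cons_cons (Rep.res π M) F a b h

/-- Moving `y` past the next argument `b` replaces it by `b⁻¹ y b`, which is the action of `b` on
`H¹(ker π; M)`; the remaining terms complete the coboundary of `c`. The sign appears because the
variables of `c` sit one place later among those of `F`. -/
lemma HasSymbol.d {m : ℕ} {F : (Fin (m + 1) → G) → M} {c : (Fin m → Q) → kerH1 π hπ M}
    (h : HasSymbol hπ F c) :
    HasSymbol hπ (m := m + 1) ((inhomogeneousCochains.d (Rep.res π M) (m + 1)).hom F)
      (-(inhomogeneousCochains.d (kerH1 π hπ M) m).hom c) where
  mem := by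
    refine (mem_F_succ π).2 fun a s s' hs => ?_
    obtain ⟨b, t, rfl⟩ : ∃ b t, s = Fin.cons b t := ⟨_, _, (Fin.cons_self_tail s).symm⟩
    obtain ⟨b', t', rfl⟩ : ∃ b t, s' = Fin.cons b t := ⟨_, _, (Fin.cons_self_tail s').symm⟩
    have ht : ∀ i, π (t i) = π (t' i) := fun i => hs i.succ
    obtain ⟨y, rfl⟩ := exists_mul_ker (hs 0)
    rw [Fin.cons_zero] at hs ⊢
    rw [d_res_cons_cons, d_res_cons_cons, ← mul_assoc, h.eq, h.eq, h.eq_congr b ht,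
      h.eq_congr (a * b) ht, map_add, map_mul π a b, map_mul, Module.End.mul_apply]
    rw [add_sub_add_right_eq_sub]
    congr 1
    refine Finset.sum_congr rfl fun i _ => ?_
    rw [h.eq_congr a (contractNth_map_eq i hs)]
  eq g y s := by
    obtain ⟨b, t, rfl⟩ : ∃ b t, s = Fin.cons b t := ⟨_, _, (Fin.cons_self_tail s).symm⟩
    have hy : π (y : G) = 1 := y.2
    have hyb : g * (y : G) * b = g * b * (kerConj π b y : G) := by
      rw [kerConj_coe]
      group
    rw [d_res_cons_cons, d_res_cons_cons, hyb, h.eq, map_mul π g y, hy, mul_one, map_cons,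
      Pi.neg_apply, d_cons, map_neg, map_add, map_sum, AddMonoidHom.neg_apply,
      AddMonoidHom.add_apply, evH1_ρ, map_mul π g b, map_mul, Module.End.mul_apply, map_neg,
      map_add, AddMonoidHom.finsetSum_apply, map_sum]
    have h1 : ∀ i : Fin (m + 1), (-1 : k) ^ (i : ℕ) • F (Fin.cons (g * (y : G))
        (Fin.contractNth i (· * ·) (Fin.cons b t : Fin (m + 1) → G))) =
        (-1 : k) ^ (i : ℕ) • F (Fin.cons g
          (Fin.contractNth i (· * ·) (Fin.cons b t : Fin (m + 1) → G))) -
        M.ρ (π g) (evH1 π M hπ ((-1 : k) ^ ((i : ℕ) + 1) • c (Fin.contractNth i (· * ·)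
          (Fin.cons (π b) fun j => π (t j) : Fin (m + 1) → Q))) (Additive.ofMul y)) := by
      intro i
      rw [h.eq, map_contractNth, map_cons, pow_succ, mul_neg_one, neg_smul, map_neg,
        AddMonoidHom.neg_apply, map_neg, sub_neg_eq_add, map_smul, smul_add]
      congr 1
      exact (map_smul (M.ρ (π g)) _ _).symm
    rw [Finset.sum_congr rfl fun i _ => h1 i, Finset.sum_sub_distrib]
    abel

/-- The coboundary of `F` does not distinguish `(g, y, t)` from `(g, 1, t)`. Comparing the two
values shows that `y ↦ F(y, t) - F(1, t)` governs the change of `F` along `g · ker π`, and then that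
it is a homomorphism. -/
lemma exists_hasSymbol {m : ℕ} {F : (Fin (m + 1) → G) → M}
    (hF : F ∈ (filtration π (Rep.res π M)).Z 1 m (m + 1)) :
    ∃ c : (Fin m → Q) → kerH1 π hπ M, HasSymbol hπ F c := by
  obtain ⟨hF1, hF2⟩ := mem_Z_iff.1 hF
  have h1 := (mem_F_succ π).1 hF1
  have key : ∀ (g : G) (y : π.ker) (t : Fin m → G), F (Fin.cons (g * (y : G)) t) =
      F (Fin.cons g t) + M.ρ (π g) (F (Fin.cons (y : G) t) - F (Fin.cons 1 t)) := by
    intro g y t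
    have hy : π (y : G) = π 1 := by rw [map_one]; exact y.2
    have h2 := (mem_F_succ π).1 hF2 g (Fin.cons (y : G) t) (Fin.cons 1 t)
      (cons_map_eq hy fun _ => rfl)
    have h3 := (d_res_cons_cons F g (y : G) t).symm.trans (h2.trans (d_res_cons_cons F g 1 t))
    have h4 : ∀ i : Fin (m + 1), F (Fin.cons g (Fin.contractNth i (· * ·)
        (Fin.cons (y : G) t : Fin (m + 1) → G))) = F (Fin.cons g (Fin.contractNth i (· * ·)
        (Fin.cons 1 t : Fin (m + 1) → G))) := fun i =>
      h1 g _ _ (contractNth_map_eq i (cons_map_eq hy fun _ => rfl))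
    simp only [h4, add_left_inj, mul_one] at h3
    rw [map_sub]
    rw [sub_eq_sub_iff_add_eq_add] at h3
    rw [← sub_eq_zero] at h3 ⊢
    rw [← neg_eq_zero, ← h3]
    abel
  have hev : ∀ t : Fin m → G, ∃ z : kerH1 π hπ M, ∀ y : π.ker,
      evH1 π M hπ z (Additive.ofMul y) = F (Fin.cons (y : G) t) - F (Fin.cons 1 t) := fun t =>
    exists_evH1 _ fun x y => by
      have hx : π (x : G) = 1 := x.2
      rw [Subgroup.coe_mul, key, hx, map_one, Module.End.one_apply]
      abel
  choose z hz using hev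
  refine ⟨fun q => z fun i => Function.surjInv hπ (q i), hF1, fun g y t => ?_⟩
  have h2 : ∀ i, π (Function.surjInv hπ (π (t i))) = π (t i) := fun i => Function.surjInv_eq hπ _
  rw [hz, key, h1 y _ _ h2, h1 1 _ _ h2]

/-- With a set-theoretic section `σ` of `π`, take `F(g, h)` to be `π g` applied to the value of
`c_h` at `σ(π g)⁻¹ g`. -/
lemma exists_of_symbol {m : ℕ} (c : (Fin m → Q) → kerH1 π hπ M) :
    ∃ F : (Fin (m + 1) → G) → M, HasSymbol hπ F c := by
  have hσ : ∀ g : G, (Function.surjInv hπ (π g))⁻¹ * g ∈ π.ker := fun g => by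
    rw [MonoidHom.mem_ker, map_mul, map_inv, Function.surjInv_eq hπ, inv_mul_cancel]
  refine ⟨fun t => M.ρ (π (t 0)) (evH1 π M hπ (c fun i => π (t i.succ))
    (Additive.ofMul ⟨_, hσ (t 0)⟩)), ?_, fun g y t => ?_⟩
  · refine (mem_F_succ π).2 fun a h h' hh => ?_
    simp only [Fin.cons_succ, hh]
    rfl
  · have hy : π (g * (y : G)) = π g := by
      rw [map_mul, show π (y : G) = 1 from y.2, mul_one]
    have h1 : (⟨_, hσ (g * (y : G))⟩ : π.ker) = ⟨_, hσ g⟩ * y := Subtype.ext (by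
      change (Function.surjInv hπ (π (g * (y : G))))⁻¹ * (g * (y : G)) = _ * (y : G)
      rw [hy, mul_assoc])
    change M.ρ (π (g * (y : G))) (evH1 π M hπ (c fun i => π (t i))
      (Additive.ofMul ⟨_, hσ (g * (y : G))⟩)) = M.ρ (π g) (evH1 π M hπ (c fun i => π (t i))
      (Additive.ofMul ⟨_, hσ g⟩)) + _
    rw [h1, evH1_mul, map_add, hy]

/-- For the coboundary of `F`, lying one filtration step deeper means having zero symbol. -/
lemma HasSymbol.mem_Z_two_iff {m : ℕ} {F : (Fin (m + 1) → G) → M}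
    {c : (Fin m → Q) → kerH1 π hπ M} (h : HasSymbol hπ F c) :
    F ∈ (filtration π (Rep.res π M)).Z 2 m (m + 1) ↔
      (inhomogeneousCochains.d (kerH1 π hπ M) m).hom c = 0 := by
  rw [mem_Z_iff]
  constructor
  · rintro ⟨-, hF⟩
    have h1 := h.d.unique (HasSymbol.of_mem_top hF)
    exact neg_eq_zero.1 h1
  · intro hc
    refine ⟨h.mem, ?_⟩
    have h1 := h.d
    rw [hc, neg_zero] at h1
    exact h1.mem_top_of_zero

end LHS

/-! ### The edge identifications -/

namespace LHS

variable {k G Q : Type} [CommRing k] [Group G] [Group Q] {π : G →* Q}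
  {hπ : Function.Surjective π} {M : Rep.{0} k Q}

lemma d_zero_mem (w : (Fin 0 → G) → M) :
    (inhomogeneousCochains.d (Rep.res π M) 0).hom w ∈ (filtration π (Rep.res π M)).F 1 1 := by
  refine (mem_F_self π).2 fun g g' hg => ?_
  rw [inhomogeneousCochains.d_hom_apply, inhomogeneousCochains.d_hom_apply]
  congr 1
  · change M.ρ (π (g 0)) _ = M.ρ (π (g' 0)) _
    rw [hg 0]
    congr 2
    exact Subsingleton.elim _ _
  · refine Finset.sum_congr rfl fun i _ => ?_
    congr 2
    exact Subsingleton.elim _ _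

/-- The summand `Z_1` of `B_2` has symbol zero, and the coboundary of a cochain with symbol `b` has
symbol `-db`. Conversely, if `c = db`, adding such a coboundary kills the symbol. For `p = 0` only
coboundaries of elements of `M` occur, and these have symbol zero. -/
lemma HasSymbol.mem_B_two_iff {p : ℕ} {F : (Fin (p + 1) → G) → M}
    {c : (Fin p → Q) → kerH1 π hπ M} (h : HasSymbol hπ F c)
    (hF : F ∈ (filtration π (Rep.res π M)).Z 2 p (p + 1)) :
    F ∈ (filtration π (Rep.res π M)).B 2 p (p + 1) ↔
      ∃ b : (groupCohomology.inhomogeneousCochains (kerH1 π hπ M)).X (p - 1),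
        ((groupCohomology.inhomogeneousCochains (kerH1 π hπ M)).d (p - 1) p).hom b = c := by
  have hZ : ∀ {F' : (Fin (p + 1) → G) → M},
      (inhomogeneousCochains.d (Rep.res π M) (p + 1)).hom F' =
        (inhomogeneousCochains.d (Rep.res π M) (p + 1)).hom F → HasSymbol hπ F' 0 →
      F' ∈ (filtration π (Rep.res π M)).Z 1 (p + 1) (p + 1) := fun h1 h2 =>
    mem_Z_iff.2 ⟨h2.mem_top_of_zero, h1 ▸ (mem_Z_iff.1 hF).2⟩
  cases p with
  | zero =>
    have hd : (groupCohomology.inhomogeneousCochains (kerH1 π hπ M)).d (0 - 1) 0 = 0 :=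
      HomologicalComplex.shape _ _ _ (by simp)
    rw [hd]
    constructor
    · intro hB
      obtain ⟨z, hz, _, ⟨-, w, -, rfl⟩, rfl⟩ := Submodule.mem_sup.1 hB
      have hz' : HasSymbol hπ z 0 := HasSymbol.of_mem_top (mem_Z_iff.1 hz).1
      have hw := HasSymbol.of_mem_top (hπ := hπ) (d_zero_mem (π := π) (M := M) w)
      have hw' : HasSymbol hπ (((groupCohomology.inhomogeneousCochains (Rep.res π M)).d
          (0 + 1 - 1) (0 + 1)).hom w) 0 := by
        change HasSymbol hπ (((groupCohomology.inhomogeneousCochains (Rep.res π M)).d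
          0 (0 + 1)).hom w) 0
        rw [groupCohomology.inhomogeneousCochains.d_def]
        exact hw
      exact ⟨0, (map_zero _).trans ((add_zero 0).symm.trans ((hz'.add hw').unique h))⟩
    · rintro ⟨b, hb⟩
      have hc : c = 0 := hb.symm
      subst hc
      exact Submodule.mem_sup_left (hZ rfl h)
  | succ m =>
    change _ ↔ ∃ b : (Fin m → Q) → kerH1 π hπ M,
      ((groupCohomology.inhomogeneousCochains (kerH1 π hπ M)).d m (m + 1)).hom b = c
    rw [groupCohomology.inhomogeneousCochains.d_def]
    constructor
    · intro hB
      obtain ⟨z, hz, _, ⟨hw1, w, hw, rfl⟩, rfl⟩ := Submodule.mem_sup.1 hB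
      have hz' : HasSymbol hπ z 0 := HasSymbol.of_mem_top (mem_Z_iff.1 hz).1
      change (Fin (m + 1) → G) → M at w
      change w ∈ (filtration π (Rep.res π M)).F m (m + 1) at hw
      change ((groupCohomology.inhomogeneousCochains (Rep.res π M)).d (m + 1) (m + 1 + 1)).hom w ∈
        (filtration π (Rep.res π M)).F (m + 1) (m + 1 + 1) at hw1
      change HasSymbol hπ (z + ((groupCohomology.inhomogeneousCochains (Rep.res π M)).d
        (m + 1) (m + 1 + 1)).hom w) c at h
      rw [groupCohomology.inhomogeneousCochains.d_def] at hw1 h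
      obtain ⟨b, hb⟩ := exists_hasSymbol (hπ := hπ) (mem_Z_iff.2 ⟨hw, hw1⟩)
      have h1 := (hz'.add hb.d).unique h
      rw [zero_add] at h1
      refine ⟨-b, ?_⟩
      rw [← h1]
      exact map_neg _ b
    · rintro ⟨b, hb⟩
      obtain ⟨w, hw⟩ := exists_of_symbol (hπ := hπ) b
      have hw' := hw.d
      have h1 := h.add hw'
      have hb' : c + -(inhomogeneousCochains.d (kerH1 π hπ M) m).hom b = 0 := by
        rw [← hb]
        exact add_neg_cancel _
      rw [hb'] at h1
      have h2 : (inhomogeneousCochains.d (Rep.res π M) (m + 1 + 1)).hom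
          ((inhomogeneousCochains.d (Rep.res π M) (m + 1)).hom w) = 0 := by
        have := groupCohomology.inhomogeneousCochains.d_comp_d (Rep.res π M) (n := m + 1)
        exact congrArg (fun φ => φ.hom w) this
      have h3 := hZ (by rw [map_add, h2, add_zero]) h1
      have h4 : F = (F + (inhomogeneousCochains.d (Rep.res π M) (m + 1)).hom w) +
          (inhomogeneousCochains.d (Rep.res π M) (m + 1)).hom (-w) := by
        rw [map_neg, add_neg_cancel_right]
      rw [h4]
      refine Submodule.add_mem_sup h3 ⟨?_, -w, ?_, ?_⟩
      · rw [map_neg]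
        exact neg_mem hw'.mem
      · exact neg_mem hw.mem
      · change ((groupCohomology.inhomogeneousCochains (Rep.res π M)).d
          (m + 1) (m + 1 + 1)).hom _ = _
        rw [groupCohomology.inhomogeneousCochains.d_def]

/-- The identification of `E_2^{p,1}`, with its value on cochains with a given symbol. -/
theorem exists_edgeOne (π : G →* Q) (hπ : Function.Surjective π) (M : Rep.{0} k Q) (p : ℕ) :
    ∃ e : E π M 2 p (p + 1) ≃ₗ[k] groupCohomology (kerH1 π hπ M) p, IsEdgeOne π hπ M p e ∧
      ∀ F hF c hc, HasSymbol hπ F c → e (E.mk π M 2 p (p + 1) ⟨F, hF⟩) =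
        groupCohomology.π (kerH1 π hπ M) p (groupCohomology.cocyclesMk c hc) := by
  have hex : ∀ v : (filtration π (Rep.res π M)).Z 2 p (p + 1),
      ∃ c : (Fin p → Q) → kerH1 π hπ M, HasSymbol hπ (v : (Fin (p + 1) → G) → M) c := fun v => by
    obtain ⟨h1, h2⟩ := mem_Z_iff.1 v.2
    exact exists_hasSymbol (mem_Z_iff.2 ⟨h1, (filtration π (Rep.res π M)).F_anti _ _ h2⟩)
  choose s hs using hex
  obtain ⟨e, he⟩ := exists_quotient_equiv
    (((filtration π (Rep.res π M)).B 2 p (p + 1)).submoduleOf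
      ((filtration π (Rep.res π M)).Z 2 p (p + 1)))
    { toFun := s
      map_add' := fun v w => (hs (v + w)).unique ((hs v).add (hs w))
      map_smul' := fun r v => (hs (r • v)).unique ((hs v).smul r) }
    (fun v => (hs v).mem_Z_two_iff.1 v.2)
    (fun f hf => by
      obtain ⟨F, hF⟩ := exists_of_symbol (hπ := hπ) f
      exact ⟨⟨F, hF.mem_Z_two_iff.2 hf⟩, (hs _).unique hF⟩)
    (fun v => (hs v).mem_B_two_iff v.2)
  have key : ∀ F hF c hc, HasSymbol hπ F c → e (E.mk π M 2 p (p + 1) ⟨F, hF⟩) =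
      groupCohomology.π (kerH1 π hπ M) p (groupCohomology.cocyclesMk c hc) := by
    intro F hF c hc h
    have h1 := (hs ⟨F, hF⟩).unique h
    subst h1
    exact he ⟨F, hF⟩
  refine ⟨e, fun F hF f hf hcond => ?_, key⟩
  have h1 := hs ⟨F, hF⟩
  suffices h2 : s ⟨F, hF⟩ = f by
    rw [h2] at h1
    exact key F hF f hf h1
  funext q
  obtain ⟨t, rfl⟩ : ∃ t : Fin p → G, (fun i => π (t i)) = q := surj_comp hπ q
  obtain ⟨c, hc, hfc⟩ := hcond t
  refine evH1_injective π M hπ (AddMonoidHom.ext fun y => ?_)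
  have h2 := h1.eq 1 y.toMul t
  rw [hfc]
  refine Eq.trans ?_ ((evH1_H1π π M hπ c y.toMul).trans (hc _)).symm
  rw [one_mul, map_one, map_one] at h2
  exact (sub_eq_of_eq_add' h2).symm

lemma d_inflation {m : ℕ} (f : (Fin m → Q) → M) (g : Fin (m + 1) → G) :
    (inhomogeneousCochains.d (Rep.res π M) m).hom (fun g : Fin m → G => f fun i => π (g i)) g =
      (inhomogeneousCochains.d M m).hom f fun i => π (g i) := by
  rw [inhomogeneousCochains.d_hom_apply, inhomogeneousCochains.d_hom_apply]
  congr 1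
  refine Finset.sum_congr rfl fun i _ => ?_
  rw [map_contractNth]

/-- The identification of `E_2^{p+2,0}`. -/
theorem exists_edgeZero (π : G →* Q) (hπ : Function.Surjective π) (M : Rep.{0} k Q) (p : ℕ) :
    ∃ e : E π M 2 (p + 2) (p + 2) ≃ₗ[k] groupCohomology M (p + 2), IsEdgeZero π M (p + 2) e := by
  let s {m : ℕ} : ((Fin m → G) → M) →ₗ[k] ((Fin m → Q) → M) :=
    LinearMap.funLeft k M fun q i => Function.surjInv hπ (q i)
  have hs : ∀ {m : ℕ} {F : (Fin m → G) → M}, F ∈ (filtration π (Rep.res π M)).F m m →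
      (fun g : Fin m → G => s F fun i => π (g i)) = F := fun hF => funext fun g =>
    (mem_F_self π).1 hF _ _ fun i => Function.surjInv_eq hπ _
  have hs' : ∀ {m : ℕ} (f : (Fin m → Q) → M), s (fun g : Fin m → G => f fun i => π (g i)) = f :=
    fun f => funext fun q => congrArg f (funext fun i => Function.surjInv_eq hπ _)
  have hinfl : ∀ {m : ℕ} (f : (Fin m → Q) → M),
      (fun g : Fin m → G => f fun i => π (g i)) ∈ (filtration π (Rep.res π M)).F m m := fun f =>
    (mem_F_self π).2 fun g g' hg => congrArg f (funext hg)
  have hd : ∀ {m : ℕ} {F : (Fin m → G) → M}, F ∈ (filtration π (Rep.res π M)).F m m →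
      s ((inhomogeneousCochains.d (Rep.res π M) m).hom F) =
        (inhomogeneousCochains.d M m).hom (s F) := fun {m F} hF => by
    conv_lhs => rw [← hs hF]
    rw [show (inhomogeneousCochains.d (Rep.res π M) m).hom
      (fun g : Fin m → G => s F fun i => π (g i)) = fun g : Fin (m + 1) → G =>
        (inhomogeneousCochains.d M m).hom (s F) fun i => π (g i) from funext (d_inflation _), hs']
  -- Filtration degree `p + 4` is zero on cochains of degree `p + 3`, so `Z_2` consists of cocycles.
  have hZ : ∀ {F : (Fin (p + 2) → G) → M}, F ∈ (filtration π (Rep.res π M)).Z 2 (p + 2) (p + 2) ↔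
      F ∈ (filtration π (Rep.res π M)).F (p + 2) (p + 2) ∧
        (inhomogeneousCochains.d (Rep.res π M) (p + 2)).hom F = 0 := by
    intro F
    rw [mem_Z_iff]
    refine and_congr_right fun _ => ⟨fun h => h.1 (by omega), fun h => ?_⟩
    rw [h]
    exact zero_mem _
  obtain ⟨e, he⟩ := exists_quotient_equiv
    (((filtration π (Rep.res π M)).B 2 (p + 2) (p + 2)).submoduleOf
      ((filtration π (Rep.res π M)).Z 2 (p + 2) (p + 2)))
    (s ∘ₗ ((filtration π (Rep.res π M)).Z 2 (p + 2) (p + 2)).subtype)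
    (fun v => by
      obtain ⟨h1, h2⟩ := hZ.1 v.2
      refine (hd h1).symm.trans ?_
      rw [h2, map_zero])
    (fun f hf => by
      refine ⟨⟨fun g : Fin (p + 2) → G => f fun i => π (g i), hZ.2 ⟨hinfl f, ?_⟩⟩, hs' f⟩
      refine (funext (d_inflation f)).trans ?_
      funext g
      exact congrFun hf _)
    (fun v => by
      obtain ⟨h1, -⟩ := hZ.1 v.2
      obtain ⟨F, hF⟩ := v
      change F ∈ (filtration π (Rep.res π M)).B 2 (p + 2) (p + 2) ↔
        ∃ b : (Fin (p + 1) → Q) → M,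
          ((groupCohomology.inhomogeneousCochains M).d (p + 1) (p + 1 + 1)).hom b = s F
      rw [groupCohomology.inhomogeneousCochains.d_def]
      constructor
      · intro hB
        obtain ⟨z, hz, _, ⟨-, w, hw, rfl⟩, rfl⟩ := Submodule.mem_sup.1 hB
        have hz0 : z = 0 := (mem_Z_iff.1 hz).1.1 (by omega)
        change w ∈ (filtration π (Rep.res π M)).F (p + 1) (p + 1) at hw
        refine ⟨s w, ?_⟩
        rw [hz0, zero_add]
        refine (hd hw).symm.trans ?_
        change _ = s (((groupCohomology.inhomogeneousCochains (Rep.res π M)).d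
          (p + 1) (p + 1 + 1)).hom w)
        rw [groupCohomology.inhomogeneousCochains.d_def]
      · rintro ⟨b, hb⟩
        refine Submodule.mem_sup_right ⟨h1, _, hinfl b, ?_⟩
        change ((groupCohomology.inhomogeneousCochains (Rep.res π M)).d
          (p + 1) (p + 1 + 1)).hom _ = _
        rw [groupCohomology.inhomogeneousCochains.d_def]
        refine (funext (d_inflation b)).trans ?_
        rw [hb]
        exact hs h1)
  refine ⟨e, fun f hf hF => ?_⟩
  refine (he ⟨_, hF⟩).trans ?_
  congr 2
  exact hs' f

/-- If the homomorphisms `ker π → M` extend to `G` as crossed homomorphisms, equivariantly, then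
the differentials `d_2^{p,1}` vanish. -/
theorem d_two_eq_zero (hπ : Function.Surjective π) (X : kerH1 π hπ M →ₗ[k] (G → M))
    (hX : ∀ z g g', X z (g * g') =
      X z g + M.ρ (π g) (X ((kerH1 π hπ M).ρ (π g)⁻¹ z) g'))
    (hX' : ∀ z (y : π.ker), X z (y : G) = evH1 π M hπ z (Additive.ofMul y)) (p : ℕ) :
    d π M 2 p (p + 1) = 0 := by
  obtain ⟨e, -, he⟩ := exists_edgeOne π hπ M p
  have hρ : ∀ (q : Q) (z : kerH1 π hπ M), (kerH1 π hπ M).ρ q⁻¹ ((kerH1 π hπ M).ρ q z) = z :=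
    fun q z => by
      rw [← Module.End.mul_apply, ← map_mul, inv_mul_cancel, map_one, Module.End.one_apply]
  refine LinearMap.ext fun x => ?_
  obtain ⟨w, rfl⟩ := e.symm.surjective x
  induction w using groupCohomology_induction_on with
  | h z =>
    obtain ⟨c, hc, rfl⟩ := cocyclesMk_surjective z
    -- The extension of the class `π (t 0) · c` is evaluated at `t 0`. The result has symbol `c`,
    -- and by `hX` its coboundary is, up to sign, the coboundary of `c` passed through `X` in the
    -- same way, hence zero.
    let F : (Fin (p + 1) → G) → M := fun t =>
      X ((kerH1 π hπ M).ρ (π (t 0)) (c fun i => π (t i.succ))) (t 0)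
    have hFcons : ∀ a h, F (Fin.cons a h) =
        X ((kerH1 π hπ M).ρ (π a) (c fun i => π (h i))) a := fun a h => rfl
    have hF : HasSymbol hπ F c :=
      ⟨(mem_F_succ π).2 fun a h h' hh => by rw [hFcons, hFcons, funext hh], fun g y h => by
        have hy : π (y : G) = 1 := y.2
        rw [hFcons, hFcons, hX, map_mul π g y, hy, mul_one, hρ, hX']⟩
    have hdF : (inhomogeneousCochains.d (Rep.res π M) (p + 1)).hom F = 0 := by
      funext t
      obtain ⟨a, t, rfl⟩ : ∃ a t', t = Fin.cons a t' := ⟨_, _, (Fin.cons_self_tail t).symm⟩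
      obtain ⟨b, t, rfl⟩ : ∃ b t', t = Fin.cons b t' := ⟨_, _, (Fin.cons_self_tail t).symm⟩
      have h1 : ∀ i : Fin (p + 1), (-1 : k) ^ (i : ℕ) • F (Fin.cons a
          (Fin.contractNth i (· * ·) (Fin.cons b t : Fin (p + 1) → G))) =
          -X ((kerH1 π hπ M).ρ (π a) ((-1 : k) ^ ((i : ℕ) + 1) • c (Fin.contractNth i (· * ·)
            (Fin.cons (π b) fun j => π (t j) : Fin (p + 1) → Q)))) a := by
        intro i
        rw [hFcons, map_contractNth, map_cons, pow_succ, mul_neg_one, neg_smul, map_neg, map_neg,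
          Pi.neg_apply, neg_neg, map_smul, map_smul, Pi.smul_apply]
      have h2 : (kerH1 π hπ M).ρ (π b) (c fun i => π (t i)) +
          ∑ i : Fin (p + 1), (-1 : k) ^ ((i : ℕ) + 1) • c (Fin.contractNth i (· * ·)
            (Fin.cons (π b) fun j => π (t j) : Fin (p + 1) → Q)) = 0 :=
        (d_cons (kerH1 π hπ M) c (π b) fun j => π (t j)).symm.trans (congrFun hc _)
      rw [d_res_cons_cons, Finset.sum_congr rfl fun i _ => h1 i, Finset.sum_neg_distrib,
        ← Finset.sum_apply, ← map_sum, ← map_sum, eq_neg_of_add_eq_zero_right h2, hFcons, hFcons,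
        hX, map_mul π a b, map_mul, Module.End.mul_apply, hρ, map_neg, map_neg, Pi.neg_apply]
      rw [Pi.zero_apply]
      abel
    have hFZ := hF.mem_Z_two_iff.2 hc
    have hx : e.symm (groupCohomology.π (kerH1 π hπ M) p (groupCohomology.cocyclesMk c hc)) =
        E.mk π M 2 p (p + 1) ⟨F, hFZ⟩ := by
      rw [LinearEquiv.symm_apply_eq]
      exact (he F hFZ c hc hF).symm
    rw [hx]
    change E.mk π M 2 (p + 2) (p + 1 + 1)
      ((filtration π (Rep.res π M)).dZ 2 p (p + 1) ⟨F, hFZ⟩) = 0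
    have h0 : (filtration π (Rep.res π M)).dZ 2 p (p + 1) ⟨F, hFZ⟩ = 0 := by
      refine Subtype.ext ?_
      change ((groupCohomology.inhomogeneousCochains (Rep.res π M)).d (p + 1)
        (p + 1 + 1)).hom F = 0
      rw [groupCohomology.inhomogeneousCochains.d_def]
      exact hdF
    rw [h0, map_zero]

end LHS

/-! ## The cohomology of `Γ` -/

namespace AutFree

variable {n : ℕ}

lemma crossed_conj_IA (φ : MulAut (F n)) (x : IA n) :
    crossed (φ * (x : MulAut (F n)) * φ⁻¹) = repT n (abs n φ) (crossed (x : MulAut (F n))) := by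
  have hx : abs n (x : MulAut (F n)) = 1 := x.2
  have h1 := crossed_mul φ φ⁻¹
  rw [mul_inv_cancel, crossed_one] at h1
  rw [crossed_mul, crossed_mul, map_mul, hx, mul_one, add_right_comm, ← h1, zero_add]

/-- Equivariance of `τ₁` as seen by `u`. It is inherited from the crossed homomorphism, which gives
twice the identity. -/
lemma johnson_conj_apply {M : Type*} [AddCommGroup M] [Module ZHalf M] (u : T n →ₗ[ℤ] M)
    (φ : MulAut (F n)) (x : IA n) (h : φ * (x : MulAut (F n)) * φ⁻¹ ∈ IA n) :
    u (repT n (abs n φ) (johnson x)) = u (johnson ⟨φ * x * φ⁻¹, h⟩) := by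
  apply eq_of_two_smul_eq
  rw [← map_smul, ← map_smul, ← map_smul, ← crossed_coe, ← crossed_coe, crossed_conj_IA φ x]

lemma extJohnson_add {M : Type*} [AddCommGroup M] [Module ZHalf M] (u v : T n →ₗ[ℤ] M)
    (φ : MulAut (F n)) : extJohnson (u + v) φ = extJohnson u φ + extJohnson v φ :=
  smul_add _ _ _

lemma extJohnson_smul {M : Type*} [AddCommGroup M] [Module ZHalf M] (r : ZHalf) (u : T n →ₗ[ℤ] M)
    (φ : MulAut (F n)) : extJohnson (r • u) φ = r • extJohnson u φ :=
  smul_comm _ _ _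

lemma extJohnson_mul {M : Type*} [AddCommGroup M] [Module ZHalf M] (u : T n →ₗ[ℤ] M)
    (φ ψ : MulAut (F n)) : extJohnson u (φ * ψ) =
      extJohnson u φ + extJohnson (u ∘ₗ repT n (abs n φ)) ψ := by
  rw [extJohnson, crossed_mul, map_add, smul_add]
  rfl

variable {S : Subgroup (LinearMap.GeneralLinearGroup ℤ (H n))}

/-- The action of an element of `Γ̄` on the coefficients, as a homomorphism of abelian groups. -/
def actInt (M : Rep.{0} ZHalf S) (A : S) : M →ₗ[ℤ] M := (M.ρ A).toAddMonoidHom.toIntLinearMap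

lemma extJohnson_actInt (M : Rep.{0} ZHalf S) (A : S) (u : T n →ₗ[ℤ] M) (φ : MulAut (F n)) :
    extJohnson (actInt M A ∘ₗ u) φ = M.ρ A (extJohnson u φ) :=
  (map_smul (M.ρ A) half (u (crossed φ))).symm

lemma coe_conj_mem_IA (g : preimage S) (x : (proj S).ker) :
    (g : MulAut (F n)) * (kerEquivIA S x : MulAut (F n)) * (g : MulAut (F n))⁻¹ ∈ IA n :=
  (inferInstance : (IA n).Normal).conj_mem _ (kerEquivIA S x).2 _

/-- The linear map attached to each class is merely chosen; linearity in the class follows from its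
uniqueness. -/
lemma exists_classifying (M : Rep.{0} ZHalf S) :
    ∃ U : LHS.kerH1 (proj S) (proj_surjective S) M →ₗ[ZHalf] (T n →ₗ[ℤ] M), ∀ z y,
      U z (johnson (kerEquivIA S y)) =
        LHS.evH1 (proj S) M (proj_surjective S) z (Additive.ofMul y) := by
  have h1 : ∀ z : LHS.kerH1 (proj S) (proj_surjective S) M, ∃ u : T n →ₗ[ℤ] M, ∀ y,
      u (johnson (kerEquivIA S y)) =
        LHS.evH1 (proj S) M (proj_surjective S) z (Additive.ofMul y) := fun z => by
    obtain ⟨u, hu⟩ := exists_linearMap_johnson (fun x : IA n =>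
      LHS.evH1 (proj S) M (proj_surjective S) z (Additive.ofMul ((kerEquivIA S).symm x)))
      fun x y => by rw [map_mul, LHS.evH1_mul]
    exact ⟨u, fun y => by rw [hu, MulEquiv.symm_apply_apply]⟩
  choose U hU using h1
  have hext : ∀ u v : T n →ₗ[ℤ] M, (∀ y : (proj S).ker, u (johnson (kerEquivIA S y)) =
      v (johnson (kerEquivIA S y))) → u = v := fun u v h => linearMap_ext_johnson fun x => by
    have := h ((kerEquivIA S).symm x)
    rwa [MulEquiv.apply_symm_apply] at this
  refine ⟨⟨⟨U, fun z w => hext _ _ fun y => ?_⟩, fun r z => hext _ _ fun y => ?_⟩, hU⟩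
  · rw [LinearMap.add_apply, hU, hU, hU, map_add]
    rfl
  · refine (hU _ _).trans ((congrArg (fun f : Additive (proj S).ker →+ M => f (Additive.ofMul y))
      (LinearMap.map_smul (LHS.evH1 (proj S) M (proj_surjective S)) r z)).trans ?_)
    exact congrArg (fun m : M => r • m) (hU z y).symm

/-- The differentials `d_2^{p,1}` of the extension `IA_n → Γ → Γ̄` vanish. -/
theorem d_two_eq_zero (M : Rep.{0} ZHalf S) (p : ℕ) : LHS.d (proj S) M 2 p (p + 1) = 0 := by
  obtain ⟨U, hU⟩ := exists_classifying M
  let X : LHS.kerH1 (proj S) (proj_surjective S) M →ₗ[ZHalf] (preimage S → M) :=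
    { toFun := fun z g => extJohnson (U z) g
      map_add' := fun z w => funext fun g => by
        rw [map_add, extJohnson_add]
        rfl
      map_smul' := fun r z => funext fun g => by
        rw [map_smul, extJohnson_smul]
        rfl }
  have hX : ∀ z g, X z g = extJohnson (U z) (g : MulAut (F n)) := fun _ _ => rfl
  refine LHS.d_two_eq_zero (proj_surjective S) X (fun z g g' => ?_) (fun z y => ?_) p
  · rw [hX, hX, hX, Subgroup.coe_mul, extJohnson_mul, ← extJohnson_actInt]
    congr 2
    -- What is needed is `U z ∘ |g| = π g ∘ U ((π g)⁻¹ z)`. On Johnson images this is the formula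
    -- for the action on `H¹(ker π; M)` by conjugation.
    refine linearMap_ext_johnson fun x => ?_
    obtain ⟨y, rfl⟩ := (kerEquivIA S).surjective x
    rw [LinearMap.comp_apply, johnson_conj_apply _ _ _ (coe_conj_mem_IA g y)]
    change _ = M.ρ (proj S g) (U _ (johnson (kerEquivIA S y)))
    rw [hU, ← map_inv, LHS.evH1_ρ, map_inv, ← Module.End.mul_apply, ← map_mul, mul_inv_cancel,
      map_one, Module.End.one_apply, ← hU]
    congr 2
  · rw [hX, ← hU]
    exact extJohnson_coe _ (kerEquivIA S y)

/-! ### The first cohomology group -/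

/-- The cocycle of `Γ` extending `u ∘ τ₁`. -/
noncomputable def extCocycle (M : Rep.{0} ZHalf S) :
    invHom S M →ₗ[ZHalf] groupCohomology.cocycles₁ (Rep.res (proj S) M) where
  toFun u := ⟨fun g => extJohnson u.1 (g : MulAut (F n)),
    (groupCohomology.mem_cocycles₁_iff _).2 fun g h => by
      rw [Subgroup.coe_mul, extJohnson_mul, add_comm]
      congr 1
      change _ = M.ρ (proj S g) _
      rw [← extJohnson_actInt]
      congr 1
      exact LinearMap.ext fun t => u.2 (proj S g) t⟩
  map_add' u v := Subtype.ext (funext fun g => extJohnson_add _ _ _)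
  map_smul' r u := Subtype.ext (funext fun g => extJohnson_smul _ _ _)

/-- The inflation from `Γ̄` to `Γ` on cocycles. -/
noncomputable def inflCocycle (M : Rep.{0} ZHalf S) :
    groupCohomology.cocycles₁ M →ₗ[ZHalf] groupCohomology.cocycles₁ (Rep.res (proj S) M) :=
  (groupCohomology.mapCocycles₁ (proj S) (𝟙 (Rep.res (proj S) M))).hom

lemma map_H1π (M : Rep.{0} ZHalf S) (c : groupCohomology.cocycles₁ M) :
    groupCohomology.map (proj S) (𝟙 (Rep.res (proj S) M)) 1 (groupCohomology.H1π M c) =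
      groupCohomology.H1π (Rep.res (proj S) M) (inflCocycle M c) :=
  groupCohomology.H1π_comp_map_apply (proj S) (𝟙 (Rep.res (proj S) M)) c

/-- The map `Hom(H_ℤ^* ⊗ Λ² H_ℤ, M)^{Γ̄} ⊕ H¹(Γ̄; M) → H¹(Γ; M)`. -/
noncomputable def splitting (M : Rep.{0} ZHalf S) :
    (invHom S M × groupCohomology M 1) →ₗ[ZHalf] groupCohomology (Rep.res (proj S) M) 1 :=
  ((groupCohomology.H1π (Rep.res (proj S) M)).hom ∘ₗ extCocycle M).coprod
    (groupCohomology.map (proj S) (𝟙 (Rep.res (proj S) M)) 1).hom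

lemma splitting_apply (M : Rep.{0} ZHalf S) (u : invHom S M) (y : groupCohomology M 1) :
    splitting M (u, y) = groupCohomology.H1π (Rep.res (proj S) M) (extCocycle M u) +
      groupCohomology.map (proj S) (𝟙 (Rep.res (proj S) M)) 1 y :=
  rfl

lemma splitting_H1π (M : Rep.{0} ZHalf S) (u : invHom S M) (c : groupCohomology.cocycles₁ M) :
    splitting M (u, groupCohomology.H1π M c) =
      groupCohomology.H1π (Rep.res (proj S) M) (extCocycle M u + inflCocycle M c) := by
  rw [splitting_apply, map_H1π, map_add]

lemma mem_coboundaries₁ {k G : Type} [CommRing k] [Group G] {A : Rep.{0} k G} {f : G → A} :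
    f ∈ groupCohomology.coboundaries₁ A ↔ ∃ m : A, ∀ g, A.ρ g m - m = f g :=
  ⟨fun ⟨m, hm⟩ => ⟨m, fun g => congrFun hm g⟩, fun ⟨m, hm⟩ => ⟨m, funext hm⟩⟩

lemma splitting_zero_right (M : Rep.{0} ZHalf S) (u : invHom S M) :
    splitting M (u, 0) = groupCohomology.H1π (Rep.res (proj S) M) (extCocycle M u) :=
  (congrArg (fun z => groupCohomology.H1π (Rep.res (proj S) M) (extCocycle M u) + z)
    (LinearMap.map_zero (groupCohomology.map (proj S) (𝟙 (Rep.res (proj S) M)) 1).hom)).trans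
      (add_zero _)

/-- On `IA n` inflated cocycles vanish, and so do coboundaries, since `IA n` acts trivially on `M`;
restriction therefore recovers `u`. The remaining coboundary relation descends along the surjection
onto `Γ̄`. -/
lemma splitting_injective (M : Rep.{0} ZHalf S) : Function.Injective (splitting M) := by
  rintro ⟨u, y⟩ ⟨v, z⟩ h
  induction y using groupCohomology.H1_induction_on with | h c =>
  induction z using groupCohomology.H1_induction_on with | h d =>
  rw [splitting_H1π, splitting_H1π, groupCohomology.H1π_eq_iff] at h
  obtain ⟨m, hm⟩ := mem_coboundaries₁.1 h
  have hm' : ∀ g : preimage S, M.ρ (proj S g) m - m =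
      extJohnson u.1 (g : MulAut (F n)) + c (proj S g) -
        (extJohnson v.1 (g : MulAut (F n)) + d (proj S g)) := hm
  have huv : u = v := by
    refine Subtype.ext (linearMap_ext_johnson fun x => ?_)
    obtain ⟨y, rfl⟩ := (kerEquivIA S).surjective x
    have h1 := hm' y
    have hy : proj S (y : preimage S) = 1 := y.2
    rw [hy, map_one, groupCohomology.cocycles₁_map_one, groupCohomology.cocycles₁_map_one,
      add_zero, add_zero, Module.End.one_apply, sub_self, eq_comm, sub_eq_zero] at h1
    exact (extJohnson_coe u.1 (kerEquivIA S y)).symm.trans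
      (h1.trans (extJohnson_coe v.1 (kerEquivIA S y)))
  subst huv
  have hcd : groupCohomology.H1π M c = groupCohomology.H1π M d := by
    rw [groupCohomology.H1π_eq_iff]
    refine mem_coboundaries₁.2 ⟨m, fun A => ?_⟩
    obtain ⟨g, rfl⟩ := proj_surjective S A
    rw [hm', add_sub_add_left_eq_sub]
    rfl
  rw [hcd]

/-- The restriction of a cocycle to `IA n` has the form `u ∘ τ₁`, and `u` is equivariant because the
cocycle is defined on all of `Γ`. Subtracting `extCocycle` leaves a cocycle that vanishes on the
kernel, hence is constant on its cosets and comes from `Γ̄`. -/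
lemma splitting_surjective (M : Rep.{0} ZHalf S) : Function.Surjective (splitting M) := by
  intro x
  induction x using groupCohomology.H1_induction_on with
  | h f =>
    have hf : ∀ g h : preimage S, f (g * h) = M.ρ (proj S g) (f h) + f g :=
      (groupCohomology.mem_cocycles₁_iff _).1 f.2
    have hf1 : f 1 = 0 := groupCohomology.cocycles₁_map_one f
    have hker : ∀ (y : (proj S).ker) (m : M), M.ρ (proj S (y : preimage S)) m = m :=
      LHS.ρ_ker (proj S) M
    obtain ⟨u, hu⟩ := exists_linearMap_johnson
      (fun x : IA n => f (((kerEquivIA S).symm x : (proj S).ker) : preimage S)) fun x y => by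
        rw [map_mul, Subgroup.coe_mul, hf, hker, add_comm]
    have hu' : ∀ y : (proj S).ker, u (johnson (kerEquivIA S y)) = f (y : preimage S) := fun y => by
      rw [hu, MulEquiv.symm_apply_apply]
    have hinv : u ∈ invHom S M := by
      intro A
      obtain ⟨g, rfl⟩ := proj_surjective S A
      suffices h : u ∘ₗ repT n (abs n (g : MulAut (F n))) = actInt M (proj S g) ∘ₗ u from
        fun t => DFunLike.congr_fun h t
      refine linearMap_ext_johnson fun x => ?_
      obtain ⟨y, rfl⟩ := (kerEquivIA S).surjective x
      rw [LinearMap.comp_apply, johnson_conj_apply _ _ _ (coe_conj_mem_IA g y)]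
      change _ = M.ρ (proj S g) (u (johnson (kerEquivIA S y)))
      have h2 : (⟨_, coe_conj_mem_IA g y⟩ : IA n) =
          kerEquivIA S (LHS.kerConj (proj S) g⁻¹ y) := by
        refine Subtype.ext ?_
        change _ = ((LHS.kerConj (proj S) g⁻¹ y : preimage S) : MulAut (F n))
        rw [LHS.kerConj_coe, inv_inv]
        rfl
      rw [h2, hu', hu', LHS.kerConj_coe, inv_inv, mul_assoc, hf, hf, hker, map_add]
      have h3 := hf g g⁻¹
      rw [mul_inv_cancel, hf1] at h3
      rw [add_right_comm, ← h3, zero_add]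
    let e : groupCohomology.cocycles₁ (Rep.res (proj S) M) := f - extCocycle M ⟨u, hinv⟩
    have he : ∀ g h : preimage S, e (g * h) = M.ρ (proj S g) (e h) + e g :=
      (groupCohomology.mem_cocycles₁_iff _).1 e.2
    have he0 : ∀ y : (proj S).ker, e (y : preimage S) = 0 := fun y => by
      change f (y : preimage S) - extJohnson u (kerEquivIA S y : MulAut (F n)) = 0
      rw [extJohnson_coe, hu', sub_self]
    have hee : ∀ g g' : preimage S, proj S g = proj S g' → e g = e g' := fun g g' h => by
      obtain ⟨y, rfl⟩ := LHS.exists_mul_ker h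
      rw [he, he0, map_zero, zero_add]
    let σ : S → preimage S := Function.surjInv (proj_surjective S)
    have hσ : ∀ A, proj S (σ A) = A := Function.surjInv_eq (proj_surjective S)
    let c : groupCohomology.cocycles₁ M := ⟨fun A => e (σ A),
      (groupCohomology.mem_cocycles₁_iff _).2 fun A B => by
        rw [hee _ (σ A * σ B) (by rw [map_mul, hσ, hσ, hσ]), he, hσ]⟩
    refine ⟨(⟨u, hinv⟩, groupCohomology.H1π M c), ?_⟩
    rw [splitting_H1π]
    congr 1
    refine groupCohomology.cocycles₁_ext fun g => ?_
    change extCocycle M ⟨u, hinv⟩ g + e (σ (proj S g)) = f g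
    rw [hee _ g (hσ _)]
    exact add_sub_cancel _ _

lemma splitting_natural {M N : Rep.{0} ZHalf S} (φ : M ⟶ N) (u : invHom S M)
    (y : groupCohomology M 1) :
    (groupCohomology.functor ZHalf (preimage S) 1).map ((Rep.resFunctor (proj S)).map φ)
        (splitting M (u, y)) =
      splitting N (invHomMap φ u, (groupCohomology.functor ZHalf S 1).map φ y) := by
  induction y using groupCohomology.H1_induction_on with
  | h c =>
    have h1 : (groupCohomology.functor ZHalf S 1).map φ (groupCohomology.H1π M c) =
        groupCohomology.H1π N (groupCohomology.mapCocycles₁ (MonoidHom.id S) φ c) :=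
      groupCohomology.H1π_comp_map_apply (A := M) (B := N) (MonoidHom.id S) φ c
    have h2 : ∀ c, (groupCohomology.functor ZHalf (preimage S) 1).map
        ((Rep.resFunctor (proj S)).map φ) (groupCohomology.H1π (Rep.res (proj S) M) c) =
          groupCohomology.H1π (Rep.res (proj S) N) (groupCohomology.mapCocycles₁
            (MonoidHom.id (preimage S)) ((Rep.resFunctor (proj S)).map φ) c) := fun c =>
      groupCohomology.H1π_comp_map_apply (A := Rep.res (proj S) M)
        (B := Rep.res (proj S) N) (MonoidHom.id (preimage S)) ((Rep.resFunctor (proj S)).map φ) c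
    rw [h1, splitting_H1π, splitting_H1π, h2]
    congr 1
    refine groupCohomology.cocycles₁_ext fun g => ?_
    change φ.hom (extJohnson u.1 (g : MulAut (F n)) + c (proj S g)) =
      extJohnson (invHomMap φ u).1 (g : MulAut (F n)) + φ.hom (c (proj S g))
    rw [map_add]
    congr 1
    exact map_smul φ.hom half (u.1 (crossed (g : MulAut (F n))))

end AutFree

/-! ### Vanishing differentials and the splitting, assembled -/

theorem proposition6p3 (n : ℕ) (hn : 2 ≤ n)
    (S : Subgroup (LinearMap.GeneralLinearGroup ℤ (AutFree.H n))) :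
    ∃ hπ : Function.Surjective (AutFree.proj S),
      (∀ (M : Rep.{0} AutFree.ZHalf S) (p : ℕ),
        ∃ (e₁ : LHS.E (AutFree.proj S) M 2 p (p + 1) ≃ₗ[AutFree.ZHalf]
            groupCohomology (LHS.kerH1 (AutFree.proj S) hπ M) p)
          (e₀ : LHS.E (AutFree.proj S) M 2 (p + 2) (p + 2) ≃ₗ[AutFree.ZHalf]
            groupCohomology M (p + 2)),
          LHS.IsEdgeOne (AutFree.proj S) hπ M p e₁ ∧
          LHS.IsEdgeZero (AutFree.proj S) M (p + 2) e₀ ∧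
          e₀.toLinearMap ∘ₗ LHS.d (AutFree.proj S) M 2 p (p + 1) ∘ₗ e₁.symm.toLinearMap = 0) ∧
      ∃ Φ : ∀ M : Rep.{0} AutFree.ZHalf S,
          (AutFree.invHom S M × groupCohomology M 1) ≃ₗ[AutFree.ZHalf]
            groupCohomology (Rep.res (AutFree.proj S) M) 1,
        (∀ (M : Rep.{0} AutFree.ZHalf S) (y : groupCohomology M 1),
          Φ M (0, y) =
            groupCohomology.map (AutFree.proj S) (𝟙 (Rep.res (AutFree.proj S) M)) 1 y) ∧
        (∀ (M : Rep.{0} AutFree.ZHalf S) (u : AutFree.invHom S M),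
          ∃ c : groupCohomology.cocycles₁ (LHS.kerRes (AutFree.proj S) M),
            (∀ x, c x = u.1 (AutFree.johnson (AutFree.kerEquivIA S x))) ∧
            groupCohomology.map (AutFree.proj S).ker.subtype
              (𝟙 (LHS.kerRes (AutFree.proj S) M)) 1 (Φ M (u, 0)) =
              groupCohomology.H1π (LHS.kerRes (AutFree.proj S) M) c) ∧
        (∀ (M N : Rep.{0} AutFree.ZHalf S) (φ : M ⟶ N) (u : AutFree.invHom S M)
          (y : groupCohomology M 1),
          (groupCohomology.functor AutFree.ZHalf (AutFree.preimage S) 1).map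
              ((Rep.resFunctor (AutFree.proj S)).map φ) (Φ M (u, y)) =
            Φ N (AutFree.invHomMap φ u,
              (groupCohomology.functor AutFree.ZHalf S 1).map φ y)) := by
  refine ⟨AutFree.proj_surjective S, fun M p => ?_, fun M => LinearEquiv.ofBijective
    (AutFree.splitting M) ⟨AutFree.splitting_injective M, AutFree.splitting_surjective M⟩,
    fun M y => ?_, fun M u => ?_, fun M N φ u y => AutFree.splitting_natural φ u y⟩
  · obtain ⟨e₁, he₁, -⟩ := LHS.exists_edgeOne (AutFree.proj S) (AutFree.proj_surjective S) M p
    obtain ⟨e₀, he₀⟩ := LHS.exists_edgeZero (AutFree.proj S) (AutFree.proj_surjective S) M p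
    refine ⟨e₁, e₀, he₁, he₀, ?_⟩
    rw [AutFree.d_two_eq_zero, LinearMap.zero_comp, LinearMap.comp_zero]
  · change AutFree.splitting M (0, y) = _
    rw [AutFree.splitting_apply, map_zero, map_zero, zero_add]
  · refine ⟨groupCohomology.mapCocycles₁ (AutFree.proj S).ker.subtype
      (𝟙 (LHS.kerRes (AutFree.proj S) M)) (AutFree.extCocycle M u),
      fun x => AutFree.extJohnson_coe u.1 (AutFree.kerEquivIA S x), ?_⟩
    change groupCohomology.map (AutFree.proj S).ker.subtype
      (𝟙 (LHS.kerRes (AutFree.proj S) M)) 1 (AutFree.splitting M (u, 0)) = _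
    rw [AutFree.splitting_zero_right]
    exact groupCohomology.H1π_comp_map_apply (A := Rep.res (AutFree.proj S) M)
      (B := LHS.kerRes (AutFree.proj S) M) (AutFree.proj S).ker.subtype
      (𝟙 (LHS.kerRes (AutFree.proj S) M)) (AutFree.extCocycle M u)
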